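/- Let $l\ge 2$ and $1\le j\le l-1$ be integers, let $g_2(s)=12(9-8s)$ and $g_3(s)=-8(8s^2-36s+27)$, and consider the elliptic surface $$X:\ -12y^2=4x^3-g_2(t^l)x-g_3(t^l)$$ fibred over the $t$-line. For $0<t<1$ the cubic $4x^3-g_2(t^l)x-g_3(t^l)$ has three real roots $r_1(t)<r_2(t)<r_3(t)$. Let $\delta_1(t)$, resp. $\delta_0(t)$, be the closed curve on the fibre over $t$ lying doubly over the segment $[r_1(t),r_2(t)]$, resp. $[r_2(t),r_3(t)]$, of the $x$-line; these are the vanishing cycles as $t\to 1$, resp. $t\to 0$. They are oriented so that $\int_{\delta_1(t)}dx/y\in i\,\mathbb R_{>0}$ and $\int_{\delta_0(t)}dx/y\in\mathbb R_{<0}$. Let $\Delta$, resp. $\Gamma$, be the 2-chain on $X$ fibred over the segment $0<t<1$ with fibres $\delta_1(t)$, resp. $\delta_0(t)$, oriented by $t$ followed by the orientation of the fibre. Let $\left(\frac{\cdot}{3}\right)$ be the Legendre symbol and put, as power series in $q$, $$E_{3a}=1-9\sum_{n\ge1}\Big(\sum_{k\mid n}\Big(\frac k3\Big)k^2\Big)q^n,\qquad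 E_{3b}=\sum_{n\ge1}\Big(\sum_{k\mid n}\Big(\frac{n/k}3\Big)k^2\Big)q^n .$$ Define rational numbers $a_n(j)$, $b_n(j)$ by $$E_{3b}\Big(\frac{E_{3a}}{E_{3a}+27E_{3b}}\Big)^{j/l}=\sum_{n\ge1}a_n(j)q^n,\qquad E_{3a}\Big(\frac{E_{3b}}{q(E_{3a}+27E_{3b})}\Big)^{j/l}=\sum_{n\ge0}b_n(j)q^n,$$ where the powers are those with constant coefficient $1$. Their expansions begin $$q+\Big(3-27\frac jl\Big)q^2+\Big(9-\frac{81j}{2l}+\frac{729}2\Big(\frac jl\Big)^2\Big)q^3+\cdots,\qquad 1+\Big(-9-15\frac jl\Big)q+\Big(27+\frac{387j}{2l}+\frac{225}2\Big(\frac jl\Big)^2\Big)q^2+\cdots .$$ Put $c=\exp(-2\pi/\sqrt3)$ and $$I(j)=\sum_{n=1}^\infty\frac{a_n(j)}nc^n+3^{3j/l-3}\sum_{n=0}^\infty b_n(j)\Big(\frac1{n+j/l}+\frac{\sqrt3}{2\pi(n+j/l)^2}\Big)c^{n+j/l},$$ $$J(j)=\sum_{n=1}^\infty a_n(j)\Big(\frac{2\pi}{\sqrt3\,n}+\frac1{n^2}\Big)c^n+2\pi\cdot3^{3j/l-7/2}\sum_{n=0}^\infty\frac{b_n(j)}{n+j/l}c^{n+j/l}.$$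 Then these four series converge, the following integrals converge absolutely, and $$\int_\Delta t^{j-1}dt\,\frac{dx}y=\frac{54\pi i}l\,I(j),\qquad \int_\Gamma t^{j-1}dt\,\frac{dx}y=\frac{-27}l\,J(j).$$ -/

import Mathlib

namespace EllipticPeriods

open MeasureTheory

/-! ### The elliptic fibration -/

/-- The coefficient `g₂(s) = 12 (9 - 8 s)`. -/
def g₂ {R : Type*} [CommRing R] (s : R) : R := 12 * (9 - 8 * s)

/-- The coefficient `g₃(s) = -8 (8 s² - 36 s + 27)`. -/
def g₃ {R : Type*} [CommRing R] (s : R) : R := -8 * (8 * s ^ 2 - 36 * s + 27)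

/-- The affine surface `-12 y² = 4 x³ - g₂(t^l) x - g₃(t^l)` in coordinates `(x, y, t)`. -/
def surface (l : ℕ) : Set (ℂ × ℂ × ℂ) :=
  {p | -12 * p.2.1 ^ 2 = 4 * p.1 ^ 3 - g₂ (p.2.2 ^ l) * p.1 - g₃ (p.2.2 ^ l)}

/-- The affine Weierstrass curve `-12 y² = 4 x³ - g₂(s) x - g₃(s)`; the fibre of `surface l` over
`t` is `fibre (t ^ l)`. -/
def fibre (s : ℂ) : Set (ℂ × ℂ) :=
  {p | -12 * p.2 ^ 2 = 4 * p.1 ^ 3 - g₂ s * p.1 - g₃ s}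

/-! ### The real roots of the cubic `4 x³ - g₂(s) x - g₃(s)`

For `0 < s < 1` the cubic has three real roots `root₁ s < root₂ s < root₃ s`.  They are given here
by the trigonometric solution of the cubic; that they are the roots, in this order, is proved in
`cubic_eq`, `root₁_lt_root₂` and `root₂_lt_root₃`. -/

/-- The angle in the trigonometric solution of the cubic. -/
noncomputable def angle (s : ℝ) : ℝ :=
  Real.arccos (-(8 * s ^ 2 - 36 * s + 27) / √(9 - 8 * s) ^ 3) / 3

/-- The smallest root. -/
noncomputable def root₁ (s : ℝ) : ℝ := 2 * √(9 - 8 * s) * Real.cos (angle s + 2 * Real.pi / 3)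

/-- The middle root. -/
noncomputable def root₂ (s : ℝ) : ℝ := 2 * √(9 - 8 * s) * Real.cos (angle s - 2 * Real.pi / 3)

/-- The largest root. -/
noncomputable def root₃ (s : ℝ) : ℝ := 2 * √(9 - 8 * s) * Real.cos (angle s)

theorem sqrt_sq_eq {s : ℝ} (hs : s ≤ 1) : √(9 - 8 * s) ^ 2 = 9 - 8 * s :=
  Real.sq_sqrt (by linarith)

theorem sqrt_pos' {s : ℝ} (hs : s ≤ 1) : 0 < √(9 - 8 * s) := Real.sqrt_pos.2 (by linarith)

theorem disc_eq {s : ℝ} (hs : s ≤ 1) :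
    (√(9 - 8 * s) ^ 3) ^ 2 - (8 * s ^ 2 - 36 * s + 27) ^ 2 = 64 * s ^ 3 * (1 - s) := by
  have h := sqrt_sq_eq hs
  have : (√(9 - 8 * s) ^ 3) ^ 2 = (√(9 - 8 * s) ^ 2) ^ 3 := by ring
  rw [this, h]; ring

theorem cos_three_angle {s : ℝ} (h0 : 0 ≤ s) (h1 : s ≤ 1) :
    √(9 - 8 * s) ^ 3 * Real.cos (3 * angle s) = -(8 * s ^ 2 - 36 * s + 27) := by
  have hw := pow_pos (sqrt_pos' h1) 3
  have hd := disc_eq h1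
  have hn : 0 ≤ 64 * s ^ 3 * (1 - s) := by
    have : 0 ≤ 1 - s := by linarith
    positivity
  have hab : |-(8 * s ^ 2 - 36 * s + 27)| ≤ √(9 - 8 * s) ^ 3 := by
    apply abs_le_of_sq_le_sq _ hw.le
    nlinarith
  obtain ⟨ha, hb⟩ := abs_le.1 hab
  have : 3 * angle s = Real.arccos (-(8 * s ^ 2 - 36 * s + 27) / √(9 - 8 * s) ^ 3) := by
    unfold angle; ring
  rw [this, Real.cos_arccos]
  · rw [mul_comm]; exact div_mul_cancel₀ _ hw.ne'
  · rw [le_div_iff₀ hw]; linarith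
  · rw [div_le_iff₀ hw]; linarith

theorem angle_mem {s : ℝ} (h0 : 0 < s) (h1 : s < 1) : 0 < angle s ∧ angle s < Real.pi / 3 := by
  have hw := pow_pos (sqrt_pos' h1.le) 3
  have hd := disc_eq h1.le
  have hn : 0 < 64 * s ^ 3 * (1 - s) := by
    have : 0 < 1 - s := by linarith
    positivity
  have hab : |-(8 * s ^ 2 - 36 * s + 27)| < √(9 - 8 * s) ^ 3 := by
    apply abs_lt_of_sq_lt_sq _ hw.le
    nlinarith
  obtain ⟨ha, hb⟩ := abs_lt.1 hab
  unfold angle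
  constructor
  · have := Real.arccos_pos.2 (show -(8 * s ^ 2 - 36 * s + 27) / √(9 - 8 * s) ^ 3 < 1 by
      rw [div_lt_iff₀ hw]; linarith)
    positivity
  · have : Real.arccos (-(8 * s ^ 2 - 36 * s + 27) / √(9 - 8 * s) ^ 3) < Real.pi := by
      rw [← Real.arccos_neg_one]
      apply Real.arccos_lt_arccos
      · norm_num
      · rw [lt_div_iff₀ hw]; linarith
      · rw [div_le_iff₀ hw]; linarith
    linarith

theorem cos_add_two_pi_div_three (a : ℝ) :
    Real.cos (a + 2 * Real.pi / 3) = -Real.cos a / 2 - √3 / 2 * Real.sin a := by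
  have e : 2 * Real.pi / 3 = Real.pi - Real.pi / 3 := by ring
  rw [Real.cos_add, e, Real.cos_pi_sub, Real.sin_pi_sub, Real.cos_pi_div_three,
    Real.sin_pi_div_three]
  ring

theorem cos_sub_two_pi_div_three (a : ℝ) :
    Real.cos (a - 2 * Real.pi / 3) = -Real.cos a / 2 + √3 / 2 * Real.sin a := by
  have e : 2 * Real.pi / 3 = Real.pi - Real.pi / 3 := by ring
  rw [Real.cos_sub, e, Real.cos_pi_sub, Real.sin_pi_sub, Real.cos_pi_div_three,
    Real.sin_pi_div_three]
  ring

theorem root_sum (s : ℝ) : root₁ s + root₂ s + root₃ s = 0 := by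
  unfold root₁ root₂ root₃
  rw [cos_add_two_pi_div_three, cos_sub_two_pi_div_three]; ring

theorem root_pairs {s : ℝ} (h1 : s ≤ 1) :
    4 * (root₁ s * root₂ s + root₁ s * root₃ s + root₂ s * root₃ s) = -g₂ s := by
  have hw := sqrt_sq_eq h1
  have h3 : √3 ^ 2 = (3 : ℝ) := Real.sq_sqrt (by norm_num)
  have hsc := Real.sin_sq_add_cos_sq (angle s)
  unfold root₁ root₂ root₃ g₂
  rw [cos_add_two_pi_div_three, cos_sub_two_pi_div_three]
  linear_combination (-4 * √(9 - 8 * s) ^ 2 * Real.sin (angle s) ^ 2) * h3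
    - 12 * √(9 - 8 * s) ^ 2 * hsc - 12 * hw

theorem root_prod {s : ℝ} (h0 : 0 ≤ s) (h1 : s ≤ 1) :
    4 * (root₁ s * root₂ s * root₃ s) = g₃ s := by
  have hc := cos_three_angle h0 h1
  rw [Real.cos_three_mul] at hc
  have h3 : √3 ^ 2 = (3 : ℝ) := Real.sq_sqrt (by norm_num)
  have hsc := Real.sin_sq_add_cos_sq (angle s)
  unfold root₁ root₂ root₃ g₃
  rw [cos_add_two_pi_div_three, cos_sub_two_pi_div_three]
  linear_combination 8 * hc
    + (-8 * √(9 - 8 * s) ^ 3 * Real.cos (angle s) * Real.sin (angle s) ^ 2) * h3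
    + (-24 * √(9 - 8 * s) ^ 3 * Real.cos (angle s)) * hsc

theorem cubic_eq {s : ℝ} (h0 : 0 ≤ s) (h1 : s ≤ 1) (x : ℂ) :
    4 * x ^ 3 - g₂ (s : ℂ) * x - g₃ (s : ℂ) = 4 * (x - root₁ s) * (x - root₂ s) * (x - root₃ s) := by
  have e1 : (root₁ s : ℂ) + root₂ s + root₃ s = 0 := by exact_mod_cast root_sum s
  have e2 : 4 * ((root₁ s : ℂ) * root₂ s + root₁ s * root₃ s + root₂ s * root₃ s)
      = -g₂ (s : ℂ) := by
    have := root_pairs h1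
    unfold g₂ at this ⊢
    exact_mod_cast this
  have e3 : 4 * ((root₁ s : ℂ) * root₂ s * root₃ s) = g₃ (s : ℂ) := by
    have := root_prod h0 h1
    unfold g₃ at this ⊢
    exact_mod_cast this
  linear_combination (4 * x ^ 2) * e1 - x * e2 + e3

theorem root₁_lt_root₂ {s : ℝ} (h0 : 0 < s) (h1 : s < 1) : root₁ s < root₂ s := by
  obtain ⟨ha, hb⟩ := angle_mem h0 h1
  have hw := sqrt_pos' h1.le
  have hS : 0 < Real.sin (angle s) :=
    Real.sin_pos_of_pos_of_lt_pi ha (by linarith [Real.pi_pos])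
  unfold root₁ root₂
  rw [cos_add_two_pi_div_three, cos_sub_two_pi_div_three]
  have : 0 < √3 / 2 * Real.sin (angle s) := by positivity
  apply mul_lt_mul_of_pos_left _ (by positivity)
  linarith

theorem root₂_lt_root₃ {s : ℝ} (h0 : 0 < s) (h1 : s < 1) : root₂ s < root₃ s := by
  obtain ⟨ha, hb⟩ := angle_mem h0 h1
  have hw := sqrt_pos' h1.le
  unfold root₂ root₃
  apply mul_lt_mul_of_pos_left _ (by positivity)
  rw [← Real.cos_neg (angle s - 2 * Real.pi / 3)]
  apply Real.cos_lt_cos_of_nonneg_of_le_pi <;> linarith [Real.pi_pos]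

theorem continuousOn_angle : ContinuousOn angle (Set.Iic 1) := by
  unfold angle
  refine ContinuousOn.div_const (Real.continuous_arccos.comp_continuousOn ?_) _
  refine ContinuousOn.div (by fun_prop) (by fun_prop) fun s hs => ?_
  exact (pow_pos (sqrt_pos' hs) 3).ne'

theorem continuousOn_root₁ : ContinuousOn root₁ (Set.Iic 1) := by
  have := continuousOn_angle
  unfold root₁; fun_prop

theorem continuousOn_root₂ : ContinuousOn root₂ (Set.Iic 1) := by
  have := continuousOn_angle
  unfold root₂; fun_prop

theorem continuousOn_root₃ : ContinuousOn root₃ (Set.Iic 1) := by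
  have := continuousOn_angle
  unfold root₃; fun_prop

theorem angle_zero : angle 0 = Real.pi / 3 := by
  have h9 : √(9 : ℝ) = 3 := by
    rw [show (9 : ℝ) = 3 ^ 2 by norm_num]; exact Real.sqrt_sq (by norm_num)
  unfold angle
  norm_num [h9]

theorem angle_one : angle 1 = 0 := by
  unfold angle
  norm_num

theorem root₁_one : root₁ 1 = -1 := by
  unfold root₁
  rw [cos_add_two_pi_div_three, angle_one]; norm_num

theorem root₂_one : root₂ 1 = -1 := by
  unfold root₂
  rw [cos_sub_two_pi_div_three, angle_one]; norm_num

theorem root₃_zero : root₃ 0 = 3 := by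
  have h9 : √(9 : ℝ) = 3 := by
    rw [show (9 : ℝ) = 3 ^ 2 by norm_num]; exact Real.sqrt_sq (by norm_num)
  unfold root₃
  rw [angle_zero]; norm_num [h9]

theorem root₂_zero : root₂ 0 = 3 := by
  have h9 : √(9 : ℝ) = 3 := by
    rw [show (9 : ℝ) = 3 ^ 2 by norm_num]; exact Real.sqrt_sq (by norm_num)
  unfold root₂
  rw [angle_zero, show Real.pi / 3 - 2 * Real.pi / 3 = -(Real.pi / 3) by ring, Real.cos_neg]
  norm_num [h9]

/-! ### Vanishing cycles and Lefschetz thimbles -/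

/-- A family, over `0 < s < 1`, of vanishing cycles of the fibration by the curves `fibre s` at
`s = P`, where `fibre P` has the node `(x₀, 0)`.  The cycle over `s` is a simple closed curve on
`fibre s`, parametrized by the angle `θ`, which contracts to the node as `s → P`.  It is stable
under the elliptic involution `(x, y) ↦ (x, -y)`, so that it is the double cover of an arc in the
`x`-plane joining two branch points, and hence is not contractible on `fibre s`. -/
structure VanishingCycle (P : ℝ) (x₀ : ℂ) where
  toFun : ℝ → ℝ → ℂ × ℂ
  node : (x₀, 0) ∈ fibre P ∧ 12 * x₀ ^ 2 - g₂ (P : ℂ) = 0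
  mem_fibre : ∀ s ∈ Set.Ioo (0 : ℝ) 1, ∀ θ, toFun s θ ∈ fibre s
  periodic : ∀ s, Function.Periodic (toFun s) (2 * Real.pi)
  contDiff : ∀ s ∈ Set.Ioo (0 : ℝ) 1, ContDiff ℝ 1 (toFun s)
  continuousOn : ContinuousOn (Function.uncurry toFun) (Set.Ioo 0 1 ×ˢ Set.univ)
  injOn : ∀ s ∈ Set.Ioo (0 : ℝ) 1, Set.InjOn (toFun s) (Set.Ico 0 (2 * Real.pi))
  involution : ∀ s θ, toFun s (-θ) = ((toFun s θ).1, -(toFun s θ).2)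
  vanishes : TendstoUniformly toFun (fun _ => (x₀, 0)) (nhdsWithin P (Set.Ioo 0 1))

/-- The `x`-coordinate of an oval over the segment `[a, b]`: it runs from `a` to `b` for
`0 ≤ θ ≤ π` and back for `π ≤ θ ≤ 2π`. -/
noncomputable def ovalX (a b θ : ℝ) : ℝ := (a + b) / 2 - (b - a) / 2 * Real.cos θ

/-- For real `a < b` and `c` outside `[a, b]`, and `ε ^ 2 = ±1`, the closed curve on
`-12 y² = 4 (x - a) (x - b) (x - c)` lying over the segment `[a, b]` of the `x`-line; here
`ε ^ 2 = -1` if `b < c` and `ε ^ 2 = 1` if `c < a`.  On the half `0 < θ < π`, on which `x` runs from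
`a` to `b`, `y` is a positive multiple of `ε`. -/
noncomputable def oval (a b c : ℝ) (ε : ℂ) (θ : ℝ) : ℂ × ℂ :=
  ((ovalX a b θ : ℂ), ε * ((b - a) / 2 * Real.sin θ * √(|c - ovalX a b θ| / 3) : ℝ))

theorem ovalX_mem {a b : ℝ} (hab : a ≤ b) (θ : ℝ) : a ≤ ovalX a b θ ∧ ovalX a b θ ≤ b := by
  have h1 := Real.neg_one_le_cos θ
  have h2 := Real.cos_le_one θ
  unfold ovalX
  constructor <;> nlinarith

theorem ovalX_mul (a b θ : ℝ) :
    (ovalX a b θ - a) * (b - ovalX a b θ) = ((b - a) / 2 * Real.sin θ) ^ 2 := by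
  have := Real.sin_sq_add_cos_sq θ
  unfold ovalX
  linear_combination (-((b - a) / 2) ^ 2) * this

theorem oval_eq {a b c : ℝ} {ε : ℂ} (hab : a < b)
    (hc : (b < c ∧ ε ^ 2 = -1) ∨ (c < a ∧ ε ^ 2 = 1)) (θ : ℝ) :
    -12 * (oval a b c ε θ).2 ^ 2 =
      4 * ((oval a b c ε θ).1 - a) * ((oval a b c ε θ).1 - b) * ((oval a b c ε θ).1 - c) := by
  have hx := ovalX_mem hab.le θ
  have hm := ovalX_mul a b θ
  have hs : √(|c - ovalX a b θ| / 3) ^ 2 = |c - ovalX a b θ| / 3 := Real.sq_sqrt (by positivity)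
  have hm' : ((ovalX a b θ : ℂ) - a) * (b - ovalX a b θ) = (((b - a) / 2 * Real.sin θ : ℝ) : ℂ) ^ 2 := by
    exact_mod_cast hm
  have hs' : ((√(|c - ovalX a b θ| / 3) : ℝ) : ℂ) ^ 2 = (|c - ovalX a b θ| : ℝ) / 3 := by
    exact_mod_cast hs
  simp only [oval]
  rw [Complex.ofReal_mul, mul_pow, mul_pow, ← hm', hs']
  rcases hc with ⟨h, hε⟩ | ⟨h, hε⟩
  · rw [hε, abs_of_pos (by linarith)]; push_cast; ring
  · rw [hε, abs_of_neg (by linarith)]; push_cast; ring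

theorem oval_periodic (a b c : ℝ) (ε : ℂ) : Function.Periodic (oval a b c ε) (2 * Real.pi) := by
  intro θ
  simp [oval, ovalX]

theorem oval_neg (a b c : ℝ) (ε : ℂ) (θ : ℝ) :
    oval a b c ε (-θ) = ((oval a b c ε θ).1, -(oval a b c ε θ).2) := by
  simp [oval, ovalX]

theorem oval_ne {a b c : ℝ} (hab : a < b) (hc : b < c ∨ c < a) (θ : ℝ) :
    c - ovalX a b θ ≠ 0 := by
  have hx := ovalX_mem hab.le θ
  rcases hc with h | h
  · have : 0 < c - ovalX a b θ := by linarith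
    exact this.ne'
  · have : c - ovalX a b θ < 0 := by linarith
    exact this.ne

theorem oval_contDiff {a b c : ℝ} (ε : ℂ) (hab : a < b) (hc : b < c ∨ c < a) :
    ContDiff ℝ 1 (oval a b c ε) := by
  have hX : ContDiff ℝ 1 (ovalX a b) := by unfold ovalX; fun_prop
  have hd : ContDiff ℝ 1 (fun θ => c - ovalX a b θ) := contDiff_const.sub hX
  have hA : ContDiff ℝ 1 (fun θ => |c - ovalX a b θ|) := by
    rw [contDiff_iff_contDiffAt]
    intro θ
    exact (contDiffAt_abs (oval_ne hab hc θ)).comp θ hd.contDiffAt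
  have hS : ContDiff ℝ 1 (fun θ => √(|c - ovalX a b θ| / 3)) := by
    refine (hA.div_const 3).sqrt fun θ => ?_
    have := abs_pos.2 (oval_ne hab hc θ)
    positivity
  unfold oval
  refine ContDiff.prodMk (Complex.ofRealCLM.contDiff.comp hX) ?_
  refine contDiff_const.mul (Complex.ofRealCLM.contDiff.comp ?_)
  exact (contDiff_const.mul Real.contDiff_sin).mul hS

theorem oval_injOn {a b c : ℝ} {ε : ℂ} (hε : ε ≠ 0) (hab : a < b) (hc : b < c ∨ c < a) :
    Set.InjOn (oval a b c ε) (Set.Ico 0 (2 * Real.pi)) := by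
  intro θ hθ ψ hψ h
  have hx : ovalX a b θ = ovalX a b ψ := by
    have := congrArg Prod.fst h
    simpa [oval] using this
  have hcos : Real.cos θ = Real.cos ψ := by
    unfold ovalX at hx
    have : (b - a) / 2 ≠ 0 := by
      have : 0 < b - a := by linarith
      positivity
    have h2 : (b - a) / 2 * Real.cos θ = (b - a) / 2 * Real.cos ψ := by linarith
    exact mul_left_cancel₀ this h2
  have hsin : Real.sin θ = Real.sin ψ := by
    have h2 := congrArg Prod.snd h
    simp only [oval] at h2
    rw [hx] at h2
    have h3 := Complex.ofReal_injective (mul_left_cancel₀ hε h2)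
    have hs : √(|c - ovalX a b ψ| / 3) ≠ 0 := by
      have := abs_pos.2 (oval_ne hab hc ψ)
      positivity
    have h4 := mul_right_cancel₀ hs h3
    have : (b - a) / 2 ≠ 0 := by
      have : 0 < b - a := by linarith
      positivity
    exact mul_left_cancel₀ this h4
  have hang := Real.Angle.cos_sin_inj hcos hsin
  rw [Real.Angle.angle_eq_iff_two_pi_dvd_sub] at hang
  obtain ⟨k, hk⟩ := hang
  have hpi := Real.pi_pos
  have hk1 : (k : ℝ) < 1 := by
    by_contra hcon
    push Not at hcon
    nlinarith [hθ.2, hψ.1]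
  have hk2 : (-1 : ℝ) < k := by
    by_contra hcon
    push Not at hcon
    nlinarith [hθ.1, hψ.2]
  have hk0 : k = 0 := by
    have h1 : k < 1 := by exact_mod_cast hk1
    have h2 : -1 < k := by exact_mod_cast hk2
    omega
  rw [hk0] at hk
  simp at hk
  linarith

theorem oval_continuousOn {a b c : ℝ → ℝ} (ε : ℂ) {S : Set ℝ} (ha : ContinuousOn a S)
    (hb : ContinuousOn b S) (hc : ContinuousOn c S) :
    ContinuousOn (Function.uncurry fun s θ => oval (a s) (b s) (c s) ε θ) (S ×ˢ Set.univ) := by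
  have h1 : Set.MapsTo (Prod.fst : ℝ × ℝ → ℝ) (S ×ˢ Set.univ) S := fun p hp => hp.1
  have ha' := ha.comp continuousOn_fst h1
  have hb' := hb.comp continuousOn_fst h1
  have hc' := hc.comp continuousOn_fst h1
  simp only [Function.comp_def] at ha' hb' hc'
  have hX : ContinuousOn (fun p : ℝ × ℝ => ovalX (a p.1) (b p.1) p.2) (S ×ˢ Set.univ) := by
    unfold ovalX; fun_prop
  unfold oval Function.uncurry
  refine ContinuousOn.prodMk (Complex.continuous_ofReal.comp_continuousOn hX) ?_
  refine continuousOn_const.mul (Complex.continuous_ofReal.comp_continuousOn ?_)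
  fun_prop

theorem oval_vanishes {a b c : ℝ → ℝ} {ε : ℂ} (hε : ‖ε‖ = 1) {P x₀ : ℝ} {S : Set ℝ}
    (hP : P ∈ S) (hS : Set.Ioo 0 1 ⊆ S)
    (ha : ContinuousOn a S) (hb : ContinuousOn b S) (hc : ContinuousOn c S)
    (hab : ∀ s ∈ Set.Ioo (0 : ℝ) 1, a s ≤ b s) (hPa : a P = x₀) (hPb : b P = x₀) :
    TendstoUniformly (fun s θ => oval (a s) (b s) (c s) ε θ) (fun _ => ((x₀ : ℂ), 0))
      (nhdsWithin P (Set.Ioo 0 1)) := by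
  rw [Metric.tendstoUniformly_iff]
  intro e he
  have lim {f : ℝ → ℝ} (hf : ContinuousOn f S) :
      Filter.Tendsto f (nhdsWithin P (Set.Ioo 0 1)) (nhds (f P)) :=
    (hf P hP).mono_left (nhdsWithin_mono _ hS)
  have hA : Filter.Tendsto (fun s => |a s - x₀| + |b s - x₀|) (nhdsWithin P (Set.Ioo 0 1))
      (nhds 0) := by
    have := lim (f := fun s => |a s - x₀| + |b s - x₀|) (by fun_prop)
    simpa [hPa, hPb] using this
  have hB : Filter.Tendsto
      (fun s => (b s - a s) / 2 * √((|c s - a s| + |c s - b s|) / 3))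
      (nhdsWithin P (Set.Ioo 0 1)) (nhds 0) := by
    have := lim (f := fun s => (b s - a s) / 2 * √((|c s - a s| + |c s - b s|) / 3))
      (by fun_prop)
    simpa [hPa, hPb] using this
  filter_upwards [hA.eventually_lt_const he, hB.eventually_lt_const he, self_mem_nhdsWithin]
    with s h1 h2 hs θ
  obtain ⟨hx1, hx2⟩ := ovalX_mem (hab s hs) θ
  have hba : 0 ≤ (b s - a s) / 2 := by linarith [hab s hs]
  rw [dist_comm, Prod.dist_eq, max_lt_iff]
  simp only [oval]
  constructor
  · rw [Complex.dist_of_im_eq (by simp)]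
    simp only [Complex.ofReal_re, Real.dist_eq]
    refine lt_of_le_of_lt ?_ h1
    rw [abs_le]
    constructor <;>
      linarith [neg_abs_le (a s - x₀), le_abs_self (b s - x₀), abs_nonneg (a s - x₀),
        abs_nonneg (b s - x₀)]
  · rw [dist_zero_right, norm_mul, hε, one_mul, Complex.norm_real, Real.norm_eq_abs, abs_mul,
      abs_mul, abs_of_nonneg hba, abs_of_nonneg (Real.sqrt_nonneg _)]
    refine lt_of_le_of_lt ?_ h2
    have hsin : (b s - a s) / 2 * |Real.sin θ| ≤ (b s - a s) / 2 := by
      have := Real.abs_sin_le_one θ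
      nlinarith
    refine mul_le_mul hsin (Real.sqrt_le_sqrt ?_) (Real.sqrt_nonneg _) hba
    have : |c s - ovalX (a s) (b s) θ| ≤ |c s - a s| + |c s - b s| := by
      rw [abs_le]
      constructor <;>
        linarith [neg_abs_le (c s - b s), le_abs_self (c s - a s), abs_nonneg (c s - a s),
          abs_nonneg (c s - b s)]
    linarith

/-- The cycle `δ₁` vanishing at `s = 1`: the closed curve on `fibre s` over the segment
`[root₁ s, root₂ s]`, on which `y` is imaginary.  It is oriented so that `∫ dx/y` over it is a
positive multiple of `i`. -/
noncomputable def δ₁ : VanishingCycle 1 (-1) where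
  toFun s θ := oval (root₁ s) (root₂ s) (root₃ s) (-Complex.I) θ
  node := by
    constructor
    · simp only [fibre, g₂, g₃, Set.mem_ofPred_eq]; norm_num
    · simp only [g₂]; norm_num
  mem_fibre s hs θ := by
    have := oval_eq (root₁_lt_root₂ hs.1 hs.2) (ε := -Complex.I)
      (Or.inl ⟨root₂_lt_root₃ hs.1 hs.2, by simp⟩) θ
    simp only [fibre, Set.mem_ofPred_eq]
    rw [this, cubic_eq hs.1.le hs.2.le]
  periodic s := oval_periodic _ _ _ _
  contDiff s hs := oval_contDiff _ (root₁_lt_root₂ hs.1 hs.2) (Or.inl (root₂_lt_root₃ hs.1 hs.2))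
  continuousOn := oval_continuousOn _ (continuousOn_root₁.mono fun _ h => h.2.le)
    (continuousOn_root₂.mono fun _ h => h.2.le) (continuousOn_root₃.mono fun _ h => h.2.le)
  injOn s hs := oval_injOn (by simp) (root₁_lt_root₂ hs.1 hs.2)
    (Or.inl (root₂_lt_root₃ hs.1 hs.2))
  involution s θ := oval_neg _ _ _ _ _
  vanishes := by
    have := oval_vanishes (ε := -Complex.I) (x₀ := -1) (S := Set.Iic 1) (P := 1) (by simp)
      (by simp) (fun _ h => h.2.le) continuousOn_root₁ continuousOn_root₂ continuousOn_root₃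
      (fun s hs => (root₁_lt_root₂ hs.1 hs.2).le) root₁_one root₂_one
    simpa using this

/-- The cycle `δ₀` vanishing at `s = 0`: the closed curve on `fibre s` over the segment
`[root₂ s, root₃ s]`, i.e. the compact component of the real locus of `fibre s`.  It is oriented
so that `∫ dx/y` over it is negative. -/
noncomputable def δ₀ : VanishingCycle 0 3 where
  toFun s θ := oval (root₂ s) (root₃ s) (root₁ s) (-1) θ
  node := by
    constructor
    · simp only [fibre, g₂, g₃, Set.mem_ofPred_eq]; norm_num
    · simp only [g₂]; norm_num
  mem_fibre s hs θ := by
    have := oval_eq (root₂_lt_root₃ hs.1 hs.2) (ε := -1)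
      (Or.inr ⟨root₁_lt_root₂ hs.1 hs.2, by simp⟩) θ
    simp only [fibre, Set.mem_ofPred_eq]
    rw [this, cubic_eq hs.1.le hs.2.le]
    ring
  periodic s := oval_periodic _ _ _ _
  contDiff s hs := oval_contDiff _ (root₂_lt_root₃ hs.1 hs.2) (Or.inr (root₁_lt_root₂ hs.1 hs.2))
  continuousOn := oval_continuousOn _ (continuousOn_root₂.mono fun _ h => h.2.le)
    (continuousOn_root₃.mono fun _ h => h.2.le) (continuousOn_root₁.mono fun _ h => h.2.le)
  injOn s hs := oval_injOn (by simp) (root₂_lt_root₃ hs.1 hs.2)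
    (Or.inr (root₁_lt_root₂ hs.1 hs.2))
  involution s θ := oval_neg _ _ _ _ _
  vanishes := by
    have := oval_vanishes (ε := -1) (x₀ := 3) (S := Set.Iic 1) (P := 0) (by simp)
      (by simp) (fun _ h => h.2.le) continuousOn_root₂ continuousOn_root₃ continuousOn_root₁
      (fun s hs => (root₂_lt_root₃ hs.1 hs.2).le) root₂_zero root₃_zero
    simpa using this

/-- A parametrized 2-chain in affine 3-space with coordinates `(x, y, t)`, with parameters in the
rectangle `(0, 1) × (0, 2π)`. -/
abbrev TwoChain : Type := ℝ → ℝ → ℂ × ℂ × ℂ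

/-- The Lefschetz thimble on the surface `-12 y² = 4 x³ - g₂(t^l) x - g₃(t^l)` fibred over the
segment `0 < t < 1` of the `t`-line, whose fibre over `t` is the cycle `δ` over `s = t ^ l`. -/
def thimble (l : ℕ) {P : ℝ} {x₀ : ℂ} (δ : VanishingCycle P x₀) : TwoChain := fun t θ =>
  ((δ.toFun (t ^ l) θ).1, (δ.toFun (t ^ l) θ).2, (t : ℂ))

theorem thimble_mem_surface {l : ℕ} (hl : 1 ≤ l) {P : ℝ} {x₀ : ℂ} (δ : VanishingCycle P x₀)
    {t : ℝ} (ht : t ∈ Set.Ioo (0 : ℝ) 1) (θ : ℝ) : thimble l δ t θ ∈ surface l := by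
  have h := δ.mem_fibre (t ^ l) ⟨pow_pos ht.1 l, pow_lt_one₀ ht.1.le ht.2 (by omega)⟩ θ
  simpa [thimble, surface, fibre] using h

/-- The thimble `Δ`, with fibres the cycles vanishing at `t = 1`. -/
noncomputable def Δ (l : ℕ) : TwoChain := thimble l δ₁

/-- The thimble `Γ`, with fibres the cycles vanishing at `t = 0`. -/
noncomputable def Γ (l : ℕ) : TwoChain := thimble l δ₀

/-- The coefficient, with respect to `du ∧ dθ`, of the pull-back under the 2-chain `C` of the
2-form `t^(j-1) dt ∧ dx/y` (with `1 ≤ j`). -/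
noncomputable def pullback (j : ℕ) (C : TwoChain) (p : ℝ × ℝ) : ℂ :=
  (C p.1 p.2).2.2 ^ (j - 1) *
    (deriv (fun u => (C u p.2).2.2) p.1 * deriv (fun θ => (C p.1 θ).1) p.2 -
      deriv (fun θ => (C p.1 θ).2.2) p.2 * deriv (fun u => (C u p.2).1) p.1) / (C p.1 p.2).2.1

/-- The parameter rectangle `(0, 1) × (0, 2π)`. -/
def rectangle : Set (ℝ × ℝ) := Set.Ioo 0 1 ×ˢ Set.Ioo 0 (2 * Real.pi)

/-- Absolute convergence of the integral of `t^(j-1) dt ∧ dx/y` over the 2-chain `C`. -/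
def PeriodConverges (j : ℕ) (C : TwoChain) : Prop :=
  IntegrableOn (pullback j C) rectangle volume

/-- The integral of `t^(j-1) dt ∧ dx/y` over the 2-chain `C`. -/
noncomputable def period (j : ℕ) (C : TwoChain) : ℂ :=
  ∫ p in rectangle, pullback j C p

/-! ### Eisenstein series of weight 3 for `Γ₁(3)` and the series `I(j)`, `J(j)` -/

open PowerSeries

/-- The `q`-expansion of `E_{3a} = 1 - 9 ∑ₙ (∑_{k ∣ n} (k/3) k²) qⁿ`. -/
noncomputable def E3a : ℚ⟦X⟧ :=
  1 - 9 * PowerSeries.mk fun n => ∑ k ∈ n.divisors, (legendreSym 3 (k : ℤ) : ℚ) * (k : ℚ) ^ 2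

/-- The `q`-expansion of `E_{3b} = ∑ₙ (∑_{k ∣ n} ((n/k)/3) k²) qⁿ`. -/
noncomputable def E3b : ℚ⟦X⟧ :=
  PowerSeries.mk fun n => ∑ k ∈ n.divisors, (legendreSym 3 ((n / k : ℕ) : ℤ) : ℚ) * (k : ℚ) ^ 2

/-- The `q`-expansion of `E_{3b} / q`. -/
noncomputable def E3bDivQ : ℚ⟦X⟧ := PowerSeries.mk fun n => coeff (n + 1) E3b

/-- The power `f ^ r = ∑ₖ (r choose k) (f - 1)ᵏ` with rational exponent `r` of a formal power
series `f` with constant coefficient `1`. -/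
noncomputable def ratPow (f : ℚ⟦X⟧) (r : ℚ) : ℚ⟦X⟧ :=
  (PowerSeries.binomialSeries ℚ r).subst (f - 1)

/-- `a_n(j)`, the `n`-th coefficient of `E_{3b} (E_{3a} / (E_{3a} + 27 E_{3b})) ^ (j/l)`. -/
noncomputable def a (l j n : ℕ) : ℚ :=
  coeff n (E3b * ratPow (E3a * (E3a + 27 * E3b)⁻¹) ((j : ℚ) / l))

/-- `b_n(j)`, the `n`-th coefficient of `E_{3a} (E_{3b} / (q (E_{3a} + 27 E_{3b}))) ^ (j/l)`. -/
noncomputable def b (l j n : ℕ) : ℚ :=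
  coeff n (E3a * ratPow (E3bDivQ * (E3a + 27 * E3b)⁻¹) ((j : ℚ) / l))

/-- `c = exp(-2π/√3)`. -/
noncomputable def c : ℝ := Real.exp (-2 * Real.pi / √3)

/-- The `n`-th term (`n ≥ 1`) of the first series in `I(j)`. -/
noncomputable def I₁ (l j n : ℕ) : ℝ := (a l j n : ℝ) / n * c ^ n

/-- The `n`-th term (`n ≥ 0`) of the second series in `I(j)`. -/
noncomputable def I₂ (l j n : ℕ) : ℝ :=
  (b l j n : ℝ) * (1 / ((n : ℝ) + j / l) + √3 / (2 * Real.pi * ((n : ℝ) + j / l) ^ 2)) *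
    c ^ ((n : ℝ) + j / l)

/-- The `n`-th term (`n ≥ 1`) of the first series in `J(j)`. -/
noncomputable def J₁ (l j n : ℕ) : ℝ :=
  (a l j n : ℝ) * (2 * Real.pi / (√3 * n) + 1 / (n : ℝ) ^ 2) * c ^ n

/-- The `n`-th term (`n ≥ 0`) of the second series in `J(j)`. -/
noncomputable def J₂ (l j n : ℕ) : ℝ :=
  (b l j n : ℝ) / ((n : ℝ) + j / l) * c ^ ((n : ℝ) + j / l)

/-- `I(j)`. -/
noncomputable def I (l j : ℕ) : ℝ :=
  (∑' n : ℕ, I₁ l j (n + 1)) + (3 : ℝ) ^ (3 * (j : ℝ) / l - 3) * ∑' n : ℕ, I₂ l j n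

/-- `J(j)`. -/
noncomputable def J (l j : ℕ) : ℝ :=
  (∑' n : ℕ, J₁ l j (n + 1)) +
    2 * Real.pi * (3 : ℝ) ^ (3 * (j : ℝ) / l - 7 / 2) * ∑' n : ℕ, J₂ l j n

end EllipticPeriods

/-!
Write `A = eisOne` for the Eisenstein series of weight one for the character modulo `3`, and `S =
hauptmodul = 27 E_{3b} / (E_{3a} + 27 E_{3b})`; both are functions of the nome `q ∈ (0, 1)`, and
`E_{3a} + 27 E_{3b} = A³`. The curve over `s = t^l` is the one with modular parameter `s = S(q)`,
and its periods are `A` and `log q` times `A`, up to constant factors. Rewritten in the nome, each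
period of the surface becomes the integral over `0 < q < c` of the two generating functions against
`q^(j/l-1)` and `1`, one of them with an additional factor `log q`; integrating term by term gives
the two series.

*The periods of the fibres.* Parametrise a root of the cubic as `3 - u²` with `s = u² (3 + u) / 4`.
The integral of `dx / y` over the oval lying over the other two roots is then an explicit function
of `u`. Differentiation under the integral sign, and reduction modulo an exact form, show that it
satisfies the hypergeometric equation of `hyp = ₂F₁(1/3, 2/3; 1; ·)` (`hasDerivAt_ovalFlux`). It
stays bounded as the oval shrinks to a point, so it is a multiple of `hyp (1 - s)`, respectively of
`hyp s` (`integral_oval_one`, `integral_oval_zero`; the Wronskian argument is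
`eq_mul_of_flux_tendsto_zero`). By Fubini, the periods are the integrals of `t^(j-1) hyp (1 - t^l)`
and `t^(j-1) hyp (t^l)` over `(0, 1)`, up to constants (`period_Δ`, `period_Γ`).

*The hypergeometric function in the nome.* The identities `hyp (S q) = A q` and `hyp (1 - S q) =
-(√3 / 2π) log q A q` (`hyp_hauptmodul`, `hyp_one_sub_hauptmodul`) follow by comparing second order
equations. The equations for `A` and `S` (`hasDerivAt_hauptmodul`, `hasDerivAt_eisFlux`) are
identities between Lambert series: a convolution identity, which is the heat equation for the theta
function of nome `q³` (`hasSum_sq_sub`), together with the three-term relation `lam_three_term` at a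
point of order three (`moment_three`, `moment_four`). The Wronskian constant `√3 / 2π` comes from
Stirling's formula (`tendsto_mul_hypCoeff`) and Abel's limit theorem. As a consequence, the Fricke
involution `log q log q' = 4π²/3` exchanges `S` and `1 - S` (`hauptmodul_fricke`); its fixed point
is `c`, so `S c = 1/2`.

*The Eisenstein series of weight three.* The Lambert series above yields `27 E_{3b} = A³ S` at once
(`seriesB_eq`). To get `E_{3a} = A³ (1 - S)` (`eisOne_cube_mul`), apply the Fricke involution: by
Lipschitz's formula the lattice sum `∑ χ(m) (m τ + n)⁻³`, summed over `n` first, is `E_{3b}` at `τ`,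
and summed over `m` first it is `E_{3a}` at the image of `τ`.

*The series.* The Jacobian of `S` is `S (1 - S) A² / q` and `27 E_{3b} = A³ S`, `E_{3a} = A³ (1 -
S)`, so the substitutions `t^l = S(q)` for `t^l < 1/2` and `t^l = 1 - S(q)` for `t^l > 1/2`, both
with `q ∈ (0, c)` (`integral_hauptmodul`), turn the integrands into the generating functions of
`b_n(j)` and `a_n(j)` (`hauptmodul_weights`). These represent the rational powers in question for
`|q| ≤ 1/36`, which includes `c`: with the weighted `ℓ¹` norm of radius `1/36`, the three series to
be raised to a power differ from `1` by less than `1`, so that the binomial series applies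
(`absConv_ratPow`, `hasSum_a`, `hasSum_b`).
-/

namespace CubicPeriods

open Filter Topology

/-! ### The Lambert series with nome `q ^ 3` at `q` -/

/-- The coefficient `1 / (1 - q ^ (3 k))` of the Laurent expansion of the logarithmic derivative of
the theta function with nome `q ^ 3`; the coefficient at `k = 0` is set to `1 / 2`, which makes the
relation `lam q (-k) = 1 - lam q k` hold for all `k`. -/
noncomputable def lam (q : ℝ) (k : ℤ) : ℝ := if k = 0 then 1 / 2 else (1 - q ^ (3 * k))⁻¹

theorem hasSum_of_eq {ι : Type*} {f g : ι → ℝ} {s t : ℝ} (h : HasSum f s) (hf : ∀ i, g i = f i)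
    (hs : t = s) : HasSum g t := by
  rw [hs, funext hf]; exact h

theorem lam_zero (q : ℝ) : lam q 0 = 1 / 2 := by simp [lam]

theorem lam_of_ne (q : ℝ) {k : ℤ} (hk : k ≠ 0) : lam q k = (1 - q ^ (3 * k))⁻¹ := by simp [lam, hk]

theorem one_sub_zpow_ne {q : ℝ} (h0 : 0 < q) (h1 : q < 1) {k : ℤ} (hk : k ≠ 0) :
    1 - q ^ (3 * k) ≠ 0 := by
  intro h
  have : q ^ (3 * k) = 1 := by linarith
  rw [zpow_eq_one_iff_right₀ h0.le h1.ne] at this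
  omega

theorem lam_neg {q : ℝ} (h0 : 0 < q) (h1 : q < 1) (k : ℤ) : lam q (-k) = 1 - lam q k := by
  rcases eq_or_ne k 0 with rfl | hk
  · simp [lam]; norm_num
  · have a := one_sub_zpow_ne h0 h1 hk
    have b := one_sub_zpow_ne h0 h1 (neg_ne_zero.2 hk)
    rw [lam_of_ne q hk, lam_of_ne q (neg_ne_zero.2 hk)]
    have e : q ^ (3 * -k) = (q ^ (3 * k))⁻¹ := by rw [← zpow_neg]; ring_nf
    rw [e] at b ⊢
    have c : q ^ (3 * k) ≠ 0 := (zpow_pos h0 _).ne'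
    have d : q ^ (3 * k) - 1 ≠ 0 := by intro h; apply a; linarith
    field_simp
    ring

theorem lam_mul_lam {q : ℝ} (h0 : 0 < q) (h1 : q < 1) {k m : ℤ} (hk : k ≠ 0) (hm : m ≠ 0)
    (hkm : k + m ≠ 0) : lam q k * lam q m = lam q (k + m) * (lam q k + lam q m - 1) := by
  have a := one_sub_zpow_ne h0 h1 hk
  have b := one_sub_zpow_ne h0 h1 hm
  have c := one_sub_zpow_ne h0 h1 hkm
  rw [lam_of_ne q hk, lam_of_ne q hm, lam_of_ne q hkm]
  have e : q ^ (3 * (k + m)) = q ^ (3 * k) * q ^ (3 * m) := by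
    rw [mul_add, zpow_add₀ h0.ne']
  rw [e] at c ⊢
  field_simp
  ring

/-- For `k > 0` the coefficient lies between `1` and `1 / (1 - p)`. -/
theorem lam_natCast_succ {q p : ℝ} (h0 : 0 < q) (hqp : q ≤ p) (hp : p < 1) (n : ℕ) :
    0 < lam q (n + 1 : ℕ) ∧ lam q (n + 1 : ℕ) ≤ (1 - p)⁻¹ := by
  have h3 : q ^ (3 * ((n + 1 : ℕ) : ℤ)) ≤ p := by
    have : q ^ (3 * ((n + 1 : ℕ) : ℤ)) = q ^ (3 * (n + 1)) := by
      rw [← zpow_natCast]; push_cast; rfl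
    rw [this]
    calc q ^ (3 * (n + 1)) ≤ q ^ 1 := pow_le_pow_of_le_one h0.le (by linarith) (by omega)
      _ ≤ p := by simpa using hqp
  rw [lam_of_ne q (by omega)]
  constructor
  · apply inv_pos.2; linarith
  · apply inv_anti₀ <;> linarith

theorem lam_neg_natCast_succ {q : ℝ} (h0 : 0 < q) (h1 : q < 1) (n : ℕ) :
    lam q (-(n + 1 : ℕ)) = -(q ^ (3 * (n + 1)) * lam q (n + 1 : ℕ)) := by
  rw [lam_neg h0 h1]
  have := one_sub_zpow_ne h0 h1 (k := ((n + 1 : ℕ) : ℤ)) (by omega)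
  rw [lam_of_ne q (by omega)]
  have e : q ^ (3 * ((n + 1 : ℕ) : ℤ)) = q ^ (3 * (n + 1)) := by
    rw [← zpow_natCast]; push_cast; rfl
  rw [e] at this ⊢
  generalize q ^ (3 * (n + 1)) = z at this ⊢
  field_simp; ring

/-- The terms of the Lambert series decay geometrically in both directions, uniformly for `q ≤ p`.
This is why the arguments of the series are `q` and `q ^ 2`, which lie strictly inside the annulus
of convergence `q ^ 3 < |x| < 1`. -/
theorem abs_lam_mul_zpow_le {q p : ℝ} (h0 : 0 < q) (hqp : q ≤ p) (hp : p < 1) (k : ℤ) :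
    |lam q k * q ^ k| ≤ (1 - p)⁻¹ * q ^ k.natAbs ∧
      |lam q k * (q ^ 2) ^ k| ≤ (1 - p)⁻¹ * q ^ k.natAbs := by
  have hp' : 1 ≤ (1 - p)⁻¹ := (one_le_inv₀ (by linarith)).2 (by linarith)
  have hq1 : q < 1 := by linarith
  rcases lt_trichotomy k 0 with hk | rfl | hk
  · obtain ⟨n, rfl⟩ : ∃ n : ℕ, k = -(n + 1 : ℕ) := ⟨(-k).toNat - 1, by omega⟩
    obtain ⟨ha, hb⟩ := lam_natCast_succ h0 hqp hp n
    have hn : (-((n + 1 : ℕ) : ℤ)).natAbs = n + 1 := by omega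
    rw [lam_neg_natCast_succ h0 hq1, hn, zpow_neg, zpow_natCast, zpow_neg, zpow_natCast]
    have e1 : -(q ^ (3 * (n + 1)) * lam q (n + 1 : ℕ)) * (q ^ (n + 1))⁻¹
        = -(lam q (n + 1 : ℕ) * q ^ (2 * (n + 1))) := by
      have : q ^ (n + 1) ≠ 0 := by positivity
      field_simp; ring
    have e2 : -(q ^ (3 * (n + 1)) * lam q (n + 1 : ℕ)) * ((q ^ 2) ^ (n + 1))⁻¹
        = -(lam q (n + 1 : ℕ) * q ^ (n + 1)) := by
      have : q ^ (n + 1) ≠ 0 := by positivity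
      have : (q ^ 2) ^ (n + 1) ≠ 0 := by positivity
      field_simp; ring
    rw [e1, e2, abs_neg, abs_neg, abs_of_pos (by positivity), abs_of_pos (by positivity)]
    constructor
    · gcongr ?_ * ?_
      exact pow_le_pow_of_le_one h0.le hq1.le (by omega)
    · gcongr
  · simp only [lam_zero, Int.natAbs_zero, pow_zero, zpow_zero, mul_one]
    rw [abs_of_pos (by norm_num)]
    constructor <;> linarith
  · obtain ⟨n, rfl⟩ : ∃ n : ℕ, k = (n + 1 : ℕ) := ⟨k.toNat - 1, by omega⟩
    obtain ⟨ha, hb⟩ := lam_natCast_succ h0 hqp hp n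
    have hn : (((n + 1 : ℕ) : ℤ)).natAbs = n + 1 := by omega
    rw [hn, zpow_natCast, zpow_natCast, abs_of_pos (by positivity), abs_of_pos (by positivity)]
    constructor
    · gcongr
    · gcongr ?_ * ?_
      rw [← pow_mul]
      exact pow_le_pow_of_le_one h0.le hq1.le (by omega)

theorem summable_natAbs_pow_mul {p : ℝ} (h0 : 0 ≤ p) (h1 : p < 1) (j : ℕ) :
    Summable fun k : ℤ => |(k : ℝ)| ^ j * p ^ k.natAbs := by
  have h : Summable fun n : ℕ => (n : ℝ) ^ j * p ^ n :=
    summable_pow_mul_geometric_of_norm_lt_one j (by rwa [Real.norm_of_nonneg h0])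
  apply Summable.of_nat_of_neg <;> simpa using h

theorem summable_moment {q x : ℝ} (h0 : 0 < q) (h1 : q < 1) (hx : x = q ∨ x = q ^ 2) (j : ℕ) :
    Summable fun k : ℤ => (k : ℝ) ^ j * (lam q k * x ^ k) := by
  refine Summable.of_norm_bounded
    ((summable_natAbs_pow_mul h0.le h1 j).mul_left (1 - q)⁻¹) fun k => ?_
  rw [Real.norm_eq_abs, abs_mul, abs_pow]
  have := abs_lam_mul_zpow_le h0 le_rfl h1 k
  have hb : |lam q k * x ^ k| ≤ (1 - q)⁻¹ * q ^ k.natAbs := by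
    rcases hx with rfl | rfl
    exacts [this.1, this.2]
  calc |(k : ℝ)| ^ j * |lam q k * x ^ k| ≤ |(k : ℝ)| ^ j * ((1 - q)⁻¹ * q ^ k.natAbs) := by gcongr
    _ = _ := by ring

/-- The moments `∑ kʲ u_k x ^ k` of the Laurent series; `moment q x j` is the `j`-th derivative
`(x d/dx) ^ j` of the logarithmic derivative of the theta function with nome `q ^ 3`. -/
noncomputable def moment (q x : ℝ) (j : ℕ) : ℝ := ∑' k : ℤ, (k : ℝ) ^ j * (lam q k * x ^ k)

theorem hasSum_moment {q x : ℝ} (h0 : 0 < q) (h1 : q < 1) (hx : x = q ∨ x = q ^ 2) (j : ℕ) :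
    HasSum (fun k : ℤ => (k : ℝ) ^ j * (lam q k * x ^ k)) (moment q x j) :=
  (summable_moment h0 h1 hx j).hasSum

/-- The reflection `x ↦ q ^ 3 / x` maps `q ^ 2` to `q`. -/
theorem hasSum_moment_sq {q : ℝ} (h0 : 0 < q) (h1 : q < 1) (j : ℕ) :
    moment q (q ^ 2) j = -(-1) ^ j * moment q q j + if j = 0 then 1 else 0 := by
  have h := hasSum_moment h0 h1 (Or.inl rfl) (x := q) j
  have h' := (Equiv.neg ℤ).hasSum_iff.2 h
  have h2 := (h'.mul_left (-(-1 : ℝ) ^ j)).add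
    (hasSum_ite_eq (0 : ℤ) (if j = 0 then (1 : ℝ) else 0))
  refine HasSum.tsum_eq (hasSum_of_eq h2 (fun k => ?_) rfl)
  simp only [Function.comp, Equiv.neg_apply]
  rcases eq_or_ne k 0 with rfl | hk
  · simp only [neg_zero, lam_zero, if_true]
    rcases eq_or_ne j 0 with rfl | hj
    · simp; norm_num
    · simp [hj]
  · rw [if_neg hk, add_zero, lam_neg h0 h1, lam_of_ne q hk]
    have a := one_sub_zpow_ne h0 h1 hk
    have e : q ^ (3 * k) = q ^ k * q ^ k * q ^ k := by
      rw [← zpow_add₀ h0.ne', ← zpow_add₀ h0.ne']; ring_nf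
    have e2 : (q ^ 2) ^ k = q ^ k * q ^ k := by
      rw [← mul_zpow, sq]
    have hz : q ^ k ≠ 0 := (zpow_pos h0 _).ne'
    have hj : (-1 : ℝ) ^ j * (-1) ^ j = 1 := by rw [← mul_pow]; norm_num
    rw [e] at a ⊢
    rw [e2, zpow_neg]
    push_cast
    rw [neg_pow (k : ℝ) j]
    generalize q ^ k = z at a hz ⊢
    have h : (1 - z * z * z)⁻¹ * (z * z) = -((1 - (1 - z * z * z)⁻¹) * z⁻¹) := by
      have a' : 1 - z ^ 3 ≠ 0 := by convert a using 2; ring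
      rw [show 1 - z * z * z = 1 - z ^ 3 by ring]
      field_simp; ring
    rw [h]
    linear_combination ((k : ℝ) ^ j * ((1 - (1 - z * z * z)⁻¹) * z⁻¹)) * hj

/-! ### The convolution identity and the heat equation -/

/-- The coefficients tend to `1` at `∞` and to `0` at `-∞`, so the differences along a shift by `N`
telescope to `N`. -/
theorem hasSum_lam_sub_shift {q : ℝ} (h0 : 0 < q) (h1 : q < 1) (N : ℤ) :
    HasSum (fun k => lam q k - lam q (k - N)) N := by
  -- subtracting the Heaviside function `H` makes the coefficients summable
  set H : ℤ → ℝ := fun k => if k < 0 then 0 else if k = 0 then 1 / 2 else 1 with hH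
  have hv : Summable fun k => lam q k - H k := by
    refine Summable.of_norm_bounded
      ((summable_natAbs_pow_mul h0.le h1 0).mul_left (1 - q)⁻¹) fun k => ?_
    rw [Real.norm_eq_abs, pow_zero, one_mul]
    rcases lt_trichotomy k 0 with hk | rfl | hk
    · obtain ⟨n, rfl⟩ : ∃ n : ℕ, k = -(n + 1 : ℕ) := ⟨(-k).toNat - 1, by omega⟩
      obtain ⟨ha, hb⟩ := lam_natCast_succ h0 le_rfl h1 n
      have hn : (-((n + 1 : ℕ) : ℤ)).natAbs = n + 1 := by omega
      simp only [hH, if_pos hk, sub_zero]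
      rw [lam_neg_natCast_succ h0 h1, hn, abs_neg, abs_of_pos (by positivity), mul_comm]
      gcongr ?_ * ?_
      exact pow_le_pow_of_le_one h0.le h1.le (by omega)
    · have : 0 < (1 - q)⁻¹ := inv_pos.2 (by linarith)
      simp [hH, lam_zero, this.le]
    · obtain ⟨n, rfl⟩ : ∃ n : ℕ, k = (n + 1 : ℕ) := ⟨k.toNat - 1, by omega⟩
      obtain ⟨ha, hb⟩ := lam_natCast_succ h0 le_rfl h1 n
      have hn : (((n + 1 : ℕ) : ℤ)).natAbs = n + 1 := by omega
      have e1 := lam_neg_natCast_succ h0 h1 n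
      rw [lam_neg h0 h1] at e1
      simp only [hH, if_neg hk.not_gt, if_neg hk.ne']
      rw [abs_sub_comm, e1, hn, abs_neg, abs_of_pos (by positivity), mul_comm]
      gcongr ?_ * ?_
      exact pow_le_pow_of_le_one h0.le h1.le (by omega)
  have one : HasSum (fun k => lam q k - lam q (k - 1)) 1 := by
    have s1 := hv.hasSum
    have s2 := (Equiv.subRight (1 : ℤ)).hasSum_iff.2 s1
    have s3 := ((s1.sub s2).add (hasSum_ite_eq (0 : ℤ) (1 / 2 : ℝ))).add
      (hasSum_ite_eq (1 : ℤ) (1 / 2 : ℝ))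
    refine hasSum_of_eq s3 (fun k => ?_) ?_
    · simp only [Function.comp, Equiv.subRight_apply, hH]
      rcases lt_trichotomy k 0 with hk | rfl | hk
      · rw [if_pos hk, if_pos (by omega), if_neg hk.ne, if_neg (by omega)]; ring
      · norm_num; ring
      · rcases eq_or_ne k 1 with rfl | hk1
        · norm_num; ring
        · rw [if_neg (by omega), if_neg (by omega), if_neg (by omega), if_neg (by omega),
            if_neg (by omega), if_neg (by omega)]; ring
    · norm_num
  have step (M : ℤ) : HasSum (fun k => lam q (k - M) - lam q (k - (M + 1))) 1 := by
    have := (Equiv.subRight M).hasSum_iff.2 one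
    simpa [Function.comp_def, sub_sub] using this
  induction N using Int.induction_on with
  | zero => simp
  | succ n ih =>
    have := ih.add (step n)
    push_cast at this ⊢
    simpa using this
  | pred n ih =>
    have := ih.sub (step (-(n : ℤ) - 1))
    push_cast at this ⊢
    simpa using this

/-- The convolution square of the coefficients. The product formula for `lam q k * lam q (N - k)`
reduces it to the telescoping sum, up to corrections at `k = 0` and `k = N`. -/
theorem hasSum_lam_conv {q : ℝ} (h0 : 0 < q) (h1 : q < 1) {N : ℤ} (hN : N ≠ 0) :
    HasSum (fun k => lam q k * lam q (N - k)) (N * lam q N - 2 * (lam q N ^ 2 - lam q N)) := by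
  have s := (((hasSum_lam_sub_shift h0 h1 N).mul_left (lam q N)).add
    (hasSum_ite_eq (0 : ℤ) (lam q N - lam q N ^ 2))).add
    (hasSum_ite_eq N (lam q N - lam q N ^ 2))
  refine hasSum_of_eq s (fun k => ?_) ?_
  · rcases eq_or_ne k 0 with rfl | hk
    · rw [if_pos rfl, if_neg hN.symm, zero_sub, lam_neg h0 h1, lam_zero, sub_zero]; ring
    · rw [if_neg hk]
      rcases eq_or_ne k N with rfl | hkN
      · rw [if_pos rfl, sub_self, lam_zero]; ring
      · rw [if_neg hkN, lam_mul_lam h0 h1 hk (sub_ne_zero.2 hkN.symm) (by simpa using hN)]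
        rw [add_sub_cancel, show k - N = -(N - k) by ring, lam_neg h0 h1]; ring
  · ring

theorem hasSum_mul_prod {f g : ℤ → ℝ} {a b : ℝ} (hf : HasSum f a) (hg : HasSum g b) :
    HasSum (fun p : ℤ × ℤ => f p.1 * g p.2) (a * b) :=
  hf.mul hg (summable_mul_of_summable_norm hf.summable.norm hg.summable.norm)

/-- A product of two Lambert series, collected according to the total exponent `N`. The factor `N ^
(j + 1)` removes the term `N = 0`, at which the formula for the convolution fails. -/
theorem hasSum_conv_of_prod {q x s : ℝ} (h0 : 0 < q) (h1 : q < 1) (hx : x ≠ 0) {j : ℕ}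
    (h : HasSum (fun p : ℤ × ℤ =>
      ((p.1 : ℝ) + p.2) ^ (j + 1) * ((lam q p.1 * x ^ p.1) * (lam q p.2 * x ^ p.2))) s) :
    HasSum (fun N : ℤ => (N : ℝ) ^ (j + 1) *
      ((N * lam q N - 2 * (lam q N ^ 2 - lam q N)) * x ^ N)) s := by
  let e : ℤ × ℤ ≃ ℤ × ℤ :=
    { toFun := fun p => (p.2, p.1 - p.2)
      invFun := fun p => (p.1 + p.2, p.1)
      left_inv := fun p => by ext <;> simp
      right_inv := fun p => by ext <;> simp }
  have h' := e.hasSum_iff.2 h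
  refine h'.prod_fiberwise fun N => ?_
  rcases eq_or_ne N 0 with rfl | hN
  · refine hasSum_of_eq hasSum_zero (fun k => ?_) ?_ <;> simp [e]
  · have := ((hasSum_lam_conv h0 h1 hN).mul_left ((N : ℝ) ^ (j + 1) * x ^ N))
    refine hasSum_of_eq this (fun k => ?_) ?_
    · simp only [Function.comp, e, Equiv.coe_fn_mk]
      have : x ^ N = x ^ k * x ^ (N - k) := by rw [← zpow_add₀ hx]; ring_nf
      rw [this]; push_cast; ring
    · ring

/-- The sums `∑ Nʲ (u_N² - u_N) x ^ N`, for `j = 1, 2, 3`, in terms of moments.  Since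
`N (u_N² - u_N)` is the logarithmic derivative of `u_N` with respect to the nome, this is the heat
equation for the theta function. -/
theorem hasSum_sq_sub {q x : ℝ} (h0 : 0 < q) (h1 : q < 1) (hx : x = q ∨ x = q ^ 2) :
    HasSum (fun N : ℤ => (N : ℝ) ^ 1 * ((lam q N ^ 2 - lam q N) * x ^ N))
        (moment q x 2 / 2 - moment q x 0 * moment q x 1) ∧
      HasSum (fun N : ℤ => (N : ℝ) ^ 2 * ((lam q N ^ 2 - lam q N) * x ^ N))
        (moment q x 3 / 2 - moment q x 1 ^ 2 - moment q x 0 * moment q x 2) ∧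
      HasSum (fun N : ℤ => (N : ℝ) ^ 3 * ((lam q N ^ 2 - lam q N) * x ^ N))
        (moment q x 4 / 2 - 3 * moment q x 1 * moment q x 2 - moment q x 0 * moment q x 3) := by
  have hx0 : x ≠ 0 := by rcases hx with rfl | rfl <;> positivity
  have m := hasSum_moment h0 h1 hx
  refine ⟨?_, ?_, ?_⟩
  · have c := hasSum_conv_of_prod (j := 0) (s := 2 * (moment q x 0 * moment q x 1)) h0 h1 hx0 (by
      refine hasSum_of_eq ((hasSum_mul_prod (m 0) (m 1)).add (hasSum_mul_prod (m 1) (m 0)))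
        (fun p => ?_) ?_
      · ring
      · ring)
    refine hasSum_of_eq (((m 2).sub c).mul_left (1 / 2)) (fun p => ?_) ?_
    · ring
    · ring
  · have c := hasSum_conv_of_prod (j := 1)
      (s := 2 * moment q x 1 ^ 2 + 2 * (moment q x 0 * moment q x 2)) h0 h1 hx0 (by
      refine hasSum_of_eq (((hasSum_mul_prod (m 0) (m 2)).add (hasSum_mul_prod (m 2) (m 0))).add
        ((hasSum_mul_prod (m 1) (m 1)).mul_left 2)) (fun p => ?_) ?_
      · ring
      · ring)
    refine hasSum_of_eq (((m 3).sub c).mul_left (1 / 2)) (fun p => ?_) ?_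
    · ring
    · ring
  · have c := hasSum_conv_of_prod (j := 2)
      (s := 6 * (moment q x 1 * moment q x 2) + 2 * (moment q x 0 * moment q x 3)) h0 h1 hx0 (by
      refine hasSum_of_eq (((hasSum_mul_prod (m 0) (m 3)).add (hasSum_mul_prod (m 3) (m 0))).add
        (((hasSum_mul_prod (m 1) (m 2)).add (hasSum_mul_prod (m 2) (m 1))).mul_left 3))
        (fun p => ?_) ?_
      · ring
      · ring)
    refine hasSum_of_eq (((m 4).sub c).mul_left (1 / 2)) (fun p => ?_) ?_
    · ring
    · ring

/-! ### The relations at a point of order three -/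

/-- The defect in the three-term relation at `(k, m)` is supported on the lines `k = 0`, `m = 0`
and `k = m`. -/
theorem lam_three_term {q : ℝ} (h0 : 0 < q) (h1 : q < 1) {k m : ℤ} (hm : m ≠ 0) :
    lam q k * lam q m - lam q (k - m) * lam q m - lam q (m - k) * lam q k =
      (if k = 0 then lam q m ^ 2 - lam q m else 0) +
        if k = m then lam q m ^ 2 - lam q m else 0 := by
  have e1 : lam q (m - k) = 1 - lam q (k - m) := by rw [← lam_neg h0 h1]; ring_nf
  rw [e1]
  rcases eq_or_ne k 0 with rfl | hk
  · rw [if_pos rfl, if_neg hm.symm, zero_sub, lam_neg h0 h1, lam_zero]; ring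
  · rw [if_neg hk]
    rcases eq_or_ne k m with rfl | hkm
    · rw [if_pos rfl, sub_self, lam_zero]; ring
    · rw [if_neg hkm]
      have := lam_mul_lam h0 h1 (sub_ne_zero.2 hkm) hm (by simpa using hk)
      rw [sub_add_cancel] at this
      linear_combination (-1 : ℝ) * this

/-- A weighted form of the three-term relation for a weight divisible by `m`. -/
theorem three_term_sum {q : ℝ} (h0 : 0 < q) (h1 : q < 1) {W : ℤ → ℤ → ℝ} {s₁ s₂ s₃ t₁ t₂ : ℝ}
    (hW : ∀ k, W k 0 = 0)
    (hs₁ : HasSum (fun p : ℤ × ℤ => W p.1 p.2 * ((lam q p.1 * q ^ p.1) * (lam q p.2 * q ^ p.2))) s₁)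
    (hs₂ : HasSum (fun p : ℤ × ℤ =>
      W (p.1 + p.2) p.2 * ((lam q p.1 * q ^ p.1) * (lam q p.2 * (q ^ 2) ^ p.2))) s₂)
    (hs₃ : HasSum (fun p : ℤ × ℤ =>
      W p.2 (p.1 + p.2) * ((lam q p.1 * q ^ p.1) * (lam q p.2 * (q ^ 2) ^ p.2))) s₃)
    (ht₁ : HasSum (fun m : ℤ => W 0 m * ((lam q m ^ 2 - lam q m) * q ^ m)) t₁)
    (ht₂ : HasSum (fun m : ℤ => W m m * ((lam q m ^ 2 - lam q m) * (q ^ 2) ^ m)) t₂) :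
    s₁ - s₂ - s₃ = t₁ + t₂ := by
  let e₂ : ℤ × ℤ ≃ ℤ × ℤ :=
    { toFun := fun p => (p.1 - p.2, p.2)
      invFun := fun p => (p.1 + p.2, p.2)
      left_inv := fun p => by ext <;> simp
      right_inv := fun p => by ext <;> simp }
  let e₃ : ℤ × ℤ ≃ ℤ × ℤ :=
    { toFun := fun p => (p.2 - p.1, p.1)
      invFun := fun p => (p.2, p.1 + p.2)
      left_inv := fun p => by ext <;> simp
      right_inv := fun p => by ext <;> simp }
  have hs₂' := e₂.hasSum_iff.2 hs₂
  have hs₃' := e₃.hasSum_iff.2 hs₃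
  have hL := (hs₁.sub hs₂').sub hs₃'
  have i₁ : Function.Injective fun m : ℤ => ((0 : ℤ), m) := fun a b h => by simpa using h
  have i₂ : Function.Injective fun m : ℤ => (m, m) := fun a b h => by simpa using h
  have g₁ : HasSum (fun p : ℤ × ℤ =>
      if p.1 = 0 then W p.1 p.2 * ((lam q p.2 ^ 2 - lam q p.2) * q ^ p.2) else 0) t₁ := by
    refine (i₁.hasSum_iff fun p hp => ?_).1 (by simpa [Function.comp_def] using ht₁)
    rw [if_neg]; rintro h; exact hp ⟨p.2, by ext <;> simp [h]⟩
  have g₂ : HasSum (fun p : ℤ × ℤ =>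
      if p.1 = p.2 then W p.1 p.2 * ((lam q p.2 ^ 2 - lam q p.2) * (q ^ 2) ^ p.2) else 0) t₂ := by
    refine (i₂.hasSum_iff fun p hp => ?_).1 (by simpa [Function.comp_def] using ht₂)
    rw [if_neg]; rintro h; exact hp ⟨p.2, by ext <;> simp [h]⟩
  refine hL.unique (hasSum_of_eq (g₁.add g₂) (fun p => ?_) rfl)
  obtain ⟨k, m⟩ := p
  simp only [Function.comp, e₂, e₃, Equiv.coe_fn_mk, sub_add_cancel]
  rcases eq_or_ne m 0 with rfl | hm
  · simp [hW]
  · have h := lam_three_term h0 h1 (k := k) hm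
    have hsq (n : ℤ) : (q ^ 2) ^ n = q ^ n * q ^ n := by rw [← mul_zpow, sq]
    have x₂ : q ^ (k - m) * (q ^ 2) ^ m = q ^ k * q ^ m := by
      rw [hsq, ← zpow_add₀ h0.ne', ← zpow_add₀ h0.ne', ← zpow_add₀ h0.ne']; ring_nf
    have x₃ : q ^ (m - k) * (q ^ 2) ^ k = q ^ k * q ^ m := by
      rw [hsq, ← zpow_add₀ h0.ne', ← zpow_add₀ h0.ne', ← zpow_add₀ h0.ne']; ring_nf
    have hL : W k m * (lam q k * q ^ k * (lam q m * q ^ m)) -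
          W k m * (lam q (k - m) * q ^ (k - m) * (lam q m * (q ^ 2) ^ m)) -
        W k m * (lam q (m - k) * q ^ (m - k) * (lam q k * (q ^ 2) ^ k)) =
        W k m * (q ^ k * q ^ m) * (lam q k * lam q m - lam q (k - m) * lam q m
          - lam q (m - k) * lam q k) := by
      linear_combination (-W k m * lam q (k - m) * lam q m) * x₂
        - (W k m * lam q (m - k) * lam q k) * x₃
    have e : k - m + m = k := by ring
    have e' : m - k + k = m := by ring
    rw [hL, h]
    rcases eq_or_ne k 0 with rfl | hk
    · simp [hm.symm]; ring
    · rcases eq_or_ne k m with rfl | hkm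
      · simp [hk, hsq]; ring
      · simp [hk, hkm]

/-- The constant term is normalised so that `6 * wtOne q` is the Eisenstein series of weight
one for the character modulo `3`. -/
noncomputable def wtOne (q : ℝ) : ℝ := moment q q 0 - 1 / 3

/-- The three-term relation at a point of order three with weight `m ^ 2`. -/
theorem moment_three {q : ℝ} (h0 : 0 < q) (h1 : q < 1) :
    moment q q 3 = 6 * wtOne q * moment q q 2 := by
  have m := hasSum_moment h0 h1 (x := q) (Or.inl rfl)
  have n := hasSum_moment h0 h1 (x := q ^ 2) (Or.inr rfl)
  have r := hasSum_moment_sq h0 h1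
  have h := three_term_sum h0 h1 (W := fun _ m => (m : ℝ) ^ 2) (by simp)
    (hasSum_of_eq (hasSum_mul_prod (m 0) (m 2)) (fun p => by ring) rfl)
    (hasSum_of_eq (hasSum_mul_prod (m 0) (n 2)) (fun p => by ring) rfl)
    (hasSum_of_eq
      (((hasSum_mul_prod (m 2) (n 0)).add ((hasSum_mul_prod (m 1) (n 1)).mul_left 2)).add
      (hasSum_mul_prod (m 0) (n 2))) (fun p => by push_cast; ring) rfl)
    (hasSum_sq_sub h0 h1 (Or.inl rfl)).2.1 (hasSum_sq_sub h0 h1 (Or.inr rfl)).2.1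
  simp only [r] at h
  norm_num at h
  unfold wtOne
  linear_combination (-1 : ℝ) * h

/-- The three-term relation at a point of order three with weight `k * m ^ 2`. -/
theorem moment_four {q : ℝ} (h0 : 0 < q) (h1 : q < 1) :
    moment q q 4 = 6 * wtOne q * moment q q 3 := by
  have m := hasSum_moment h0 h1 (x := q) (Or.inl rfl)
  have n := hasSum_moment h0 h1 (x := q ^ 2) (Or.inr rfl)
  have r := hasSum_moment_sq h0 h1
  have h := three_term_sum h0 h1 (W := fun k m => (k : ℝ) * (m : ℝ) ^ 2) (by simp)
    (hasSum_of_eq (hasSum_mul_prod (m 1) (m 2)) (fun p => by ring) rfl)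
    (hasSum_of_eq ((hasSum_mul_prod (m 1) (n 2)).add (hasSum_mul_prod (m 0) (n 3)))
      (fun p => by push_cast; ring) rfl)
    (hasSum_of_eq
      (((hasSum_mul_prod (m 2) (n 1)).add ((hasSum_mul_prod (m 1) (n 2)).mul_left 2)).add
      (hasSum_mul_prod (m 0) (n 3))) (fun p => by push_cast; ring) rfl)
    (hasSum_of_eq hasSum_zero (fun m => by simp) rfl)
    (hasSum_of_eq (hasSum_sq_sub h0 h1 (Or.inr rfl)).2.2 (fun m => by ring) rfl)
  simp only [r] at h
  norm_num at h
  unfold wtOne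
  linear_combination (2 : ℝ) * h

/-! ### The differential equations -/

theorem hasDerivAt_lam_mul_zpow {q : ℝ} (h0 : 0 < q) (h1 : q < 1) (k : ℤ) :
    HasDerivAt (fun q => lam q k * q ^ k)
      ((3 * (k * ((lam q k ^ 2 - lam q k) * q ^ k)) + k * (lam q k * q ^ k)) / q) q := by
  rcases eq_or_ne k 0 with rfl | hk
  · simpa [lam_zero] using hasDerivAt_const q (1 / 2 : ℝ)
  · have a := one_sub_zpow_ne h0 h1 hk
    have d1 := ((hasDerivAt_zpow (3 * k) q (Or.inl h0.ne')).const_sub 1).inv a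
    have d2 := hasDerivAt_zpow k q (Or.inl h0.ne')
    simp only [lam_of_ne _ hk]
    refine (d1.mul d2).congr_deriv ?_
    rw [zpow_sub_one₀ h0.ne', zpow_sub_one₀ h0.ne']
    simp only [Pi.inv_apply]
    generalize q ^ (3 * k) = z at a ⊢
    push_cast
    field_simp
    ring

theorem abs_deriv_lam_le {q p : ℝ} (h0 : 0 < q) (hqp : q ≤ p) (hp : p < 1) (k : ℤ) :
    |3 * (k * ((lam q k ^ 2 - lam q k) * q ^ k)) + k * (lam q k * q ^ k)|
      ≤ 4 * ((1 - p)⁻¹) ^ 2 * (|(k : ℝ)| ^ 1 * p ^ k.natAbs) := by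
  have hp' : 1 ≤ (1 - p)⁻¹ := (one_le_inv₀ (by linarith)).2 (by linarith)
  have hb := (abs_lam_mul_zpow_le h0 hqp hp k).1
  have hpow : q ^ k.natAbs ≤ p ^ k.natAbs := pow_le_pow_left₀ h0.le hqp _
  have hl : |lam q k - 1| ≤ (1 - p)⁻¹ := by
    rcases lt_trichotomy k 0 with hk | rfl | hk
    · obtain ⟨n, rfl⟩ : ∃ n : ℕ, k = -(n + 1 : ℕ) := ⟨(-k).toNat - 1, by omega⟩
      obtain ⟨ha, hb⟩ := lam_natCast_succ h0 hqp hp n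
      rw [lam_neg h0 (by linarith), abs_sub_comm, sub_sub_cancel, abs_of_pos ha]; exact hb
    · rw [lam_zero]; norm_num; linarith
    · obtain ⟨n, rfl⟩ : ∃ n : ℕ, k = (n + 1 : ℕ) := ⟨k.toNat - 1, by omega⟩
      obtain ⟨ha, hb⟩ := lam_natCast_succ h0 hqp hp n
      rw [abs_le]; constructor <;> linarith
  have e : 3 * (k * ((lam q k ^ 2 - lam q k) * q ^ k)) + k * (lam q k * q ^ k)
      = k * (lam q k * q ^ k) * (3 * (lam q k - 1) + 1) := by ring
  rw [e, abs_mul, abs_mul]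
  have h4 : |3 * (lam q k - 1) + 1| ≤ 4 * (1 - p)⁻¹ := by
    calc |3 * (lam q k - 1) + 1| ≤ |3 * (lam q k - 1)| + |1| := abs_add_le _ _
      _ = 3 * |lam q k - 1| + 1 := by rw [abs_mul]; norm_num
      _ ≤ _ := by linarith
  calc |(k : ℝ)| * |lam q k * q ^ k| * |3 * (lam q k - 1) + 1|
      ≤ |(k : ℝ)| * ((1 - p)⁻¹ * p ^ k.natAbs) * (4 * (1 - p)⁻¹) := by
        have : |lam q k * q ^ k| ≤ (1 - p)⁻¹ * p ^ k.natAbs := hb.trans (by gcongr)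
        exact mul_le_mul (by gcongr) h4 (abs_nonneg _) (mul_nonneg (abs_nonneg _)
          ((abs_nonneg _).trans this))
    _ = _ := by ring

/-- Termwise differentiation in the nome. Both the coefficients and their argument depend on `q`:
the sum `d` is the contribution of the former, which the heat equation evaluates. -/
theorem hasDerivAt_moment {q d : ℝ} (h0 : 0 < q) (h1 : q < 1) (j : ℕ)
    (hd : HasSum (fun k : ℤ => (k : ℝ) ^ (j + 1) * ((lam q k ^ 2 - lam q k) * q ^ k)) d) :
    HasDerivAt (fun q => moment q q j) ((3 * d + moment q q (j + 1)) / q) q := by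
  set p := (1 + q) / 2
  have hp : p < 1 := by simp only [p]; linarith
  have hqp : q < p := by simp only [p]; linarith
  have hp0 : 0 < p := by linarith
  set f' : ℤ → ℝ → ℝ := fun k q =>
    (k : ℝ) ^ j * ((3 * (k * ((lam q k ^ 2 - lam q k) * q ^ k)) + k * (lam q k * q ^ k)) / q)
  have key := hasDerivAt_tsum_of_isPreconnected (t := Set.Ioo (q / 2) p)
    (u := fun k : ℤ => (4 * ((1 - p)⁻¹) ^ 2 * (2 / q)) * (|(k : ℝ)| ^ (j + 1) * p ^ k.natAbs))
    (g := fun (k : ℤ) q => (k : ℝ) ^ j * (lam q k * q ^ k)) (g' := f') (y₀ := q) (y := q)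
    ((summable_natAbs_pow_mul hp0.le hp (j + 1)).mul_left _) isOpen_Ioo isPreconnected_Ioo
    (fun k y hy =>
      (hasDerivAt_lam_mul_zpow (by linarith [hy.1]) (by linarith [hy.2]) k).const_mul _)
    (fun k y hy => by
      have hy0 : 0 < y := by linarith [hy.1]
      have := abs_deriv_lam_le hy0 hy.2.le hp k
      simp only [f']
      rw [Real.norm_eq_abs, abs_mul, abs_div, abs_pow, abs_of_pos hy0]
      have h2 : 1 / y ≤ 2 / q := by
        rw [div_le_div_iff₀ hy0 h0]; linarith [hy.1]
      have hy1 : 0 < 1 / y := by positivity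
      have hpi : 0 < (1 - p)⁻¹ := inv_pos.2 (by linarith)
      rw [div_eq_mul_one_div]
      calc _ ≤ |(k : ℝ)| ^ j *
            ((4 * ((1 - p)⁻¹) ^ 2 * (|(k : ℝ)| ^ 1 * p ^ k.natAbs)) * (2 / q)) := by
            gcongr
        _ = _ := by ring)
    ⟨by linarith, hqp⟩ (summable_moment h0 h1 (Or.inl rfl) j) ⟨by linarith, hqp⟩
  refine key.congr_deriv ?_
  refine HasSum.tsum_eq (hasSum_of_eq
    (((hd.mul_left 3).add (hasSum_moment h0 h1 (Or.inl rfl) (j + 1))).div_const q)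
    (fun k => ?_) rfl)
  simp only [f']
  ring

theorem hasDerivAt_wtOne {q : ℝ} (h0 : 0 < q) (h1 : q < 1) :
    HasDerivAt wtOne (3 * (moment q q 2 / 2 - wtOne q * moment q q 1) / q) q := by
  have := (hasDerivAt_moment h0 h1 0 (hasSum_sq_sub h0 h1 (Or.inl rfl)).1).sub_const (1 / 3)
  refine this.congr_deriv ?_
  unfold wtOne; ring

theorem hasDerivAt_moment_one {q : ℝ} (h0 : 0 < q) (h1 : q < 1) :
    HasDerivAt (fun q => moment q q 1)
      (3 * (2 * wtOne q * moment q q 2 - moment q q 1 ^ 2) / q) q := by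
  refine (hasDerivAt_moment h0 h1 1 (hasSum_sq_sub h0 h1 (Or.inl rfl)).2.1).congr_deriv ?_
  rw [moment_three h0 h1]; unfold wtOne; ring

theorem hasDerivAt_moment_two {q : ℝ} (h0 : 0 < q) (h1 : q < 1) :
    HasDerivAt (fun q => moment q q 2)
      (3 * moment q q 2 * (12 * wtOne q ^ 2 - 3 * moment q q 1) / q) q := by
  refine (hasDerivAt_moment h0 h1 2 (hasSum_sq_sub h0 h1 (Or.inl rfl)).2.2).congr_deriv ?_
  rw [moment_four h0 h1, moment_three h0 h1]; unfold wtOne; ring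

open Asymptotics

/-! ### The hypergeometric function `₂F₁(1/3, 2/3; 1; s)` -/

theorem summable_pow_of_bound {f : ℕ → ℝ} {C x : ℝ} {p : ℕ}
    (hf : ∀ n, |f n| ≤ C * ((n : ℝ) + 1) ^ p) (hx : |x| < 1) : Summable fun n => f n * x ^ n := by
  have h1 : Summable fun n : ℕ => ((n : ℝ) + 1) ^ p * |x| ^ n := by
    rcases eq_or_ne x 0 with rfl | hx0
    · refine summable_of_ne_finset_zero (s := {0}) fun n hn => ?_
      have : n ≠ 0 := by simpa using hn
      simp [this]
    · have := (summable_nat_add_iff 1).2 (summable_pow_mul_geometric_of_norm_lt_one (R := ℝ) p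
        (r := |x|) (by simpa using hx))
      refine (this.mul_left (|x|)⁻¹).congr fun n => ?_
      have : |x| ≠ 0 := by simpa using hx0
      rw [pow_succ]; push_cast; field_simp
  refine Summable.of_norm_bounded (h1.mul_left C) fun n => ?_
  rw [Real.norm_eq_abs, abs_mul, abs_pow, ← mul_assoc]
  gcongr
  exact hf n

/-- Termwise differentiation of a power series whose coefficients grow at most polynomially. -/
theorem hasDerivAt_tsum_pow {f : ℕ → ℝ} {C x : ℝ} {p : ℕ}
    (hf : ∀ n, |f n| ≤ C * ((n : ℝ) + 1) ^ p) (hx : |x| < 1) :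
    HasDerivAt (fun x => ∑' n, f n * x ^ n) (∑' n : ℕ, ((n : ℝ) + 1) * f (n + 1) * x ^ n) x := by
  set r := (1 + |x|) / 2
  have hxr : |x| < r := by simp only [r]; linarith
  have hr1 : r < 1 := by simp only [r]; linarith
  have hr0 : 0 < r := by linarith [abs_nonneg x]
  have hC : 0 ≤ C := by
    have := (abs_nonneg _).trans (hf 0)
    simpa using this
  have hu : Summable fun n : ℕ => C * ((n : ℝ) + 1) ^ p * (n * r ^ (n - 1)) := by
    rw [← summable_nat_add_iff 1]
    refine (summable_pow_of_bound (f := fun n : ℕ => C * 2 ^ p * ((n : ℝ) + 1) ^ (p + 1))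
      (C := C * 2 ^ p) (p := p + 1) (x := r)
      (fun n => ?_) (by rwa [abs_of_pos hr0])).of_nonneg_of_le
      (fun n => by positivity) (fun n => ?_)
    · rw [abs_of_nonneg (by positivity)]
    · simp only [Nat.add_sub_cancel]
      have : ((n + 1 : ℕ) : ℝ) + 1 ≤ 2 * (n + 1) := by push_cast; linarith
      calc C * (((n + 1 : ℕ) : ℝ) + 1) ^ p * (((n + 1 : ℕ) : ℝ) * r ^ n)
          ≤ C * (2 * ((n : ℝ) + 1)) ^ p * (((n + 1 : ℕ) : ℝ) * r ^ n) := by gcongr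
        _ = _ := by rw [mul_pow]; push_cast; ring
  have key := hasDerivAt_tsum_of_isPreconnected (t := Metric.ball (0 : ℝ) r)
    (g := fun (n : ℕ) y => f n * y ^ n) (g' := fun n y => f n * (n * y ^ (n - 1)))
    (y₀ := 0) (y := x) hu Metric.isOpen_ball (convex_ball _ _).isPreconnected
    (fun n y hy => (hasDerivAt_pow n y).const_mul _)
    (fun n y hy => by
      have hy' : |y| < r := by simpa using hy
      rw [Real.norm_eq_abs, abs_mul, abs_mul, abs_pow, Nat.abs_cast]
      gcongr
      exact hf n)
    (by simpa using hr0) (summable_pow_of_bound hf (by simp)) (by simpa using hxr)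
  refine key.congr_deriv ?_
  have hs : Summable fun n : ℕ => f n * (n * x ^ (n - 1)) := by
    refine Summable.of_norm_bounded hu fun n => ?_
    rw [Real.norm_eq_abs, abs_mul, abs_mul, abs_pow, Nat.abs_cast]
    gcongr
    exact hf n
  rw [hs.tsum_eq_zero_add]
  simp only [Nat.cast_zero, zero_mul, mul_zero, zero_add, Nat.add_sub_cancel]
  refine tsum_congr fun n => ?_
  push_cast; ring

/-- The coefficients `(1/3)_n (2/3)_n / n!² = (3 n)! / (27ⁿ n!³)`. -/
noncomputable def hypCoeff (n : ℕ) : ℝ :=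
  ((3 * n).factorial : ℝ) / (27 ^ n * (n.factorial : ℝ) ^ 3)

/-- The function `₂F₁(1/3, 2/3; 1; s)`. -/
noncomputable def hyp (s : ℝ) : ℝ := ∑' n, hypCoeff n * s ^ n

/-- The coefficients of the series `s (1 - s) hyp' s`. -/
noncomputable def hypFluxCoeff : ℕ → ℝ
  | 0 => 0
  | n + 1 => 2 / 9 * hypCoeff n / (n + 1)

/-- The function `s (1 - s) hyp' s`, given by its power series. -/
noncomputable def hypFlux (s : ℝ) : ℝ := ∑' n : ℕ, hypFluxCoeff n * s ^ n

theorem hypCoeff_pos (n : ℕ) : 0 < hypCoeff n := by unfold hypCoeff; positivity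

theorem hypCoeff_zero : hypCoeff 0 = 1 := by simp [hypCoeff]

theorem hypCoeff_succ (n : ℕ) :
    ((n : ℝ) + 1) ^ 2 * hypCoeff (n + 1) = ((n : ℝ) + 1 / 3) * (n + 2 / 3) * hypCoeff n := by
  unfold hypCoeff
  rw [show 3 * (n + 1) = 3 * n + 1 + 1 + 1 by ring, Nat.factorial_succ, Nat.factorial_succ,
    Nat.factorial_succ, Nat.factorial_succ]
  push_cast
  have : (n.factorial : ℝ) ≠ 0 := by positivity
  field_simp
  ring

theorem hypCoeff_succ_le (n : ℕ) : hypCoeff (n + 1) ≤ hypCoeff n := by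
  have h := hypCoeff_succ n
  have h0 := hypCoeff_pos n
  have : ((n : ℝ) + 1) ^ 2 * hypCoeff (n + 1) ≤ ((n : ℝ) + 1) ^ 2 * hypCoeff n := by
    rw [h]; gcongr; nlinarith [(n.cast_nonneg : (0 : ℝ) ≤ n)]
  exact le_of_mul_le_mul_left this (by positivity)

theorem hypCoeff_le_one (n : ℕ) : hypCoeff n ≤ 1 := by
  induction n with
  | zero => rw [hypCoeff_zero]
  | succ n ih => exact (hypCoeff_succ_le n).trans ih

/-- Stirling's formula. The limit is the coefficient of the logarithmic singularity of `hyp` at `1`,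
and so the constant in its Wronskian. -/
theorem tendsto_mul_hypCoeff :
    Tendsto (fun n : ℕ => n * hypCoeff n) atTop (𝓝 (√3 / (2 * Real.pi))) := by
  have s1 := Stirling.factorial_isEquivalent_stirling
  have h3 : Tendsto (fun n : ℕ => 3 * n) atTop atTop :=
    tendsto_id.const_mul_atTop' (by norm_num)
  have s3 := s1.comp_tendsto h3
  have h := (s3.div ((IsEquivalent.refl (u := fun n : ℕ => (27 : ℝ) ^ n)).mul (s1.pow 3)))
  have h' := (IsEquivalent.refl (u := fun n : ℕ => (n : ℝ))).mul h
  have e : ((fun n : ℕ => (n : ℝ)) * (fun n : ℕ => hypCoeff n)) ~[atTop]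
      fun _ => √3 / (2 * Real.pi) := by
    refine IsEquivalent.trans (h'.congr_left (Eventually.of_forall fun n => ?_)) ?_
    · simp [hypCoeff]
    · refine IsEquivalent.congr_left (u := fun _ => √3 / (2 * Real.pi)) IsEquivalent.refl ?_
      filter_upwards [eventually_gt_atTop 0] with n hn
      have hn' : (0 : ℝ) < n := by exact_mod_cast hn
      have hpi := Real.pi_pos
      have he := Real.exp_pos 1
      have e1 : √(2 * ((3 * n : ℕ) : ℝ) * Real.pi) = √3 * √(2 * n * Real.pi) := by
        rw [← Real.sqrt_mul (by norm_num)]; congr 1; push_cast; ring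
      have hsq : √(2 * n * Real.pi) ^ 2 = 2 * n * Real.pi := Real.sq_sqrt (by positivity)
      have hsp : 0 < √(2 * n * Real.pi) := Real.sqrt_pos.2 (by positivity)
      simp only [Pi.mul_apply, Pi.div_apply, Pi.pow_apply, Function.comp]
      rw [e1]
      set w := √(2 * n * Real.pi)
      have e2 : (((3 * n : ℕ) : ℝ) / Real.exp 1) ^ (3 * n) =
          27 ^ n * ((n / Real.exp 1) ^ n) ^ 3 := by
        push_cast
        rw [show (27 : ℝ) = 3 ^ 3 by norm_num, ← pow_mul, ← pow_mul, mul_comm n 3, ← mul_pow]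
        congr 1; ring
      rw [e2]
      have hx : ((n : ℝ) / Real.exp 1) ^ n ≠ 0 := by positivity
      have e3 : (n : ℝ) * (√3 * w * (27 ^ n * ((n / Real.exp 1) ^ n) ^ 3) /
          (27 ^ n * (w * (n / Real.exp 1) ^ n) ^ 3)) = n * √3 / w ^ 2 := by
        field_simp
      rw [e3, hsq]
      field_simp
  exact (isEquivalent_const_iff_tendsto (by positivity)).1 e

theorem hypCoeff_bound (n : ℕ) : |hypCoeff n| ≤ 1 * ((n : ℝ) + 1) ^ 0 := by
  rw [abs_of_pos (hypCoeff_pos n)]; simpa using hypCoeff_le_one n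

/-- The coefficients of the flux telescope, so their sum up to the index `n` is `n * hypCoeff n`. -/
theorem hypFluxCoeff_succ (n : ℕ) :
    hypFluxCoeff (n + 1) = (n + 1) * hypCoeff (n + 1) - n * hypCoeff n := by
  have := hypCoeff_succ n
  simp only [hypFluxCoeff]
  field_simp
  linear_combination (-9 : ℝ) * this

theorem hypFluxCoeff_nonneg (n : ℕ) : 0 ≤ hypFluxCoeff n := by
  cases n with
  | zero => simp [hypFluxCoeff]
  | succ n => have := hypCoeff_pos n; simp only [hypFluxCoeff]; positivity

theorem hypFlux_bound (n : ℕ) : |hypFluxCoeff n| ≤ 1 * ((n : ℝ) + 1) ^ 0 := by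
  rw [abs_of_nonneg (hypFluxCoeff_nonneg n)]
  cases n with
  | zero => simp [hypFluxCoeff]
  | succ n =>
    have := hypCoeff_pos n
    have := hypCoeff_le_one n
    simp only [hypFluxCoeff, pow_zero, mul_one]
    rw [div_le_one (by positivity)]
    linarith [(n.cast_nonneg : (0 : ℝ) ≤ n)]

theorem hasSum_hyp {s : ℝ} (hs : |s| < 1) : HasSum (fun n => hypCoeff n * s ^ n) (hyp s) :=
  (summable_pow_of_bound hypCoeff_bound hs).hasSum

/-- The hypergeometric equation, in self-adjoint form. -/
theorem hasDerivAt_hypFlux {s : ℝ} (hs : |s| < 1) : HasDerivAt hypFlux (2 / 9 * hyp s) s := by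
  refine (hasDerivAt_tsum_pow hypFlux_bound hs).congr_deriv ?_
  unfold hyp
  rw [← tsum_mul_left]
  refine tsum_congr fun n => ?_
  simp only [hypFluxCoeff]
  field_simp

theorem hasDerivAt_hyp_aux {s : ℝ} (hs : |s| < 1) :
    ∃ d, HasDerivAt hyp d s ∧ s * (1 - s) * d = hypFlux s := by
  refine ⟨_, hasDerivAt_tsum_pow hypCoeff_bound hs, ?_⟩
  set a : ℕ → ℝ := fun n => (n : ℝ) * hypCoeff n with ha
  have hab (n : ℕ) : |a n| ≤ 1 * ((n : ℝ) + 1) ^ 1 := by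
    have h1 := hypCoeff_pos n
    have h2 := hypCoeff_le_one n
    have hn : (0 : ℝ) ≤ n := n.cast_nonneg
    rw [abs_of_nonneg (by positivity)]
    simp only [ha]; nlinarith
  have hA := (summable_pow_of_bound hab hs).hasSum
  set D := ∑' n, a n * s ^ n with hD
  have e1 : s * ∑' n : ℕ, ((n : ℝ) + 1) * hypCoeff (n + 1) * s ^ n = D := by
    rw [hD, hA.summable.tsum_eq_zero_add, ← tsum_mul_left]
    simp only [ha, Nat.cast_zero, zero_mul, zero_add]
    refine tsum_congr fun n => ?_
    push_cast; ring
  have e2 : hypFlux s = D - s * D := by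
    have hF := (summable_pow_of_bound hypFlux_bound hs)
    unfold hypFlux
    rw [hF.tsum_eq_zero_add, hD]
    nth_rw 1 [hA.summable.tsum_eq_zero_add]
    rw [← tsum_mul_left]
    simp only [ha, hypFluxCoeff, Nat.cast_zero, zero_mul, zero_add]
    rw [← ((summable_nat_add_iff 1).2 hA.summable).tsum_sub (hA.summable.mul_left s)]
    refine tsum_congr fun n => ?_
    have := hypFluxCoeff_succ n
    simp only [hypFluxCoeff] at this
    rw [this]
    simp only [ha]
    push_cast; ring
  rw [e2, ← e1]; ring

theorem hasDerivAt_hyp {s : ℝ} (h0 : 0 < s) (h1 : s < 1) :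
    HasDerivAt hyp (hypFlux s / (s * (1 - s))) s := by
  obtain ⟨d, hd, e⟩ := hasDerivAt_hyp_aux (s := s) (by rwa [abs_of_pos h0])
  refine hd.congr_deriv ?_
  have : 1 - s ≠ 0 := by linarith
  rw [← e]; field_simp

theorem continuousAt_hyp {s : ℝ} (hs : |s| < 1) : ContinuousAt hyp s :=
  (hasDerivAt_hyp_aux hs).choose_spec.1.continuousAt

theorem continuousAt_hypFlux {s : ℝ} (hs : |s| < 1) : ContinuousAt hypFlux s :=
  (hasDerivAt_hypFlux hs).continuousAt

/-- The Wronskian constant of the hypergeometric equation. -/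
noncomputable def wronskianConst : ℝ := √3 / (2 * Real.pi)

/-- Abel's limit theorem, the partial sums of the coefficients being `n * hypCoeff n`. -/
theorem tendsto_hypFlux_one : Tendsto hypFlux (𝓝[<] 1) (𝓝 wronskianConst) := by
  refine Real.tendsto_tsum_powerSeries_nhdsWithin_lt ?_
  rw [← tendsto_add_atTop_iff_nat 1]
  refine tendsto_mul_hypCoeff.congr fun n => ?_
  induction n with
  | zero => simp [hypFluxCoeff]
  | succ n ih => rw [Finset.sum_range_succ, ← ih, hypFluxCoeff_succ]; push_cast; ring

theorem tendsto_hypCoeff : Tendsto hypCoeff atTop (𝓝 0) := by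
  have h := tendsto_mul_hypCoeff.mul (tendsto_inv_atTop_nhds_zero_nat (𝕜 := ℝ))
  rw [mul_zero] at h
  refine h.congr' ?_
  filter_upwards [eventually_gt_atTop 0] with n hn
  have : (n : ℝ) ≠ 0 := by exact_mod_cast hn.ne'
  field_simp

/-- The singularity of `hyp` at `1` is milder than a pole. This is Abel's limit theorem for the
series `(1 - s) * hyp s`, whose partial sums of coefficients are `hypCoeff n`. -/
theorem tendsto_one_sub_mul_hyp : Tendsto (fun s => (1 - s) * hyp s) (𝓝[<] 1) (𝓝 0) := by
  let f : ℕ → ℝ := fun n => hypCoeff n - if n = 0 then 0 else hypCoeff (n - 1)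
  have h : Tendsto (fun s : ℝ => ∑' n, f n * s ^ n) (𝓝[<] 1) (𝓝 0) := by
    refine Real.tendsto_tsum_powerSeries_nhdsWithin_lt ?_
    rw [← tendsto_add_atTop_iff_nat 1]
    refine tendsto_hypCoeff.congr fun n => ?_
    induction n with
    | zero => simp [f]
    | succ n ih => rw [Finset.sum_range_succ, ← ih]; simp [f]
  refine h.congr' ?_
  filter_upwards [Ioo_mem_nhdsLT (show (0 : ℝ) < 1 by norm_num)] with s hs
  have hs' : |s| < 1 := by rw [abs_of_pos hs.1]; exact hs.2
  have hF := hasSum_hyp hs'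
  have hF1 := (hasSum_nat_add_iff' 1).2 hF
  have h2 := hF1.sub (hF.mul_left s)
  have h3 : HasSum (fun n => f (n + 1) * s ^ (n + 1)) (hyp s - 1 - s * hyp s) := by
    refine hasSum_of_eq h2 (fun n => ?_) (by simp [hypCoeff_zero])
    simp [f]; ring
  have h4 := (hasSum_nat_add_iff (f := fun n => f n * s ^ n) 1).1 h3
  rw [h4.tsum_eq]
  simp [f, hypCoeff_zero]; ring

theorem one_le_hyp {s : ℝ} (h0 : 0 ≤ s) (h1 : s < 1) : 1 ≤ hyp s := by
  have h := hasSum_hyp (s := s) (by rwa [abs_of_nonneg h0])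
  have := le_hasSum h 0 fun n _ => by have := hypCoeff_pos n; positivity
  simpa [hypCoeff_zero] using this

theorem hyp_zero : hyp 0 = 1 := by
  unfold hyp
  rw [tsum_eq_single 0 (fun n hn => by simp [hn])]
  simp [hypCoeff_zero]

theorem hypFlux_zero : hypFlux 0 = 0 := by
  unfold hypFlux
  rw [tsum_eq_single 0 (fun n hn => by simp [hn])]
  simp [hypFluxCoeff]

theorem hyp_strictMonoOn : StrictMonoOn hyp (Set.Ico 0 1) := by
  intro s hs t ht hst
  have h1 := hasSum_hyp (s := s) (by rw [abs_of_nonneg hs.1]; exact hs.2)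
  have h2 := hasSum_hyp (s := t) (by rw [abs_of_nonneg ht.1]; exact ht.2)
  refine hasSum_lt (i := 1) (fun n => ?_) ?_ h1 h2
  · exact mul_le_mul_of_nonneg_left (pow_le_pow_left₀ hs.1 hst.le n) (hypCoeff_pos n).le
  · exact mul_lt_mul_of_pos_left (by simpa using hst) (hypCoeff_pos 1)

theorem eq_of_hasDerivAt_zero {f : ℝ → ℝ} {u v : ℝ}
    (hf : ∀ x ∈ Set.Ioo u v, HasDerivAt f 0 x) {x y : ℝ} (hx : x ∈ Set.Ioo u v)
    (hy : y ∈ Set.Ioo u v) : f x = f y :=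
  isOpen_Ioo.is_const_of_deriv_eq_zero isPreconnected_Ioo
    (fun z hz => (hf z hz).differentiableAt.differentiableWithinAt)
    (fun z hz => (hf z hz).deriv) hx hy

theorem eq_of_hasDerivAt_zero_of_tendsto_left {f : ℝ → ℝ} {u v l : ℝ} (huv : u < v)
    (hf : ∀ x ∈ Set.Ioo u v, HasDerivAt f 0 x) (hl : Tendsto f (𝓝[>] u) (𝓝 l)) {x : ℝ}
    (hx : x ∈ Set.Ioo u v) : f x = l := by
  refine tendsto_nhds_unique ?_ hl
  refine tendsto_const_nhds.congr' ?_
  filter_upwards [Ioo_mem_nhdsGT huv] with y hy using eq_of_hasDerivAt_zero hf hx hy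

theorem eq_of_hasDerivAt_zero_of_tendsto_right {f : ℝ → ℝ} {u v l : ℝ} (huv : u < v)
    (hf : ∀ x ∈ Set.Ioo u v, HasDerivAt f 0 x) (hl : Tendsto f (𝓝[<] v) (𝓝 l)) {x : ℝ}
    (hx : x ∈ Set.Ioo u v) : f x = l := by
  refine tendsto_nhds_unique ?_ hl
  refine tendsto_const_nhds.congr' ?_
  filter_upwards [Ioo_mem_nhdsLT huv] with y hy using eq_of_hasDerivAt_zero hf hx hy

/-- The Wronskian of the solutions `hyp s` and `hyp (1 - s)`, an analogue of Legendre's relation. -/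
theorem hyp_wronskian {s : ℝ} (hs : s ∈ Set.Ioo (0 : ℝ) 1) :
    hypFlux (1 - s) * hyp s + hyp (1 - s) * hypFlux s = wronskianConst := by
  refine eq_of_hasDerivAt_zero_of_tendsto_left (u := 0) (v := 1) zero_lt_one (fun x hx => ?_)
    ?_ hs (f := fun s => hypFlux (1 - s) * hyp s + hyp (1 - s) * hypFlux s)
  · have hx1 : 1 - x ∈ Set.Ioo (0 : ℝ) 1 := ⟨by linarith [hx.2], by linarith [hx.1]⟩
    have abs1 {y : ℝ} (hy : y ∈ Set.Ioo (0 : ℝ) 1) : |y| < 1 := by rw [abs_of_pos hy.1]; exact hy.2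
    have hr : HasDerivAt (fun s : ℝ => 1 - s) (-1) x := by
      simpa using (hasDerivAt_id x).const_sub 1
    have d1 := (hasDerivAt_hypFlux (abs1 hx1)).comp x hr
    have d2 := (hasDerivAt_hyp hx1.1 hx1.2).comp x hr
    have d3 := hasDerivAt_hyp hx.1 hx.2
    have d4 := hasDerivAt_hypFlux (abs1 hx)
    refine ((d1.mul d3).add (d2.mul d4)).congr_deriv ?_
    have := hx.1.ne'
    have := hx1.1.ne'
    simp only [Function.comp]
    rw [sub_sub_cancel]
    field_simp
    ring
  · have hr : Tendsto (fun s : ℝ => 1 - s) (𝓝[>] 0) (𝓝[<] 1) := by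
      refine tendsto_nhdsWithin_iff.2 ⟨?_, ?_⟩
      · have : Tendsto (fun s : ℝ => 1 - s) (𝓝 0) (𝓝 (1 - 0)) := by
          exact (continuous_const.sub continuous_id).tendsto 0
        rw [sub_zero] at this
        exact this.mono_left nhdsWithin_le_nhds
      · filter_upwards [self_mem_nhdsWithin] with s hs
        simpa using hs
    have t1 := tendsto_hypFlux_one.comp hr
    have t2 : Tendsto hyp (𝓝[>] 0) (𝓝 1) := by
      have := (continuousAt_hyp (s := 0) (by simp)).tendsto
      rw [hyp_zero] at this
      exact this.mono_left nhdsWithin_le_nhds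
    have t3 := tendsto_one_sub_mul_hyp.comp hr
    have t4 : Tendsto (fun s => hypFlux s / s) (𝓝[>] 0) (𝓝 (2 / 9)) := by
      have h := hasDerivAt_hypFlux (s := 0) (by simp)
      rw [hyp_zero, mul_one, hasDerivAt_iff_tendsto_slope_zero] at h
      refine (h.mono_left (nhdsWithin_mono _ ?_)).congr fun s => ?_
      · intro x hx; exact (ne_of_gt hx)
      · simp [hypFlux_zero, div_eq_inv_mul]
    have := (t1.mul t2).add (t3.mul t4)
    simp only [mul_one, zero_mul, add_zero] at this
    refine this.congr' ?_
    filter_upwards [self_mem_nhdsWithin] with s hs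
    have : s ≠ 0 := ne_of_gt hs
    simp only [Function.comp, sub_sub_cancel]
    field_simp

/-! ### The modular parametrisation -/

/-- The two halves of the Lambert series, folded together by `lam q (-k) = 1 - lam q k`. -/
theorem hasSum_moment_nat {q : ℝ} (h0 : 0 < q) (h1 : q < 1) (j : ℕ) :
    HasSum (fun n : ℕ => ((n : ℝ) + 1) ^ j *
      ((q ^ (n + 1) - (-1) ^ j * (q ^ (n + 1)) ^ 2) / (1 - (q ^ (n + 1)) ^ 3)))
      (moment q q j - if j = 0 then 1 / 2 else 0) := by
  have h := (hasSum_nat_add_iff' 1).2 (hasSum_moment h0 h1 (Or.inl rfl) j).nat_add_neg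
  refine hasSum_of_eq h (fun n => ?_) ?_
  · have a := one_sub_zpow_ne h0 h1 (k := ((n + 1 : ℕ) : ℤ)) (by omega)
    rw [lam_neg_natCast_succ h0 h1, lam_of_ne q (by omega), zpow_neg, zpow_natCast]
    have e : q ^ (3 * ((n + 1 : ℕ) : ℤ)) = (q ^ (n + 1)) ^ 3 := by
      rw [mul_comm, zpow_mul, zpow_natCast]; norm_cast
    have e2 : q ^ (3 * (n + 1)) = (q ^ (n + 1)) ^ 3 := by rw [mul_comm, pow_mul]
    rw [e] at a ⊢
    rw [e2]
    have hz : q ^ (n + 1) ≠ 0 := by positivity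
    generalize q ^ (n + 1) = z at a hz ⊢
    push_cast
    rw [neg_pow ((n : ℝ) + 1) j]
    field_simp
    ring
  · rcases eq_or_ne j 0 with rfl | hj
    · simp [lam_zero]
    · simp [hj]

theorem lambert_term_bounds {x : ℝ} (h0 : 0 < x) (h1 : x < 1) :
    0 < (x - x ^ 2) / (1 - x ^ 3) ∧ (x - x ^ 2) / (1 - x ^ 3) = x / (1 + x + x ^ 2) := by
  have e : (x - x ^ 2) / (1 - x ^ 3) = x / (1 + x + x ^ 2) := by
    have a : 1 - x ^ 3 ≠ 0 := by
      have : x ^ 3 < 1 := pow_lt_one₀ h0.le h1 (by norm_num)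
      linarith
    have b : 1 + x + x ^ 2 ≠ 0 := by positivity
    rw [div_eq_div_iff a b]; ring
  exact ⟨by rw [e]; positivity, e⟩

theorem hasSum_wtOne {q : ℝ} (h0 : 0 < q) (h1 : q < 1) :
    HasSum (fun n : ℕ => q ^ (n + 1) / (1 + q ^ (n + 1) + (q ^ (n + 1)) ^ 2))
      (wtOne q - 1 / 6) := by
  refine hasSum_of_eq (hasSum_moment_nat h0 h1 0) (fun n => ?_) ?_
  · have := (lambert_term_bounds (pow_pos h0 (n + 1)) (pow_lt_one₀ h0.le h1 (by omega))).2
    rw [← this]; simp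
  · unfold wtOne; norm_num; ring

theorem wtOne_pos {q : ℝ} (h0 : 0 < q) (h1 : q < 1) : 0 < wtOne q := by
  have := (hasSum_wtOne h0 h1).nonneg fun n => by positivity
  linarith

theorem moment_two_pos {q : ℝ} (h0 : 0 < q) (h1 : q < 1) : 0 < moment q q 2 := by
  have h := hasSum_moment_nat h0 h1 2
  have pos (n : ℕ) : 0 < ((n : ℝ) + 1) ^ 2 *
      ((q ^ (n + 1) - (-1) ^ 2 * (q ^ (n + 1)) ^ 2) / (1 - (q ^ (n + 1)) ^ 3)) := by
    have := (lambert_term_bounds (pow_pos h0 (n + 1)) (pow_lt_one₀ h0.le h1 (by omega))).1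
    rw [show ((-1 : ℝ)) ^ 2 = 1 by norm_num, one_mul]
    positivity
  have := hasSum_lt (i := 0) (fun n => (pos n).le) (pos 0) (hasSum_zero (α := ℝ) (β := ℕ)) h
  simpa using this

/-- The weight one Eisenstein series blows up at the cusp `q = 1`. -/
theorem tendsto_wtOne_one : Tendsto wtOne (𝓝[<] 1) atTop := by
  rw [tendsto_atTop]
  intro M
  obtain ⟨N, hN⟩ := exists_nat_gt (3 * M)
  have ht : Tendsto (fun q : ℝ => ∑ n ∈ Finset.range N,
      q ^ (n + 1) / (1 + q ^ (n + 1) + (q ^ (n + 1)) ^ 2)) (𝓝[<] 1) (𝓝 ((N : ℝ) / 3)) := by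
    have : Tendsto (fun q : ℝ => ∑ n ∈ Finset.range N,
        q ^ (n + 1) / (1 + q ^ (n + 1) + (q ^ (n + 1)) ^ 2)) (𝓝 1)
        (𝓝 (∑ n ∈ Finset.range N, (1 : ℝ) ^ (n + 1) / (1 + 1 ^ (n + 1) + (1 ^ (n + 1)) ^ 2))) := by
      refine tendsto_finsetSum _ fun n _ => ContinuousAt.tendsto ?_
      refine ContinuousAt.div (by fun_prop) (by fun_prop) ?_
      norm_num
    have e : (∑ n ∈ Finset.range N, (1 : ℝ) ^ (n + 1) / (1 + 1 ^ (n + 1) + (1 ^ (n + 1)) ^ 2))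
        = (N : ℝ) / 3 := by
      norm_num; ring
    rw [e] at this
    exact this.mono_left nhdsWithin_le_nhds
  have hM : M < (N : ℝ) / 3 := by linarith
  filter_upwards [ht.eventually_const_lt hM, Ioo_mem_nhdsLT (show (0 : ℝ) < 1 by norm_num)]
    with q h hq
  have := sum_le_hasSum (Finset.range N) (fun n _ => by have := hq.1; positivity)
    (hasSum_wtOne hq.1 hq.2)
  linarith

theorem tendsto_moment_zero (j : ℕ) :
    Tendsto (fun q => moment q q j) (𝓝[>] 0) (𝓝 (if j = 0 then 1 / 2 else 0)) := by
  have e : (if j = 0 then (1 / 2 : ℝ) else 0) = ∑' k : ℤ, if k = 0 then (0 : ℝ) ^ j / 2 else 0 := by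
    rw [tsum_ite_eq]
    rcases eq_or_ne j 0 with rfl | hj <;> simp [*]
  rw [e]
  refine tendsto_tsum_of_dominated_convergence
    (bound := fun k : ℤ => (1 - 1 / 2)⁻¹ * (|(k : ℝ)| ^ j * (1 / 2) ^ k.natAbs))
    ((summable_natAbs_pow_mul (by norm_num) (by norm_num) j).mul_left _) (fun k => ?_) ?_
  · rcases eq_or_ne k 0 with rfl | hk
    · simp [lam_zero, div_eq_mul_inv]
    · rw [if_neg hk]
      have hb : Tendsto (fun q : ℝ => |(k : ℝ)| ^ j * ((1 - 1 / 2)⁻¹ * q ^ k.natAbs)) (𝓝[>] 0)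
          (𝓝 0) := by
        have : Tendsto (fun q : ℝ => |(k : ℝ)| ^ j * ((1 - 1 / 2)⁻¹ * q ^ k.natAbs)) (𝓝 0)
            (𝓝 (|(k : ℝ)| ^ j * ((1 - 1 / 2)⁻¹ * 0 ^ k.natAbs))) :=
          ContinuousAt.tendsto (by fun_prop)
        rw [zero_pow (by simpa using hk), mul_zero, mul_zero] at this
        exact this.mono_left nhdsWithin_le_nhds
      refine squeeze_zero_norm' ?_ hb
      filter_upwards [Ioc_mem_nhdsGT (show (0 : ℝ) < 1 / 2 by norm_num)] with q hq
      rw [Real.norm_eq_abs, abs_mul, abs_pow]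
      gcongr
      exact (abs_lam_mul_zpow_le hq.1 hq.2 (by norm_num) k).1
  · filter_upwards [Ioc_mem_nhdsGT (show (0 : ℝ) < 1 / 2 by norm_num)] with q hq k
    rw [Real.norm_eq_abs, abs_mul, abs_pow]
    have h1 := (abs_lam_mul_zpow_le hq.1 hq.2 (by norm_num) k).1
    have h2 : q ^ k.natAbs ≤ (1 / 2) ^ k.natAbs := pow_le_pow_left₀ hq.1.le hq.2 _
    calc |(k : ℝ)| ^ j * |lam q k * q ^ k|
        ≤ |(k : ℝ)| ^ j * ((1 - 1 / 2)⁻¹ * (1 / 2) ^ k.natAbs) := by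
          gcongr; exact h1.trans (by gcongr)
      _ = _ := by ring

theorem tendsto_wtOne_zero : Tendsto wtOne (𝓝[>] 0) (𝓝 (1 / 6)) := by
  have := (tendsto_moment_zero 0).sub_const (1 / 3)
  norm_num at this
  exact this

/-- The weight one Eisenstein series `1 + 6 ∑ₙ (∑_{k ∣ n} (k/3)) qⁿ`. -/
noncomputable def eisOne (q : ℝ) : ℝ := 6 * wtOne q

/-- The modular function `s = 27 E_{3b} / (E_{3a} + 27 E_{3b})`, as a function of `q`; here
`moment q q 2` is `E_{3b}` and `E_{3a} + 27 E_{3b}` is the cube of `eisOne q`. -/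
noncomputable def hauptmodul (q : ℝ) : ℝ := 27 * moment q q 2 / eisOne q ^ 3

theorem eisOne_pos {q : ℝ} (h0 : 0 < q) (h1 : q < 1) : 0 < eisOne q := by
  have := wtOne_pos h0 h1
  unfold eisOne; positivity

theorem hauptmodul_pos {q : ℝ} (h0 : 0 < q) (h1 : q < 1) : 0 < hauptmodul q := by
  have := moment_two_pos h0 h1
  have := eisOne_pos h0 h1
  unfold hauptmodul; positivity

theorem tendsto_eisOne_zero : Tendsto eisOne (𝓝[>] 0) (𝓝 1) := by
  have := tendsto_wtOne_zero.const_mul 6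
  norm_num at this
  exact this

theorem tendsto_hauptmodul_zero : Tendsto hauptmodul (𝓝[>] 0) (𝓝 0) := by
  have := ((tendsto_moment_zero 2).const_mul 27).div (tendsto_eisOne_zero.pow 3) (by norm_num)
  norm_num at this
  exact this

/-- With `hasDerivAt_eisOne` and `hasDerivAt_eisFlux`, these are the analogues for level three of
Ramanujan's differential equations. -/
theorem hasDerivAt_hauptmodul {q : ℝ} (h0 : 0 < q) (h1 : q < 1) :
    HasDerivAt hauptmodul (hauptmodul q * (1 - hauptmodul q) * eisOne q ^ 2 / q) q := by
  have hr := wtOne_pos h0 h1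
  have d1 := hasDerivAt_wtOne h0 h1
  have d2 := hasDerivAt_moment_two h0 h1
  have hne : (6 * wtOne q) ^ 3 ≠ 0 := by positivity
  refine ((d2.const_mul 27).div ((d1.const_mul 6).pow 3) hne).congr_deriv ?_
  simp only [hauptmodul, eisOne, Pi.pow_apply]
  push_cast
  field_simp
  ring

/-- The quotient `θ A / A²`, where `A = eisOne` and `θ = q d/dq`. -/
noncomputable def eisFlux (q : ℝ) : ℝ :=
  (moment q q 2 / 2 - wtOne q * moment q q 1) / (2 * wtOne q ^ 2)

theorem hasDerivAt_eisOne {q : ℝ} (h0 : 0 < q) (h1 : q < 1) :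
    HasDerivAt eisOne (eisOne q ^ 2 * eisFlux q / q) q := by
  have hr := wtOne_pos h0 h1
  refine ((hasDerivAt_wtOne h0 h1).const_mul 6).congr_deriv ?_
  simp only [eisOne, eisFlux]
  field_simp
  ring

/-- Together with the derivatives of `hauptmodul` and `eisOne`, this is the hypergeometric equation
for `eisOne` as a function of `hauptmodul`. -/
theorem hasDerivAt_eisFlux {q : ℝ} (h0 : 0 < q) (h1 : q < 1) :
    HasDerivAt eisFlux
      (2 / 9 * eisOne q ^ 3 * (hauptmodul q * (1 - hauptmodul q)) / q) q := by
  have hr := wtOne_pos h0 h1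
  have d1 := hasDerivAt_wtOne h0 h1
  have d2 := hasDerivAt_moment_two h0 h1
  have d3 := hasDerivAt_moment_one h0 h1
  have hne : 2 * wtOne q ^ 2 ≠ 0 := by positivity
  refine (((d2.div_const 2).sub (d1.mul d3)).div ((d1.pow 2).const_mul 2) hne).congr_deriv ?_
  simp only [hauptmodul, eisOne, Pi.pow_apply, Pi.mul_apply, Pi.sub_apply]
  push_cast
  field_simp
  ring

theorem tendsto_eisFlux_zero : Tendsto eisFlux (𝓝[>] 0) (𝓝 0) := by
  have := (((tendsto_moment_zero 2).div_const 2).sub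
    (tendsto_wtOne_zero.mul (tendsto_moment_zero 1))).div
    ((tendsto_wtOne_zero.pow 2).const_mul 2) (by norm_num)
  norm_num at this
  exact this

theorem hauptmodul_lt_one {q : ℝ} (h0 : 0 < q) (h1 : q < 1) : hauptmodul q < 1 := by
  have cont : ContinuousOn hauptmodul (Set.Ioo 0 1) := fun x hx =>
    (hasDerivAt_hauptmodul hx.1 hx.2).continuousAt.continuousWithinAt
  have contE : ContinuousOn eisOne (Set.Ioo 0 1) := fun x hx =>
    (hasDerivAt_eisOne hx.1 hx.2).continuousAt.continuousWithinAt
  -- `1 - s` satisfies a linear differential equation, so it has no zeros: its square times a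
  -- suitable exponential is increasing
  have ne_one : ∀ x ∈ Set.Ioo (0 : ℝ) 1, hauptmodul x ≠ 1 := by
    intro x hx hx1
    obtain ⟨y, hy, hyx⟩ : ∃ y, hauptmodul y < 1 ∧ y ∈ Set.Ioo 0 x :=
      ((tendsto_hauptmodul_zero.eventually_lt_const one_pos).and (Ioo_mem_nhdsGT hx.1)).exists
    have hsub : Set.Icc y x ⊆ Set.Ioo 0 1 := fun z hz =>
      ⟨hyx.1.trans_le hz.1, hz.2.trans_lt hx.2⟩
    obtain ⟨M, hM⟩ := (isCompact_Icc (a := y) (b := x)).bddAbove_image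
      (f := fun z => hauptmodul z * eisOne z ^ 2 / z)
      (((cont.mono hsub).mul ((contE.mono hsub).pow 2)).div continuousOn_id
        fun z hz => (hsub hz).1.ne')
    have hder (z : ℝ) (hz : z ∈ Set.Icc y x) :
        HasDerivAt (fun z => (1 - hauptmodul z) ^ 2 * Real.exp (2 * M * z))
          (2 * (1 - hauptmodul z) ^ 2 * (M - hauptmodul z * eisOne z ^ 2 / z)
            * Real.exp (2 * M * z)) z := by
      have d := (hasDerivAt_hauptmodul (hsub hz).1 (hsub hz).2).const_sub 1
      have de : HasDerivAt (fun z => Real.exp (2 * M * z)) (Real.exp (2 * M * z) * (2 * M)) z := by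
        simpa using ((hasDerivAt_id z).const_mul (2 * M)).exp
      refine ((d.pow 2).mul de).congr_deriv ?_
      have := (hsub hz).1.ne'
      simp only [Pi.pow_apply]
      field_simp
      ring
    have mono : MonotoneOn (fun z => (1 - hauptmodul z) ^ 2 * Real.exp (2 * M * z))
        (Set.Icc y x) := by
      refine monotoneOn_of_deriv_nonneg (convex_Icc y x)
        (fun z hz => (hder z hz).continuousAt.continuousWithinAt)
        (fun z hz => (hder z (interior_subset hz)).differentiableAt.differentiableWithinAt)
        fun z hz => ?_
      have hz' := interior_subset hz
      rw [(hder z hz').deriv]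
      have : hauptmodul z * eisOne z ^ 2 / z ≤ M := hM ⟨z, hz', rfl⟩
      have h3 : 0 ≤ M - hauptmodul z * eisOne z ^ 2 / z := by linarith
      positivity
    have hyx' : y ≤ x := hyx.2.le
    have := mono ⟨le_rfl, hyx'⟩ ⟨hyx', le_rfl⟩ hyx'
    simp only [hx1, sub_self] at this
    have h4 : 0 < 1 - hauptmodul y := by linarith
    have h5 : 0 < (1 - hauptmodul y) ^ 2 * Real.exp (2 * M * y) := by positivity
    norm_num at this
    linarith
  by_contra hcon
  push Not at hcon
  obtain ⟨y, hy, hyx⟩ : ∃ y, hauptmodul y < 1 ∧ y ∈ Set.Ioo 0 q :=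
    ((tendsto_hauptmodul_zero.eventually_lt_const one_pos).and (Ioo_mem_nhdsGT h0)).exists
  have hsub : Set.Icc y q ⊆ Set.Ioo 0 1 := fun z hz => ⟨hyx.1.trans_le hz.1, hz.2.trans_lt h1⟩
  obtain ⟨z, hz, hz1⟩ := intermediate_value_Icc hyx.2.le (cont.mono hsub) ⟨hy.le, hcon⟩
  exact ne_one z (hsub hz) hz1

theorem hauptmodul_mem {q : ℝ} (hq : q ∈ Set.Ioo (0 : ℝ) 1) : hauptmodul q ∈ Set.Ioo (0 : ℝ) 1 :=
  ⟨hauptmodul_pos hq.1 hq.2, hauptmodul_lt_one hq.1 hq.2⟩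

theorem hauptmodul_strictMonoOn : StrictMonoOn hauptmodul (Set.Ioo 0 1) := by
  refine strictMonoOn_of_deriv_pos (convex_Ioo 0 1) (fun x hx =>
    (hasDerivAt_hauptmodul hx.1 hx.2).continuousAt.continuousWithinAt) fun x hx => ?_
  rw [interior_Ioo] at hx
  rw [(hasDerivAt_hauptmodul hx.1 hx.2).deriv]
  have hs := hauptmodul_mem hx
  have := hs.1
  have : 0 < 1 - hauptmodul x := by linarith [hs.2]
  have := eisOne_pos hx.1 hx.2
  have := hx.1
  positivity

theorem abs_lt_one_of_mem {s : ℝ} (hs : s ∈ Set.Ioo (0 : ℝ) 1) : |s| < 1 := by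
  rw [abs_of_pos hs.1]; exact hs.2

theorem hasDerivAt_hyp_hauptmodul {q : ℝ} (hq : q ∈ Set.Ioo (0 : ℝ) 1) :
    HasDerivAt (fun q => hyp (hauptmodul q)) (hypFlux (hauptmodul q) * eisOne q ^ 2 / q) q := by
  have hs := hauptmodul_mem hq
  have := hs.1.ne'
  have h1 : 1 - hauptmodul q ≠ 0 := by linarith [hs.2]
  refine ((hasDerivAt_hyp hs.1 hs.2).comp q (hasDerivAt_hauptmodul hq.1 hq.2)).congr_deriv ?_
  field_simp

/-- The inversion formula: both sides satisfy the same second order linear differential equation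
in `q`, so their Wronskian is constant; it vanishes at the cusp `q = 0`. -/
theorem hyp_hauptmodul {q : ℝ} (hq : q ∈ Set.Ioo (0 : ℝ) 1) : hyp (hauptmodul q) = eisOne q := by
  have tF : Tendsto (fun q => hyp (hauptmodul q)) (𝓝[>] 0) (𝓝 1) := by
    have := (continuousAt_hyp (s := 0) (by simp)).tendsto.comp tendsto_hauptmodul_zero
    rwa [hyp_zero] at this
  have tG : Tendsto (fun q => hypFlux (hauptmodul q)) (𝓝[>] 0) (𝓝 0) := by
    have := (continuousAt_hypFlux (s := 0) (by simp)).tendsto.comp tendsto_hauptmodul_zero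
    rwa [hypFlux_zero] at this
  have W : ∀ x ∈ Set.Ioo (0 : ℝ) 1,
      hypFlux (hauptmodul x) * eisOne x - hyp (hauptmodul x) * eisFlux x = 0 := by
    intro x hx
    refine eq_of_hasDerivAt_zero_of_tendsto_left (v := 1) one_pos (fun y hy => ?_) ?_ hx
      (f := fun x => hypFlux (hauptmodul x) * eisOne x - hyp (hauptmodul x) * eisFlux x)
    · have hs := hauptmodul_mem hy
      have d1 :=
        (hasDerivAt_hypFlux (abs_lt_one_of_mem hs)).comp y (hasDerivAt_hauptmodul hy.1 hy.2)
      have d2 := hasDerivAt_hyp_hauptmodul hy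
      refine ((d1.mul (hasDerivAt_eisOne hy.1 hy.2)).sub
        (d2.mul (hasDerivAt_eisFlux hy.1 hy.2))).congr_deriv ?_
      have := hy.1.ne'
      simp only [Function.comp]
      field_simp
      ring
    · simpa using (tG.mul tendsto_eisOne_zero).sub (tF.mul tendsto_eisFlux_zero)
  have := eq_of_hasDerivAt_zero_of_tendsto_left (v := 1) (l := 1) one_pos (fun y hy => ?_) ?_ hq
    (f := fun x => hyp (hauptmodul x) / eisOne x)
  · rwa [div_eq_one_iff_eq (eisOne_pos hq.1 hq.2).ne'] at this
  · have hp := (eisOne_pos hy.1 hy.2).ne'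
    refine ((hasDerivAt_hyp_hauptmodul hy).div (hasDerivAt_eisOne hy.1 hy.2) hp).congr_deriv ?_
    have := hy.1.ne'
    have h := W y hy
    field_simp
    linear_combination h
  · have := tF.div tendsto_eisOne_zero one_ne_zero
    rwa [div_one] at this

/-- The second solution: the ratio of the two solutions of the hypergeometric equation is a multiple
of `log q`.  There is no additive constant because the ratio tends to `0` at the cusp `q = 1`. -/
theorem hyp_one_sub_hauptmodul {q : ℝ} (hq : q ∈ Set.Ioo (0 : ℝ) 1) :
    hyp (1 - hauptmodul q) = -wronskianConst * Real.log q * eisOne q := by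
  have sym {s : ℝ} (hs : s ∈ Set.Ioo (0 : ℝ) 1) : 1 - s ∈ Set.Ioo (0 : ℝ) 1 :=
    ⟨by linarith [hs.2], by linarith [hs.1]⟩
  have := eq_of_hasDerivAt_zero_of_tendsto_right (u := 0) (l := 0) one_pos (fun y hy => ?_) ?_ hq
    (f := fun x => hyp (1 - hauptmodul x) / hyp (hauptmodul x) + wronskianConst * Real.log x)
  · rw [hyp_hauptmodul hq] at this
    have hp := (eisOne_pos hq.1 hq.2).ne'
    field_simp at this
    linarith
  · have hs := hauptmodul_mem hy
    have hs' := sym hs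
    have hF : hyp (hauptmodul y) ≠ 0 := by
      have := one_le_hyp hs.1.le hs.2; linarith
    have hF2 : hyp (hauptmodul y) = eisOne y := hyp_hauptmodul hy
    have d1 := (hasDerivAt_hyp hs'.1 hs'.2).comp y ((hasDerivAt_hauptmodul hy.1 hy.2).const_sub 1)
    have d2 := hasDerivAt_hyp_hauptmodul hy
    have d3 := (Real.hasDerivAt_log hy.1.ne').const_mul wronskianConst
    refine ((d1.div d2 hF).add d3).congr_deriv ?_
    have w := hyp_wronskian hs
    have := hy.1.ne'
    have := hs.1.ne'
    have := hs'.1.ne'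
    have hp := (eisOne_pos hy.1 hy.2).ne'
    simp only [Function.comp]
    rw [sub_sub_cancel]
    rw [hF2] at w ⊢
    field_simp
    linear_combination (-1 : ℝ) * w
  · obtain ⟨q₀, hq₀⟩ : ∃ q₀ : ℝ, q₀ ∈ Set.Ioo (0 : ℝ) 1 := ⟨1 / 2, by norm_num⟩
    have lim1 : Tendsto (fun x => hyp (1 - hauptmodul x) / hyp (hauptmodul x)) (𝓝[<] 1) (𝓝 0) := by
      have tA : Tendsto (fun x => hyp (1 - hauptmodul q₀) / eisOne x) (𝓝[<] 1) (𝓝 0) :=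
        tendsto_const_nhds.div_atTop (tendsto_wtOne_one.const_mul_atTop (by norm_num))
      refine squeeze_zero' ?_ ?_ tA
      · filter_upwards [Ioo_mem_nhdsLT (show (0 : ℝ) < 1 by norm_num)] with x hx
        have hs := hauptmodul_mem hx
        have := one_le_hyp hs.1.le hs.2
        have := one_le_hyp (sym hs).1.le (sym hs).2
        positivity
      · filter_upwards [Ioo_mem_nhdsLT hq₀.2] with x hx
        have hx' : x ∈ Set.Ioo (0 : ℝ) 1 := ⟨hq₀.1.trans hx.1, hx.2⟩
        have hs := sym (hauptmodul_mem hx')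
        have hs₀ := sym (hauptmodul_mem hq₀)
        rw [hyp_hauptmodul hx']
        have := hauptmodul_strictMonoOn hq₀ hx' hx.1
        have := hyp_strictMonoOn ⟨hs.1.le, hs.2⟩ ⟨hs₀.1.le, hs₀.2⟩ (by linarith)
        have := eisOne_pos hx'.1 hx'.2
        gcongr
    have lim2 : Tendsto (fun x => wronskianConst * Real.log x) (𝓝[<] 1) (𝓝 0) := by
      have : Tendsto (fun x => wronskianConst * Real.log x) (𝓝 1)
          (𝓝 (wronskianConst * Real.log 1)) :=
        ((Real.continuousAt_log one_ne_zero).const_mul _ : ContinuousAt _ _).tendsto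
      rw [Real.log_one, mul_zero] at this
      exact this.mono_left nhdsWithin_le_nhds
    simpa using lim1.add lim2

/-- The Fricke involution exchanges `s` and `1 - s`. -/
theorem hauptmodul_fricke {q q' : ℝ} (hq : q ∈ Set.Ioo (0 : ℝ) 1) (hq' : q' ∈ Set.Ioo (0 : ℝ) 1)
    (h : Real.log q * Real.log q' = 4 * Real.pi ^ 2 / 3) : hauptmodul q' = 1 - hauptmodul q := by
  have hs := hauptmodul_mem hq
  have hs' := hauptmodul_mem hq'
  have e1 := hyp_one_sub_hauptmodul hq
  have e2 := hyp_one_sub_hauptmodul hq'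
  rw [← hyp_hauptmodul hq] at e1
  rw [← hyp_hauptmodul hq'] at e2
  have hC : wronskianConst ^ 2 * (4 * Real.pi ^ 2 / 3) = 1 := by
    unfold wronskianConst
    have := Real.pi_pos.ne'
    rw [div_pow, Real.sq_sqrt (by norm_num)]
    field_simp; norm_num
  have key : hyp (1 - hauptmodul q) * hyp (1 - hauptmodul q')
      = hyp (hauptmodul q) * hyp (hauptmodul q') := by
    rw [e1, e2]
    rw [← h] at hC
    linear_combination (hyp (hauptmodul q) * hyp (hauptmodul q')) * hC
  have pos {s : ℝ} (h : s ∈ Set.Ioo (0 : ℝ) 1) : 0 < hyp s :=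
    one_pos.trans_le (one_le_hyp h.1.le h.2)
  have sym {s : ℝ} (hs : s ∈ Set.Ioo (0 : ℝ) 1) : 1 - s ∈ Set.Ioo (0 : ℝ) 1 :=
    ⟨by linarith [hs.2], by linarith [hs.1]⟩
  have ico {s : ℝ} (hs : s ∈ Set.Ioo (0 : ℝ) 1) : s ∈ Set.Ico (0 : ℝ) 1 := ⟨hs.1.le, hs.2⟩
  rcases lt_trichotomy (hauptmodul q') (1 - hauptmodul q) with hlt | heq | hgt
  · have i1 := hyp_strictMonoOn (ico hs') (ico (sym hs)) hlt
    have i2 := hyp_strictMonoOn (ico hs) (ico (sym hs')) (by linarith)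
    have := mul_lt_mul'' i1 i2 (pos hs').le (pos hs).le
    linarith
  · exact heq
  · have i1 := hyp_strictMonoOn (ico (sym hs)) (ico hs') hgt
    have i2 := hyp_strictMonoOn (ico (sym hs')) (ico hs) (by linarith)
    have := mul_lt_mul'' i1 i2 (pos (sym hs)).le (pos (sym hs')).le
    linarith

/-! ### Double series and the Eisenstein series of weight three -/

/-- The nontrivial character modulo `3`. -/
noncomputable def chi (n : ℤ) : ℝ := (legendreSym 3 n : ℝ)

theorem chi_add_three (n : ℤ) : chi (n + 3) = chi n := by
  unfold chi
  rw [legendreSym.mod 3 (n + 3), legendreSym.mod 3 n]; simp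

theorem chi_three_mul_add (d n : ℤ) : chi (3 * d + n) = chi n := by
  unfold chi
  rw [legendreSym.mod 3 (3 * d + n), legendreSym.mod 3 n]; simp

theorem chi_zero : chi 0 = 0 := by
  have : legendreSym 3 0 = 0 := by decide
  simp [chi, this]

theorem chi_one : chi 1 = 1 := by
  have : legendreSym 3 1 = 1 := by decide
  simp [chi, this]

theorem chi_two : chi 2 = -1 := by
  have : legendreSym 3 2 = -1 := by decide
  simp [chi, this]

theorem exists_three_mul_add (n : ℤ) :
    ∃ d : ℤ, n = 3 * d + 0 ∨ n = 3 * d + 1 ∨ n = 3 * d + 2 := ⟨n / 3, by omega⟩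

theorem chi_neg (n : ℤ) : chi (-n) = -chi n := by
  obtain ⟨d, rfl | rfl | rfl⟩ := exists_three_mul_add n
  · rw [show -(3 * d + 0) = 3 * (-d) + 0 by ring, chi_three_mul_add, chi_three_mul_add, chi_zero,
      neg_zero]
  · rw [show -(3 * d + 1) = 3 * (-d - 1) + 2 by ring, chi_three_mul_add, chi_three_mul_add, chi_one,
      chi_two]
  · rw [show -(3 * d + 2) = 3 * (-d - 1) + 1 by ring, chi_three_mul_add, chi_three_mul_add, chi_one,
      chi_two, neg_neg]

theorem abs_chi_le (n : ℤ) : |chi n| ≤ 1 := by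
  obtain ⟨d, rfl | rfl | rfl⟩ := exists_three_mul_add n <;> rw [chi_three_mul_add]
  · simp [chi_zero]
  · simp [chi_one]
  · simp [chi_two]

/-- The double series `∑ w(n, k) q ^ (n k)` over positive integers. -/
noncomputable def doubleSeries (w : ℤ → ℤ → ℝ) (q : ℝ) : ℝ :=
  ∑' p : ℕ+ × ℕ+, w p.1 p.2 * q ^ (p.1 * p.2 : ℕ)

theorem summable_doubleSeries {w : ℤ → ℤ → ℝ} (hw : ∀ n k, |w n k| ≤ (k : ℝ) ^ 2) {q : ℝ}
    (hq : |q| < 1) : Summable fun p : ℕ+ × ℕ+ => w p.1 p.2 * q ^ (p.1 * p.2 : ℕ) := by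
  refine Summable.of_norm_bounded (summable_prod_mul_pow 2 (r := |q|) (by simpa using hq))
    fun p => ?_
  rw [Real.norm_eq_abs, abs_mul, abs_pow]
  gcongr
  simpa using hw p.1 p.2

theorem hasSum_divisors {w : ℤ → ℤ → ℝ} (hw : ∀ n k, |w n k| ≤ (k : ℝ) ^ 2) {q : ℝ}
    (hq : |q| < 1) :
    HasSum (fun N : ℕ => (∑ k ∈ N.divisors, w (N / k : ℕ) k) * q ^ N) (doubleSeries w q) := by
  have h := sigmaAntidiagonalEquivProd.hasSum_iff.2 (summable_doubleSeries hw hq).hasSum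
  have h2 := h.sigma fun N => hasSum_fintype _
  have i : Function.Injective (fun n : ℕ+ => (n : ℕ)) := PNat.coe_injective
  refine (i.hasSum_iff fun N hN => ?_).1 (hasSum_of_eq h2 (fun N => ?_) rfl)
  · have : N = 0 := by
      by_contra h
      exact hN ⟨⟨N, Nat.pos_of_ne_zero h⟩, rfl⟩
    simp [this]
  · simp only [Function.comp]
    rw [← Nat.sum_divisorsAntidiagonal' (fun x y => w (x : ℤ) (y : ℤ)), Finset.sum_mul,
      Finset.univ_eq_attach, ← Finset.sum_attach]
    refine Finset.sum_congr rfl fun x _ => ?_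
    have hx := (Nat.mem_divisorsAntidiagonal.1 x.2).1
    simp only [sigmaAntidiagonalEquivProd, Equiv.coe_fn_mk, divisorsAntidiagonalFactors,
      PNat.mk_coe]
    rw [hx]

theorem doubleSeries_eq {w : ℤ → ℤ → ℝ} (hw : ∀ n k, |w n k| ≤ (k : ℝ) ^ 2) {q : ℝ}
    (hq : |q| < 1) : doubleSeries w q = ∑' n : ℕ+, ∑' k : ℕ+, w n k * q ^ (n * k : ℕ) :=
  (summable_doubleSeries hw hq).tsum_prod

theorem bound_a (_n k : ℤ) : |chi k * (k : ℝ) ^ 2| ≤ (k : ℝ) ^ 2 := by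
  rw [abs_mul, abs_of_nonneg (sq_nonneg (k : ℝ))]
  exact mul_le_of_le_one_left (sq_nonneg _) (abs_chi_le k)

theorem bound_b (n k : ℤ) : |chi n * (k : ℝ) ^ 2| ≤ (k : ℝ) ^ 2 := by
  rw [abs_mul, abs_of_nonneg (sq_nonneg (k : ℝ))]
  exact mul_le_of_le_one_left (sq_nonneg _) (abs_chi_le n)

/-- `∑ (k/3) k² q ^ (n k)`. -/
noncomputable def seriesA (q : ℝ) : ℝ := doubleSeries (fun _ k => chi k * (k : ℝ) ^ 2) q

/-- `∑ (n/3) k² q ^ (n k)`. -/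
noncomputable def seriesB (q : ℝ) : ℝ := doubleSeries (fun n k => chi n * (k : ℝ) ^ 2) q

theorem hasSum_E3a {q : ℝ} (hq : |q| < 1) :
    HasSum (fun n => ((PowerSeries.coeff n EllipticPeriods.E3a : ℚ) : ℝ) * q ^ n)
      (1 - 9 * seriesA q) := by
  have h := (hasSum_ite_eq (0 : ℕ) (1 : ℝ)).sub ((hasSum_divisors bound_a hq).mul_left 9)
  refine hasSum_of_eq h (fun n => ?_) rfl
  unfold EllipticPeriods.E3a
  have e9 : (9 : PowerSeries ℚ) = PowerSeries.C 9 := rfl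
  rw [map_sub, e9, PowerSeries.coeff_C_mul, PowerSeries.coeff_mk, PowerSeries.coeff_one]
  push_cast
  rcases eq_or_ne n 0 with rfl | hn
  · simp
  · simp [hn, chi]; ring

theorem hasSum_E3b {q : ℝ} (hq : |q| < 1) :
    HasSum (fun n => ((PowerSeries.coeff n EllipticPeriods.E3b : ℚ) : ℝ) * q ^ n) (seriesB q) := by
  refine hasSum_of_eq (hasSum_divisors bound_b hq) (fun n => ?_) rfl
  unfold EllipticPeriods.E3b
  rw [PowerSeries.coeff_mk]
  push_cast
  simp [chi]

theorem hasSum_chi_pow {x : ℝ} (hx : |x| < 1) :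
    HasSum (fun n : ℕ+ => chi n * x ^ (n : ℕ)) ((x - x ^ 2) / (1 - x ^ 3)) := by
  have hs : Summable fun n : ℕ => chi n * x ^ n :=
    summable_pow_of_bound (C := 1) (p := 0) (fun n => by simpa using abs_chi_le n) hx
  have h3 := hs.sum_add_tsum_nat_add 3
  have e : ∑' n : ℕ, chi ((n + 3 : ℕ) : ℤ) * x ^ (n + 3) = x ^ 3 * ∑' n : ℕ, chi n * x ^ n := by
    rw [← tsum_mul_left]
    refine tsum_congr fun n => ?_
    push_cast
    rw [chi_add_three]; ring
  rw [e] at h3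
  simp only [Finset.sum_range_succ, Finset.sum_range_zero] at h3
  norm_num [chi_zero, chi_one, chi_two] at h3
  have hx3 : 1 - x ^ 3 ≠ 0 := by
    have : |x ^ 3| < 1 := by rw [abs_pow]; exact pow_lt_one₀ (abs_nonneg x) hx (by norm_num)
    have := (abs_lt.1 this).2
    linarith
  have e2 : ∑' n : ℕ, chi n * x ^ n = (x - x ^ 2) / (1 - x ^ 3) := by
    rw [eq_div_iff hx3]; linarith
  have i : Function.Injective (fun n : ℕ+ => (n : ℕ)) := PNat.coe_injective
  have := (i.hasSum_iff fun N hN => ?_).2 (e2 ▸ hs.hasSum)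
  · simpa [Function.comp_def] using this
  · have : N = 0 := by
      by_contra h
      exact hN ⟨⟨N, Nat.pos_of_ne_zero h⟩, rfl⟩
    simp [this, chi_zero]

/-- `moment q q 2` is the Eisenstein series `E_{3b}`. -/
theorem seriesB_eq {q : ℝ} (h0 : 0 < q) (h1 : q < 1) : seriesB q = moment q q 2 := by
  have hs := summable_doubleSeries bound_b (q := q) (by rwa [abs_of_pos h0])
  have hs' : Summable fun p : ℕ+ × ℕ+ => chi p.2 * ((p.1 : ℤ) : ℝ) ^ 2 * q ^ (p.2 * p.1 : ℕ) :=
    (Equiv.prodComm ℕ+ ℕ+).summable_iff.2 hs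
  have e : seriesB q = ∑' p : ℕ+ × ℕ+, chi p.2 * ((p.1 : ℤ) : ℝ) ^ 2 * q ^ (p.2 * p.1 : ℕ) :=
    ((Equiv.prodComm ℕ+ ℕ+).tsum_eq
      (fun p => chi p.1 * ((p.2 : ℤ) : ℝ) ^ 2 * q ^ (p.1 * p.2 : ℕ))).symm
  rw [e, hs'.tsum_prod]
  have h := hasSum_moment_nat h0 h1 2
  simp only [OfNat.ofNat_ne_zero, if_false, sub_zero] at h
  rw [← h.tsum_eq, tsum_pnat_eq_tsum_succ (f := fun k : ℕ => ∑' n : ℕ+,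
    chi n * ((k : ℤ) : ℝ) ^ 2 * q ^ (n * k : ℕ))]
  refine tsum_congr fun k => ?_
  have hx : |q ^ (k + 1)| < 1 := by
    rw [abs_of_pos (by positivity)]; exact pow_lt_one₀ h0.le h1 (by omega)
  rw [show ((-1 : ℝ)) ^ 2 = 1 by norm_num, one_mul, ← (hasSum_chi_pow hx).tsum_eq, ← tsum_mul_left]
  refine tsum_congr fun n => ?_
  rw [← pow_mul, mul_comm (n : ℕ)]
  push_cast; ring

theorem tendsto_seriesA_zero : Tendsto seriesA (𝓝[>] 0) (𝓝 0) := by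
  have hs := summable_doubleSeries bound_a (q := 1 / 2) (by norm_num [abs_of_pos])
  have h0 : ∑' p : ℕ+ × ℕ+, (0 : ℝ) = 0 := tsum_zero
  suffices h : Tendsto seriesA (𝓝[>] 0) (𝓝 (∑' p : ℕ+ × ℕ+, (0 : ℝ))) by rwa [h0] at h
  refine tendsto_tsum_of_dominated_convergence hs.norm (fun p => ?_) ?_
  · have : Tendsto (fun q : ℝ => chi p.2 * ((p.2 : ℤ) : ℝ) ^ 2 * q ^ (p.1 * p.2 : ℕ)) (𝓝 0)
        (𝓝 (chi p.2 * ((p.2 : ℤ) : ℝ) ^ 2 * 0 ^ (p.1 * p.2 : ℕ))) :=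
      ContinuousAt.tendsto (by fun_prop)
    rw [zero_pow (by positivity), mul_zero] at this
    exact this.mono_left nhdsWithin_le_nhds
  · filter_upwards [Ioc_mem_nhdsGT (show (0 : ℝ) < 1 / 2 by norm_num)] with q hq p
    simp only [norm_mul, norm_pow]
    gcongr
    rw [Real.norm_of_nonneg hq.1.le, Real.norm_of_nonneg (by norm_num)]
    exact hq.2

/-! ### The Fricke involution on the Eisenstein series of weight three -/

open UpperHalfPlane in
/-- Lipschitz's formula in weight three. -/
theorem lipschitz_three (z : ℍ) :
    ∑' n : ℤ, ((z : ℂ) + n) ^ (-3 : ℤ) = 4 * (Real.pi : ℂ) ^ 3 * Complex.I *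
      ∑' k : ℕ+, (k : ℂ) ^ 2 * Complex.exp (2 * Real.pi * Complex.I * z) ^ (k : ℕ) := by
  have h := EisensteinSeries.qExpansion_identity_pnat (k := 2) (by norm_num) z
  have e (n : ℤ) : ((z : ℂ) + n) ^ (-3 : ℤ) = 1 / ((z : ℂ) + n) ^ (2 + 1) := by
    rw [zpow_neg, one_div]; norm_cast
  simp_rw [e]
  rw [h]
  congr 1
  have : (-2 * (Real.pi : ℂ) * Complex.I) ^ (2 + 1) = 8 * (Real.pi : ℂ) ^ 3 * Complex.I := by
    rw [show (-2 * (Real.pi : ℂ) * Complex.I) ^ (2 + 1)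
      = -8 * Real.pi ^ 3 * (Complex.I ^ 2 * Complex.I) by ring, Complex.I_sq]; ring
  rw [this]; norm_num [Nat.factorial]; ring

/-- The point `i v` of the upper half plane. -/
noncomputable def imPt {v : ℝ} (hv : 0 < v) : UpperHalfPlane := ⟨v * Complex.I, by simpa using hv⟩

theorem coe_imPt {v : ℝ} (hv : 0 < v) : (imPt hv : ℂ) = v * Complex.I := rfl

theorem exp_imPt (v : ℝ) (x : ℝ) : Complex.exp (2 * Real.pi * Complex.I * (v * Complex.I + x)) =
    Complex.exp (2 * Real.pi * Complex.I * x) * (Real.exp (-(2 * Real.pi * v)) : ℝ) := by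
  rw [Complex.ofReal_exp, ← Complex.exp_add]
  congr 1
  push_cast
  linear_combination (2 * Real.pi * v : ℂ) * Complex.I_sq

theorem summable_lattice {v : ℝ} (hv : 0 < v) :
    Summable fun p : ℤ × ℤ => ((p.1 : ℂ) * (v * Complex.I) + p.2) ^ (-3 : ℤ) := by
  have := summable_prod_eisSummand (k := 3) le_rfl (imPt hv)
  simpa [EisensteinSeries.eisSummand, coe_imPt] using this

theorem summable_chi_lattice {v : ℝ} (hv : 0 < v) :
    Summable fun p : ℤ × ℤ => (chi p.1 : ℂ) * ((p.1 : ℂ) * (v * Complex.I) + p.2) ^ (-3 : ℤ) := by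
  refine Summable.of_norm_bounded (summable_lattice hv).norm fun p => ?_
  rw [norm_mul, Complex.norm_real, Real.norm_eq_abs]
  exact mul_le_of_le_one_left (norm_nonneg _) (abs_chi_le _)

theorem ofReal_doubleSeries {w : ℤ → ℤ → ℝ} (hw : ∀ n k, |w n k| ≤ (k : ℝ) ^ 2) {q : ℝ}
    (hq : |q| < 1) : ((doubleSeries w q : ℝ) : ℂ) =
      ∑' n : ℕ+, ∑' k : ℕ+, (w n k : ℂ) * (q : ℂ) ^ (n * k : ℕ) := by
  rw [doubleSeries_eq hw hq, Complex.ofReal_tsum]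
  refine tsum_congr fun n => ?_
  rw [Complex.ofReal_tsum]
  push_cast; rfl

/-- Summing the lattice sum `∑ χ(m) (m τ + n)⁻³` over `n` first gives `E_{3b}`. -/
theorem lattice_sum_rows {v : ℝ} (hv : 0 < v) :
    ∑' p : ℤ × ℤ, (chi p.1 : ℂ) * ((p.1 : ℂ) * (v * Complex.I) + p.2) ^ (-3 : ℤ) =
      8 * (Real.pi : ℂ) ^ 3 * Complex.I * seriesB (Real.exp (-(2 * Real.pi * v))) := by
  have hs := summable_chi_lattice hv
  rw [hs.tsum_prod, tsum_int_eq_zero_add_two_mul_tsum_pnat (fun m => ?_) hs.prod]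
  · have hq : |Real.exp (-(2 * Real.pi * v))| < 1 := by
      rw [abs_of_pos (Real.exp_pos _), Real.exp_lt_one_iff]
      have := Real.pi_pos
      have : 0 < 2 * Real.pi * v := by positivity
      linarith
    simp only [chi_zero, Complex.ofReal_zero, zero_mul, tsum_zero, zero_add]
    rw [seriesB, ofReal_doubleSeries bound_b hq, nsmul_eq_mul, ← tsum_mul_left, ← tsum_mul_left]
    refine tsum_congr fun m => ?_
    have hm : 0 < (m : ℝ) * v := by have : (0 : ℝ) < m := by exact_mod_cast m.pos
                                    positivity
    have h := lipschitz_three (imPt hm)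
    rw [coe_imPt] at h
    have e (n : ℤ) : ((((m : ℕ) : ℤ) : ℂ) * (v * Complex.I) + n) =
        ((m * v : ℝ) : ℂ) * Complex.I + n := by
      push_cast; ring
    simp_rw [e]
    rw [tsum_mul_left, h, ← tsum_mul_left, ← tsum_mul_left, ← tsum_mul_left, ← tsum_mul_left]
    refine tsum_congr fun k => ?_
    have e2 : Complex.exp (2 * Real.pi * Complex.I * (((m * v : ℝ) : ℂ) * Complex.I)) =
        (Real.exp (-(2 * Real.pi * v)) : ℂ) ^ (m : ℕ) := by
      rw [Complex.ofReal_exp, ← Complex.exp_nat_mul]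
      congr 1
      push_cast
      linear_combination (2 * Real.pi * m * v : ℂ) * Complex.I_sq
    rw [e2, ← pow_mul]
    push_cast
    ring
  · rw [← tsum_comp_neg]
    refine tsum_congr fun n => ?_
    rw [chi_neg]
    have : (((-m : ℤ) : ℂ) * (v * Complex.I) + ((-n : ℤ) : ℂ)) =
        -((m : ℂ) * (v * Complex.I) + n) := by
      push_cast; ring
    rw [this, Odd.neg_zpow ⟨-2, by norm_num⟩]
    push_cast; ring

/-- A sum twisted by the character, split into residue classes modulo `3`. -/
theorem tsum_chi_mul {f : ℤ → ℂ} (hf : Summable f) :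
    ∑' m : ℤ, (chi m : ℂ) * f m = ∑' d : ℤ, f (3 * d + 1) - ∑' d : ℤ, f (3 * d + 2) := by
  have i (a : ℤ) : Function.Injective fun d : ℤ => 3 * d + a := fun x y h => by
    simp only at h; omega
  have key (a : ℤ) : HasSum (fun m : ℤ => if m % 3 = a % 3 then f m else 0)
      (∑' d : ℤ, f (3 * d + a)) := by
    refine ((i a).hasSum_iff fun m hm => ?_).1 ?_
    · rw [if_neg]
      intro h
      exact hm ⟨(m - a) / 3, by simp only; omega⟩
    · refine ((hf.comp_injective (i a)).hasSum).congr_fun fun d => ?_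
      simp only [Function.comp]
      rw [if_pos (by omega)]
  refine (((key 1).sub (key 2)).congr_fun fun m => ?_).tsum_eq
  obtain ⟨d, rfl | rfl | rfl⟩ := exists_three_mul_add m <;> rw [chi_three_mul_add]
  · rw [if_neg (by omega), if_neg (by omega), chi_zero]; simp
  · rw [if_pos (by omega), if_neg (by omega), chi_one]; simp
  · rw [if_neg (by omega), if_pos (by omega), chi_two]; simp

/-- The Gauss sum: `exp(2πik/3) - exp(4πik/3) = i √3 χ(k)`. -/
theorem gauss_sum (k : ℕ) : Complex.exp (2 * Real.pi * Complex.I * (1 / 3 : ℝ)) ^ k -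
    Complex.exp (2 * Real.pi * Complex.I * (2 / 3 : ℝ)) ^ k = Complex.I * √3 * chi k := by
  set w := Complex.exp (2 * Real.pi * Complex.I * (1 / 3 : ℝ)) with hw
  have h2 : Complex.exp (2 * Real.pi * Complex.I * (2 / 3 : ℝ)) = w ^ 2 := by
    rw [hw, ← Complex.exp_nat_mul]; congr 1; push_cast; ring
  have h3 : w ^ 3 = 1 := by
    rw [hw, ← Complex.exp_nat_mul, ← Complex.exp_two_pi_mul_I]; congr 1; push_cast; ring
  have h1 : w - w ^ 2 = Complex.I * √3 := by
    have e1 : w = Complex.exp ((2 * Real.pi / 3 : ℝ) * Complex.I) := by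
      rw [hw]; congr 1; push_cast; ring
    have e2 : w ^ 2 = Complex.exp ((-(2 * Real.pi / 3) : ℝ) * Complex.I) := by
      have : w ^ 2 = w⁻¹ := by
        have : w ≠ 0 := Complex.exp_ne_zero _
        field_simp; linear_combination h3
      rw [this, e1, ← Complex.exp_neg]; congr 1; push_cast; ring
    rw [e2, e1, Complex.exp_ofReal_mul_I, Complex.exp_ofReal_mul_I, Real.cos_neg, Real.sin_neg]
    have : Real.sin (2 * Real.pi / 3) = √3 / 2 := by
      rw [show 2 * Real.pi / 3 = Real.pi - Real.pi / 3 by ring, Real.sin_pi_sub,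
        Real.sin_pi_div_three]
    rw [this]; push_cast; ring
  rw [h2]
  obtain ⟨d, hd⟩ : ∃ d : ℕ, k = 3 * d + 0 ∨ k = 3 * d + 1 ∨ k = 3 * d + 2 := ⟨k / 3, by omega⟩
  have p (r : ℕ) : w ^ (3 * d + r) = w ^ r := by rw [pow_add, pow_mul, h3, one_pow, one_mul]
  have p2 (r : ℕ) : (w ^ 2) ^ (3 * d + r) = (w ^ 2) ^ r := by
    rw [pow_add, pow_mul, ← pow_mul w 2 3, mul_comm 2 3, pow_mul w, h3, one_pow, one_pow, one_mul]
  have c (r : ℕ) : chi ((3 * d + r : ℕ) : ℤ) = chi r := by push_cast; exact chi_three_mul_add _ _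
  rcases hd with rfl | rfl | rfl <;> rw [p, p2, c]
  · simp [chi_zero]
  · simp [chi_one, h1]
  · have : ((2 : ℕ) : ℤ) = 2 := rfl
    rw [this, chi_two]
    push_cast
    linear_combination (-1 : ℂ) * h1 - w * h3

/-- The sum over `m` of `χ(m) (3 n τ + m)⁻³` for `n > 0`. -/
theorem lattice_sum_column {v : ℝ} (hv : 0 < v) (n : ℕ+) :
    ∑' m : ℤ, (chi m : ℂ) * (3 * n * (v * Complex.I) + m) ^ (-3 : ℤ) =
      -(4 * √3 * Real.pi ^ 3 / 27) *
        ∑' k : ℕ+, ((chi k * ((k : ℤ) : ℝ) ^ 2 : ℝ) : ℂ) *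
          (Real.exp (-(2 * Real.pi * v)) : ℂ) ^ (n * k : ℕ) := by
  have hn : (0 : ℝ) < n := by exact_mod_cast n.pos
  have hnv : 0 < (n : ℝ) * v := by positivity
  have hf : Summable fun m : ℤ => (3 * n * (v * Complex.I) + m) ^ (-3 : ℤ) := by
    have h3v : 0 < 3 * (n : ℝ) * v := by positivity
    have := (summable_lattice h3v).comp_injective (i := fun m : ℤ => ((1 : ℤ), m))
      fun a b h => by simpa using h
    refine this.congr fun m => ?_
    simp [mul_assoc]
  rw [tsum_chi_mul hf]
  have q0 : |Real.exp (-(2 * Real.pi * v))| < 1 := by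
    rw [abs_of_pos (Real.exp_pos _), Real.exp_lt_one_iff]
    have := Real.pi_pos
    have : 0 < 2 * Real.pi * v := by positivity
    linarith
  have q1 : |Real.exp (-(2 * Real.pi * v)) ^ (n : ℕ)| < 1 := by
    rw [abs_pow]; exact pow_lt_one₀ (abs_nonneg _) q0 n.ne_zero
  have part (x : ℝ) : ∑' d : ℤ, (3 * n * (v * Complex.I) + ((3 * d : ℤ) + 3 * x)) ^ (-3 : ℤ) =
      1 / 27 * (4 * (Real.pi : ℂ) ^ 3 * Complex.I *
        ∑' k : ℕ+, (k : ℂ) ^ 2 * (Complex.exp (2 * Real.pi * Complex.I * x) *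
          (Real.exp (-(2 * Real.pi * v)) : ℂ) ^ (n : ℕ)) ^ (k : ℕ)) := by
    have hz : 0 < ((n * v : ℝ) * Complex.I + x : ℂ).im := by simpa using hnv
    have h := lipschitz_three ⟨(n * v : ℝ) * Complex.I + x, hz⟩
    simp only at h
    rw [exp_imPt] at h
    have e2 : Real.exp (-(2 * Real.pi * (n * v))) = Real.exp (-(2 * Real.pi * v)) ^ (n : ℕ) := by
      rw [← Real.exp_nat_mul]; congr 1; ring
    rw [e2] at h
    push_cast at h ⊢
    rw [← h, ← tsum_mul_left]
    refine tsum_congr fun d => ?_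
    have : (3 * n * (v * Complex.I) + (3 * d + 3 * x)) = 3 * (n * v * Complex.I + x + d : ℂ) := by
      ring
    rw [this, mul_zpow]; norm_num
  have p1 := part (1 / 3)
  have p2 := part (2 / 3)
  have c1 : (3 : ℂ) * ((1 / 3 : ℝ) : ℂ) = 1 := by push_cast; norm_num
  have c2 : (3 : ℂ) * ((2 / 3 : ℝ) : ℂ) = 2 := by push_cast; norm_num
  rw [c1] at p1
  rw [c2] at p2
  have l1 : ∑' d : ℤ, (3 * n * (v * Complex.I) + ((3 * d + 1 : ℤ) : ℂ)) ^ (-3 : ℤ) =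
    ∑' d : ℤ, (3 * n * (v * Complex.I) + (((3 * d : ℤ) : ℂ) + 1)) ^ (-3 : ℤ) :=
    tsum_congr fun d => by push_cast; rfl
  have l2 : ∑' d : ℤ, (3 * n * (v * Complex.I) + ((3 * d + 2 : ℤ) : ℂ)) ^ (-3 : ℤ) =
    ∑' d : ℤ, (3 * n * (v * Complex.I) + (((3 * d : ℤ) : ℂ) + 2)) ^ (-3 : ℤ) :=
    tsum_congr fun d => by push_cast; rfl
  rw [l1, l2, p1, p2]
  have sm (x : ℝ) : Summable fun k : ℕ+ => (k : ℂ) ^ 2 *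
      (Complex.exp (2 * Real.pi * Complex.I * x) *
          (Real.exp (-(2 * Real.pi * v)) : ℂ) ^ (n : ℕ)) ^ (k : ℕ) := by
    have s := (summable_pow_mul_geometric_of_norm_lt_one (R := ℂ) 2
      (r := Complex.exp (2 * Real.pi * Complex.I * x) *
          (Real.exp (-(2 * Real.pi * v)) : ℂ) ^ (n : ℕ)) ?_)
    · exact s.comp_injective PNat.coe_injective
    · rw [norm_mul]
      have : (2 * Real.pi * Complex.I * x : ℂ) = ((2 * Real.pi * x : ℝ) : ℂ) * Complex.I := by
        push_cast; ring
      rw [this, Complex.norm_exp_ofReal_mul_I, one_mul]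
      rw [← Complex.ofReal_pow, Complex.norm_real, Real.norm_eq_abs]
      exact q1
  rw [← mul_sub, ← mul_sub, ← (sm _).tsum_sub (sm _), ← tsum_mul_left, ← tsum_mul_left,
    ← tsum_mul_left]
  refine tsum_congr fun k => ?_
  have g := gauss_sum k
  rw [mul_pow, mul_pow, ← pow_mul]
  push_cast
  push_cast at g
  generalize Complex.exp (2 * Real.pi * Complex.I * (1 / 3)) ^ (k : ℕ) = z₁ at g ⊢
  generalize Complex.exp (2 * Real.pi * Complex.I * (2 / 3)) ^ (k : ℕ) = z₂ at g ⊢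
  generalize Complex.exp (-(2 * Real.pi * v)) ^ ((n : ℕ) * (k : ℕ)) = E
  linear_combination (4 / 27 * (Real.pi : ℂ) ^ 3 * Complex.I * (k : ℂ) ^ 2 * E) * g +
    (4 / 27 * (Real.pi : ℂ) ^ 3 * (k : ℂ) ^ 2 * E * √3 * (chi k : ℂ)) * Complex.I_sq

/-- Summing the lattice sum `∑ χ(m) (m τ + n)⁻³` over `m` first gives the other Eisenstein series,
up to a constant `κ`, at the image of `τ` under the Fricke involution. -/
theorem exists_fricke_const : ∃ κ : ℂ, ∀ v : ℝ, 0 < v →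
    (seriesB (Real.exp (-(2 * Real.pi * (1 / (3 * v))))) : ℂ) =
      v ^ 3 * (κ - √3 * seriesA (Real.exp (-(2 * Real.pi * v)))) := by
  -- the terms with `n = 0` give the constant
  set K : ℂ := ∑' m : ℤ, (chi m : ℂ) * (m : ℂ) ^ (-3 : ℤ) with hK
  refine ⟨27 / (8 * (Real.pi : ℂ) ^ 3) * K, fun v hv => ?_⟩
  have hv' : 0 < 1 / (3 * v) := by positivity
  have hvc : (v : ℂ) ≠ 0 := by exact_mod_cast hv.ne'
  have hq : |Real.exp (-(2 * Real.pi * v))| < 1 := by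
    rw [abs_of_pos (Real.exp_pos _), Real.exp_lt_one_iff]
    have := Real.pi_pos
    have : 0 < 2 * Real.pi * v := by positivity
    linarith
  have hrow := lattice_sum_rows hv'
  have hs := summable_chi_lattice hv'
  have hs' := (Equiv.prodComm ℤ ℤ).summable_iff.2 hs
  have hfact (m n : ℤ) : ((m : ℂ) * (((1 / (3 * v) : ℝ) : ℂ) * Complex.I) + n) ^ (-3 : ℤ) =
      -27 * v ^ 3 * Complex.I * ((3 * n * (v * Complex.I) - m) ^ (-3 : ℤ)) := by
    have : ((m : ℂ) * (((1 / (3 * v) : ℝ) : ℂ) * Complex.I) + n) =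
        (3 * v * Complex.I)⁻¹ * (3 * n * (v * Complex.I) - m) := by
      have := Complex.I_ne_zero
      push_cast
      field_simp
      linear_combination (m : ℂ) * Complex.I_sq
    rw [this, mul_zpow, inv_zpow, zpow_neg (3 * v * Complex.I), inv_inv]
    congr 1
    have e : (3 * v * Complex.I) ^ (3 : ℤ) = (3 * v * Complex.I) ^ 3 := by norm_cast
    rw [e, mul_pow, Complex.I_pow_three]
    ring
  have hcol : ∑' p : ℤ × ℤ,
      (chi p.1 : ℂ) * ((p.1 : ℂ) * (((1 / (3 * v) : ℝ) : ℂ) * Complex.I) + p.2) ^ (-3 : ℤ) =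
      ∑' n : ℤ, (-27 * v ^ 3 * Complex.I) *
        ∑' m : ℤ, (chi m : ℂ) * (3 * n * (v * Complex.I) - m) ^ (-3 : ℤ) := by
    rw [← (Equiv.prodComm ℤ ℤ).tsum_eq]
    refine (hs'.tsum_prod).trans (tsum_congr fun n => ?_)
    rw [← tsum_mul_left]
    refine tsum_congr fun m => ?_
    simp only [Function.comp, Equiv.prodComm_apply, Prod.swap]
    rw [hfact]; ring
  have hsum : Summable fun n : ℤ => (-27 * v ^ 3 * Complex.I) *
        ∑' m : ℤ, (chi m : ℂ) * (3 * n * (v * Complex.I) - m) ^ (-3 : ℤ) := by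
    refine hs'.prod.congr fun n => ?_
    rw [← tsum_mul_left]
    refine tsum_congr fun m => ?_
    simp only [Function.comp, Equiv.prodComm_apply, Prod.swap]
    rw [hfact]; ring
  have odd (z : ℂ) : (-z) ^ (-3 : ℤ) = -z ^ (-3 : ℤ) := Odd.neg_zpow ⟨-2, by norm_num⟩ z
  rw [hrow, tsum_int_eq_zero_add_two_mul_tsum_pnat (fun n => ?_) hsum] at hcol
  · have h0 : ∑' m : ℤ, (chi m : ℂ) * (3 * ((0 : ℤ) : ℂ) * (v * Complex.I) - m) ^ (-3 : ℤ) =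
        -K := by
      rw [hK, ← tsum_neg]
      refine tsum_congr fun m => ?_
      have : (3 * ((0 : ℤ) : ℂ) * (v * Complex.I) - m) = -(m : ℂ) := by push_cast; ring
      rw [this, odd]; ring
    have hp (n : ℕ+) : ∑' m : ℤ, (chi m : ℂ) *
        (3 * (((n : ℕ) : ℤ) : ℂ) * (v * Complex.I) - m) ^ (-3 : ℤ) =
        (4 * √3 * Real.pi ^ 3 / 27) *
        ∑' k : ℕ+, ((chi k * ((k : ℤ) : ℝ) ^ 2 : ℝ) : ℂ) *
          (Real.exp (-(2 * Real.pi * v)) : ℂ) ^ (n * k : ℕ) := by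
      have h := lattice_sum_column hv n
      rw [← tsum_comp_neg]
      have : ∑' m : ℤ, (chi (-m) : ℂ) *
          (3 * (((n : ℕ) : ℤ) : ℂ) * (v * Complex.I) - ((-m : ℤ) : ℂ)) ^ (-3 : ℤ) =
          -∑' m : ℤ, (chi m : ℂ) * (3 * n * (v * Complex.I) + m) ^ (-3 : ℤ) := by
        rw [← tsum_neg]
        refine tsum_congr fun m => ?_
        rw [chi_neg]; push_cast; rw [sub_neg_eq_add]; ring
      rw [this, h]; ring
    simp only [hp] at hcol
    rw [h0, tsum_mul_left, tsum_mul_left, ← ofReal_doubleSeries bound_a hq] at hcol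
    have hpi : (Real.pi : ℂ) ≠ 0 := by exact_mod_cast Real.pi_pos.ne'
    have hI := Complex.I_ne_zero
    unfold seriesA
    have h8 : 8 * (Real.pi : ℂ) ^ 3 * Complex.I ≠ 0 := by
      simp [hpi]
    apply mul_left_cancel₀ h8
    rw [hcol]
    field_simp
    ring
  · congr 1
    rw [← tsum_comp_neg]
    refine tsum_congr fun m => ?_
    rw [chi_neg]
    have : (3 * ((-n : ℤ) : ℂ) * (v * Complex.I) - ((-m : ℤ) : ℂ)) =
        -(3 * n * (v * Complex.I) - m) := by push_cast; ring
    rw [this, odd]; push_cast; ring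

/-- The Eisenstein series `E_{3a}` is the cube of `eisOne` times `1 - s`. -/
theorem eisOne_cube_mul {q : ℝ} (hq : q ∈ Set.Ioo (0 : ℝ) 1) :
    eisOne q ^ 3 * (1 - hauptmodul q) = 1 - 9 * seriesA q := by
  obtain ⟨κ, hκ⟩ := exists_fricke_const
  have hpi := Real.pi_pos
  have h3 : √3 ^ 2 = (3 : ℝ) := Real.sq_sqrt (by norm_num)
  have h3p : 0 < √3 := Real.sqrt_pos.2 (by norm_num)
  have main : ∀ x ∈ Set.Ioo (0 : ℝ) 1,
      eisOne x ^ 3 * (1 - hauptmodul x) = 3 * √3 * κ.re - 9 * seriesA x := by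
    intro x hx
    set v := -Real.log x / (2 * Real.pi) with hv
    have hlog : Real.log x < 0 := Real.log_neg hx.1 hx.2
    have hv0 : 0 < v := div_pos (by linarith) (by positivity)
    have hlogv : Real.log x = -(2 * Real.pi * v) := by rw [hv]; field_simp
    have hxv : Real.exp (-(2 * Real.pi * v)) = x := by rw [← hlogv, Real.exp_log hx.1]
    set x' := Real.exp (-(2 * Real.pi * (1 / (3 * v)))) with hx'
    have hx'm : x' ∈ Set.Ioo (0 : ℝ) 1 := by
      refine ⟨Real.exp_pos _, Real.exp_lt_one_iff.2 ?_⟩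
      have : 0 < 2 * Real.pi * (1 / (3 * v)) := by positivity
      linarith
    have hfr : hauptmodul x' = 1 - hauptmodul x := by
      refine hauptmodul_fricke hx hx'm ?_
      rw [hx', Real.log_exp, hlogv]
      field_simp; ring
    have hB : seriesB x' = v ^ 3 * (κ.re - √3 * seriesA x) := by
      have h := congrArg Complex.re (hκ v hv0)
      rw [hxv, ← Complex.ofReal_pow, Complex.re_ofReal_mul, Complex.sub_re, ← Complex.ofReal_mul,
        Complex.ofReal_re, Complex.ofReal_re] at h
      exact h
    have hA : eisOne x' = √3 * v * eisOne x := by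
      rw [← hyp_hauptmodul hx'm, hfr, hyp_one_sub_hauptmodul hx, hlogv]
      unfold wronskianConst; field_simp
    rw [← hfr]
    have e := (eisOne_pos hx.1 hx.2).ne'
    unfold hauptmodul
    rw [← seriesB_eq hx'm.1 hx'm.2, hA, hB]
    field_simp
    linear_combination (-9 * κ.re + 9 * √3 * seriesA x - 3 * κ.re * √3 ^ 2) * h3
  have hlim : 3 * √3 * κ.re = 1 := by
    have l1 : Tendsto (fun x => eisOne x ^ 3 * (1 - hauptmodul x)) (𝓝[>] 0) (𝓝 1) := by
      simpa using (tendsto_eisOne_zero.pow 3).mul (tendsto_hauptmodul_zero.const_sub 1)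
    have l2 : Tendsto (fun x => 3 * √3 * κ.re - 9 * seriesA x) (𝓝[>] 0) (𝓝 (3 * √3 * κ.re)) := by
      simpa using (tendsto_seriesA_zero.const_mul 9).const_sub (3 * √3 * κ.re)
    refine tendsto_nhds_unique l2 (l1.congr' ?_)
    filter_upwards [Ioo_mem_nhdsGT (show (0 : ℝ) < 1 by norm_num)] with x hx using main x hx
  rw [main q hq, hlim]

/-! ### Period integrals over the ovals -/

/-- Differentiation under the integral sign for an integrand that is `C¹` in the parameter. -/
theorem hasDerivAt_integral_of_continuousOn {f f' : ℝ → ℝ → ℝ} {U : Set ℝ} (hU : IsOpen U)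
    (hf : ContinuousOn (Function.uncurry f) (U ×ˢ Set.univ))
    (hf' : ContinuousOn (Function.uncurry f') (U ×ˢ Set.univ))
    (hd : ∀ u ∈ U, ∀ θ, HasDerivAt (fun v => f v θ) (f' u θ) u) (a b : ℝ) {u : ℝ} (hu : u ∈ U) :
    HasDerivAt (fun v => ∫ θ in a..b, f v θ) (∫ θ in a..b, f' u θ) u := by
  obtain ⟨ε, hε, hball⟩ := Metric.nhds_basis_closedBall.mem_iff.1 (hU.mem_nhds hu)
  have slice {g : ℝ → ℝ → ℝ} (hg : ContinuousOn (Function.uncurry g) (U ×ˢ Set.univ)) {v : ℝ}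
      (hv : v ∈ U) : Continuous (g v) := by
    have : Continuous fun θ : ℝ => Function.uncurry g (v, θ) :=
      hg.comp_continuous (by fun_prop) fun θ => ⟨hv, trivial⟩
    exact this
  obtain ⟨C, hC⟩ := ((isCompact_closedBall u ε).prod
    (isCompact_uIcc (a := a) (b := b))).exists_bound_of_continuousOn
    (hf'.mono (Set.prod_mono hball (Set.subset_univ _)))
  refine (intervalIntegral.hasDerivAt_integral_of_dominated_loc_of_deriv_le (bound := fun _ => C)
    (s := Metric.closedBall u ε) (Metric.closedBall_mem_nhds u hε) ?_ ?_ ?_ ?_ ?_ ?_).2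
  · filter_upwards [hU.mem_nhds hu] with v hv
    exact (slice hf hv).aestronglyMeasurable
  · exact (slice hf hu).intervalIntegrable _ _
  · exact (slice hf' hu).aestronglyMeasurable
  · refine Eventually.of_forall fun θ hθ v hv => hC (v, θ) ⟨hv, Set.uIoc_subset_uIcc hθ⟩
  · exact intervalIntegrable_const
  · exact Eventually.of_forall fun θ _ v hv => hd v (hball hv) θ

/-- Two solutions of one second order equation, written as a first order system with fluxes `Φ`
and `H`, are proportional if both fluxes vanish at an endpoint: the Wronskian is constant and
tends to `0` there. -/
theorem eq_mul_of_flux_tendsto_zero {K Φ G H M ρ : ℝ → ℝ} {u v k : ℝ} {F : Filter ℝ} (huv : u < v)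
    (hF : F = 𝓝[>] u ∨ F = 𝓝[<] v)
    (hM : ∀ x ∈ Set.Ioo u v, M x ≠ 0) (hG : ∀ x ∈ Set.Ioo u v, G x ≠ 0)
    (hK' : ∀ x ∈ Set.Ioo u v, HasDerivAt K (Φ x / M x) x)
    (hΦ' : ∀ x ∈ Set.Ioo u v, HasDerivAt Φ (ρ x * K x) x)
    (hG' : ∀ x ∈ Set.Ioo u v, HasDerivAt G (H x / M x) x)
    (hH' : ∀ x ∈ Set.Ioo u v, HasDerivAt H (ρ x * G x) x)
    (lK : Tendsto K F (𝓝 k)) (lΦ : Tendsto Φ F (𝓝 0)) (lG : Tendsto G F (𝓝 1))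
    (lH : Tendsto H F (𝓝 0)) {x : ℝ} (hx : x ∈ Set.Ioo u v) : K x = k * G x := by
  have const {f : ℝ → ℝ} {l : ℝ} (hf : ∀ x ∈ Set.Ioo u v, HasDerivAt f 0 x)
      (hl : Tendsto f F (𝓝 l)) {x : ℝ} (hx : x ∈ Set.Ioo u v) : f x = l := by
    rcases hF with rfl | rfl
    · exact eq_of_hasDerivAt_zero_of_tendsto_left huv hf hl hx
    · exact eq_of_hasDerivAt_zero_of_tendsto_right huv hf hl hx
  have hW {x : ℝ} (hx : x ∈ Set.Ioo u v) : Φ x * G x - K x * H x = 0 := by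
    refine const (f := fun x => Φ x * G x - K x * H x) (fun x hx => ?_) ?_ hx
    · refine (((hΦ' x hx).mul (hG' x hx)).sub ((hK' x hx).mul (hH' x hx))).congr_deriv ?_
      have := hM x hx
      field_simp
      ring
    · simpa using (lΦ.mul lG).sub (lK.mul lH)
  have hq : K x / G x = k := by
    refine const (f := fun x => K x / G x) (fun x hx => ?_) ?_ hx
    · refine ((hK' x hx).div (hG' x hx) (hG x hx)).congr_deriv ?_
      have h1 := hM x hx
      have h2 := hG x hx
      have h3 := hW hx
      field_simp
      linarith
    · have := lK.div lG one_ne_zero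
      rwa [div_one] at this
  rw [← hq, div_mul_cancel₀ _ (hG x hx)]

/-- If `c = 3 - u²` is a root of `4x³ - g₂(s)x - g₃(s)`, the other two roots are
`-c/2 ± √(ovalRad u)`. -/
noncomputable def ovalRad (u : ℝ) : ℝ := 3 / 4 * (1 - u) * (3 + u) ^ 3

/-- Up to the sign `σ`, the difference `c - x` on the oval over the segment between the two
roots other than `c = 3 - u²`. -/
noncomputable def ovalDist (σ u θ : ℝ) : ℝ := σ * (3 / 2 * (3 - u ^ 2) + √(ovalRad u) * Real.cos θ)

/-- The parameters `u` for which the oval does not meet the root `3 - u²`, which lies above it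
for `σ = 1` and below it for `σ = -1`. -/
def ovalDom (σ : ℝ) : Set ℝ := {u | -3 < u ∧ u < 1 ∧ 0 < σ * (3 - u ^ 2) ∧ 0 < u ^ 3 * (u + 2)}

theorem isOpen_ovalDom (σ : ℝ) : IsOpen (ovalDom σ) := by
  have h1 : IsOpen {u : ℝ | -3 < u} := isOpen_lt (by fun_prop) (by fun_prop)
  have h2 : IsOpen {u : ℝ | u < 1} := isOpen_lt (by fun_prop) (by fun_prop)
  have h3 : IsOpen {u : ℝ | 0 < σ * (3 - u ^ 2)} := isOpen_lt (by fun_prop) (by fun_prop)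
  have h4 : IsOpen {u : ℝ | 0 < u ^ 3 * (u + 2)} := isOpen_lt (by fun_prop) (by fun_prop)
  exact h1.inter (h2.inter (h3.inter h4))

theorem ovalRad_pos {σ u : ℝ} (hu : u ∈ ovalDom σ) : 0 < ovalRad u := by
  have h1 : 0 < 1 - u := by linarith [hu.2.1]
  have h2 : 0 < 3 + u := by linarith [hu.1]
  unfold ovalRad; positivity

theorem ovalDist_pos {σ u : ℝ} (hσ : σ ^ 2 = 1) (hu : u ∈ ovalDom σ) (θ : ℝ) :
    0 < ovalDist σ u θ := by
  have h3 := hu.2.2.1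
  have h4 := hu.2.2.2
  have hR := Real.sq_sqrt (ovalRad_pos hu).le
  have hQ : |σ * √(ovalRad u)| < σ * (3 / 2 * (3 - u ^ 2)) := by
    apply abs_lt_of_sq_lt_sq _ (by nlinarith)
    rw [mul_pow, mul_pow, hσ, hR]
    unfold ovalRad
    nlinarith
  have hc : |σ * √(ovalRad u) * Real.cos θ| ≤ |σ * √(ovalRad u)| := by
    rw [abs_mul]
    exact mul_le_of_le_one_right (abs_nonneg _) (Real.abs_cos_le_one θ)
  have := neg_abs_le (σ * √(ovalRad u) * Real.cos θ)
  unfold ovalDist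
  linarith

theorem continuous_ovalDist (σ : ℝ) : Continuous fun p : ℝ × ℝ => ovalDist σ p.1 p.2 := by
  unfold ovalDist ovalRad; fun_prop

theorem continuous_ovalDist_right (σ u : ℝ) : Continuous (ovalDist σ u) := by
  unfold ovalDist; fun_prop

/-- The derivative is affine in `ovalDist` itself, so that differentiation of the oval integrals
produces only integrals of powers of `ovalDist`. -/
theorem hasDerivAt_ovalDist {σ u : ℝ} (hu : u ∈ ovalDom σ) (θ : ℝ) :
    HasDerivAt (fun v => ovalDist σ v θ) (-3 * σ * u - 2 * u / ((1 - u) * (3 + u)) *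
      (ovalDist σ u θ - σ * (3 / 2 * (3 - u ^ 2)))) u := by
  have hR := ovalRad_pos hu
  have h1 : 0 < 1 - u := by linarith [hu.2.1]
  have h2 : 0 < 3 + u := by linarith [hu.1]
  have hrad : HasDerivAt ovalRad (-4 * u / ((1 - u) * (3 + u)) * ovalRad u) u := by
    have e1 : HasDerivAt (fun v : ℝ => 1 - v) (-1) u := by
      simpa using (hasDerivAt_id u).const_sub 1
    have e2 : HasDerivAt (fun v : ℝ => 3 + v) 1 u := by
      simpa using (hasDerivAt_id u).const_add 3
    refine ((e1.const_mul (3 / 4)).mul (e2.pow 3)).congr_deriv ?_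
    simp only [Pi.pow_apply]
    unfold ovalRad
    field_simp
    ring
  have hs := hrad.sqrt hR.ne'
  have hsq : HasDerivAt (fun v : ℝ => 3 - v ^ 2) (-(2 * u)) u := by
    simpa using ((hasDerivAt_id u).pow 2).const_sub 3
  have := ((hsq.const_mul (3 / 2)).add (hs.mul_const (Real.cos θ))).const_mul σ
  refine this.congr_deriv ?_
  have hq := Real.sqrt_pos.2 hR
  have hqq := Real.sq_sqrt hR.le
  unfold ovalDist
  rw [← hqq]
  simp only [Real.sqrt_sq hq.le]
  field_simp
  ring

/-- The integral over the oval of `dx / y`, up to a constant factor. -/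
noncomputable def ovalK (σ u : ℝ) : ℝ := ∫ θ in (0 : ℝ)..2 * Real.pi, (√(ovalDist σ u θ))⁻¹

/-- The integral over the oval of `(c - x) dx / y`, up to a constant factor, where `c` is the root
off the oval. -/
noncomputable def ovalL (σ u : ℝ) : ℝ := ∫ θ in (0 : ℝ)..2 * Real.pi, √(ovalDist σ u θ)

/-- The integral over the oval of `dx / ((c - x) y)` reduces to that of `(c - x) dx / y`, because
the two differ by the integral of an exact form. -/
theorem integral_inv_cube {σ u : ℝ} (hσ : σ ^ 2 = 1) (hu : u ∈ ovalDom σ) :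
    3 * u ^ 3 * (u + 2) * ∫ θ in (0 : ℝ)..2 * Real.pi, (√(ovalDist σ u θ))⁻¹ ^ 3 = ovalL σ u := by
  have hpos := ovalDist_pos hσ hu
  have hsp θ := Real.sqrt_pos.2 (hpos θ)
  have hcont : Continuous fun θ => √(ovalDist σ u θ) := (continuous_ovalDist_right σ u).sqrt
  have hinv : Continuous fun θ => (√(ovalDist σ u θ))⁻¹ := hcont.inv₀ fun θ => (hsp θ).ne'
  have hinv3 : Continuous fun θ => (√(ovalDist σ u θ))⁻¹ ^ 3 := hinv.pow 3
  -- the primitive of the exact form; up to a constant it is `y / (c - x)`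
  have hD θ : HasDerivAt (fun θ => 2 * σ * √(ovalRad u) * Real.sin θ * (√(ovalDist σ u θ))⁻¹)
      (√(ovalDist σ u θ) - 3 * u ^ 3 * (u + 2) * (√(ovalDist σ u θ))⁻¹ ^ 3) θ := by
    have hg : HasDerivAt (ovalDist σ u) (σ * (√(ovalRad u) * -Real.sin θ)) θ :=
      (((Real.hasDerivAt_cos θ).const_mul _).const_add _).const_mul σ
    have hi := (hg.sqrt (hpos θ).ne').inv (hsp θ).ne'
    refine (((Real.hasDerivAt_sin θ).const_mul (2 * σ * √(ovalRad u))).mul hi).congr_deriv ?_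
    have hw := Real.sq_sqrt (hpos θ).le
    have hR := Real.sq_sqrt (ovalRad_pos hu).le
    have hw' : √(ovalDist σ u θ) ^ 2 = σ * (3 / 2 * (3 - u ^ 2) + √(ovalRad u) * Real.cos θ) := hw
    have hsc := Real.sin_sq_add_cos_sq θ
    have hne := (hsp θ).ne'
    simp only [Pi.inv_apply]
    set w := √(ovalDist σ u θ)
    set r := √(ovalRad u)
    field_simp
    have hP : (σ * (3 / 2 * (3 - u ^ 2))) ^ 2 - (σ * r) ^ 2 = 3 * u ^ 3 * (u + 2) := by
      rw [mul_pow, mul_pow σ r, hσ, hR]; unfold ovalRad; ring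
    have h4 : w ^ 4 = (σ * (3 / 2 * (3 - u ^ 2) + r * Real.cos θ)) ^ 2 := by rw [← hw']; ring
    rw [h4, hw']
    linear_combination (r ^ 2 * σ ^ 2) * hsc - hP
  have hint := intervalIntegral.integral_eq_sub_of_hasDerivAt (a := 0) (b := 2 * Real.pi)
    (fun θ _ => hD θ)
    ((hcont.sub (hinv3.const_mul _)).intervalIntegrable _ _)
  rw [intervalIntegral.integral_sub (hcont.intervalIntegrable _ _)
    ((hinv3.const_mul _).intervalIntegrable _ _), intervalIntegral.integral_const_mul] at hint
  simp only [Real.sin_two_pi, Real.sin_zero, mul_zero, zero_mul, sub_self] at hint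
  unfold ovalL
  linarith

theorem hasDerivAt_ovalK {σ u : ℝ} (hσ : σ ^ 2 = 1) (hu : u ∈ ovalDom σ) :
    HasDerivAt (ovalK σ)
      ((u * ovalK σ u - σ * ovalL σ u / (u * (u + 2))) / ((1 - u) * (3 + u))) u := by
  have h1 : 0 < 1 - u := by linarith [hu.2.1]
  have h2 : 0 < 3 + u := by linarith [hu.1]
  have hcg := (continuous_ovalDist σ).sqrt
  have hci : ContinuousOn (fun p : ℝ × ℝ => (√(ovalDist σ p.1 p.2))⁻¹) (ovalDom σ ×ˢ Set.univ) :=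
    hcg.continuousOn.inv₀ fun p hp => (Real.sqrt_pos.2 (ovalDist_pos hσ hp.1 _)).ne'
  have hci3 : ContinuousOn (fun p : ℝ × ℝ => (√(ovalDist σ p.1 p.2))⁻¹ ^ 3)
    (ovalDom σ ×ˢ Set.univ) := hci.pow 3
  have hcN : ContinuousOn (fun p : ℝ × ℝ => p.1 / ((1 - p.1) * (3 + p.1)))
      (ovalDom σ ×ˢ Set.univ) := by
    refine ContinuousOn.div (by fun_prop) (by fun_prop) fun p hp => ?_
    have h1 : 0 < 1 - p.1 := by linarith [hp.1.2.1]
    have h2 : 0 < 3 + p.1 := by linarith [hp.1.1]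
    positivity
  have hcL : ContinuousOn (fun p : ℝ × ℝ => 3 * σ * p.1) (ovalDom σ ×ˢ Set.univ) := by fun_prop
  have key := hasDerivAt_integral_of_continuousOn (isOpen_ovalDom σ)
    (f := fun u θ => (√(ovalDist σ u θ))⁻¹)
    (f' := fun u θ => u / ((1 - u) * (3 + u)) * (√(ovalDist σ u θ))⁻¹
      - 3 * σ * u * (u / ((1 - u) * (3 + u))) * (√(ovalDist σ u θ))⁻¹ ^ 3)
    hci (by exact (hcN.mul hci).sub ((hcL.mul hcN).mul hci3)) (fun u hu θ => ?_) 0 (2 * Real.pi) hu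
  · refine key.congr_deriv ?_
    have hi : Continuous fun θ => (√(ovalDist σ u θ))⁻¹ :=
      (continuous_ovalDist_right σ u).sqrt.inv₀ fun θ =>
        (Real.sqrt_pos.2 (ovalDist_pos hσ hu θ)).ne'
    have hi3 : Continuous fun θ => (√(ovalDist σ u θ))⁻¹ ^ 3 := hi.pow 3
    rw [intervalIntegral.integral_sub ((hi.const_mul _).intervalIntegrable _ _)
      ((hi3.const_mul _).intervalIntegrable _ _), intervalIntegral.integral_const_mul,
      intervalIntegral.integral_const_mul, ← integral_inv_cube hσ hu]
    have h4 := hu.2.2.2.ne'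
    have hu0 : u ≠ 0 := by rintro rfl; simp at h4
    have hu2 : u + 2 ≠ 0 := by intro h; simp [h] at h4
    change _ * ovalK σ u - _ = _
    field_simp
  · have h1 : 0 < 1 - u := by linarith [hu.2.1]
    have h2 : 0 < 3 + u := by linarith [hu.1]
    have hg := ovalDist_pos hσ hu θ
    have hs := Real.sqrt_pos.2 hg
    refine (((hasDerivAt_ovalDist hu θ).sqrt hg.ne').inv hs.ne').congr_deriv ?_
    have hw := Real.sq_sqrt hg.le
    have hne := hs.ne'
    set w := √(ovalDist σ u θ)
    rw [← hw]
    field_simp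
    ring

theorem hasDerivAt_ovalL {σ u : ℝ} (hσ : σ ^ 2 = 1) (hu : u ∈ ovalDom σ) :
    HasDerivAt (ovalL σ)
      ((3 * σ * u ^ 2 * ovalK σ u - u * ovalL σ u) / ((1 - u) * (3 + u))) u := by
  have hcg := (continuous_ovalDist σ).sqrt
  have hci : ContinuousOn (fun p : ℝ × ℝ => (√(ovalDist σ p.1 p.2))⁻¹) (ovalDom σ ×ˢ Set.univ) :=
    hcg.continuousOn.inv₀ fun p hp => (Real.sqrt_pos.2 (ovalDist_pos hσ hp.1 _)).ne'
  have hcN : ContinuousOn (fun p : ℝ × ℝ => p.1 / ((1 - p.1) * (3 + p.1)))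
      (ovalDom σ ×ˢ Set.univ) := by
    refine ContinuousOn.div (by fun_prop) (by fun_prop) fun p hp => ?_
    have h1 : 0 < 1 - p.1 := by linarith [hp.1.2.1]
    have h2 : 0 < 3 + p.1 := by linarith [hp.1.1]
    positivity
  have hcL : ContinuousOn (fun p : ℝ × ℝ => 3 * σ * p.1) (ovalDom σ ×ˢ Set.univ) := by fun_prop
  have key := hasDerivAt_integral_of_continuousOn (isOpen_ovalDom σ)
    (f := fun u θ => √(ovalDist σ u θ))
    (f' := fun u θ => 3 * σ * u * (u / ((1 - u) * (3 + u))) * (√(ovalDist σ u θ))⁻¹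
      - u / ((1 - u) * (3 + u)) * √(ovalDist σ u θ))
    hcg.continuousOn (by exact ((hcL.mul hcN).mul hci).sub (hcN.mul hcg.continuousOn))
    (fun u hu θ => ?_) 0 (2 * Real.pi) hu
  · refine key.congr_deriv ?_
    have hc := (continuous_ovalDist_right σ u).sqrt
    have hi : Continuous fun θ => (√(ovalDist σ u θ))⁻¹ :=
      hc.inv₀ fun θ => (Real.sqrt_pos.2 (ovalDist_pos hσ hu θ)).ne'
    rw [intervalIntegral.integral_sub ((hi.const_mul _).intervalIntegrable _ _)
      ((hc.const_mul _).intervalIntegrable _ _), intervalIntegral.integral_const_mul,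
      intervalIntegral.integral_const_mul]
    change _ * ovalK σ u - _ * ovalL σ u = _
    ring
  · have h1 : 0 < 1 - u := by linarith [hu.2.1]
    have h2 : 0 < 3 + u := by linarith [hu.1]
    have hg := ovalDist_pos hσ hu θ
    have hs := Real.sqrt_pos.2 hg
    refine ((hasDerivAt_ovalDist hu θ).sqrt hg.ne').congr_deriv ?_
    have hw := Real.sq_sqrt hg.le
    have hne := hs.ne'
    set w := √(ovalDist σ u θ)
    rw [← hw]
    field_simp
    ring

/-- The flux `s (1 - s) dK/ds` of the oval integral, where `s = u² (3 + u) / 4`. -/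
noncomputable def ovalFlux (σ u : ℝ) : ℝ :=
  (u ^ 2 * (u + 2) * ovalK σ u - σ * ovalL σ u) / 12

/-- The Picard–Fuchs equation of the family of ovals is the hypergeometric equation. -/
theorem hasDerivAt_ovalFlux {σ u : ℝ} (hσ : σ ^ 2 = 1) (hu : u ∈ ovalDom σ) :
    HasDerivAt (ovalFlux σ) (u * (u + 2) / 6 * ovalK σ u) u := by
  have h1 : 0 < 1 - u := by linarith [hu.2.1]
  have h2 : 0 < 3 + u := by linarith [hu.1]
  have h4 := hu.2.2.2.ne'
  have hu0 : u ≠ 0 := by rintro rfl; simp at h4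
  have hu2 : u + 2 ≠ 0 := by intro h; simp [h] at h4
  have hp : HasDerivAt (fun v : ℝ => v ^ 2 * (v + 2)) (2 * u * (u + 2) + u ^ 2) u := by
    refine ((hasDerivAt_pow 2 u).mul ((hasDerivAt_id u).add_const 2)).congr_deriv ?_
    simp
  refine (((hp.mul (hasDerivAt_ovalK hσ hu)).sub
    ((hasDerivAt_ovalL hσ hu).const_mul σ)).div_const 12).congr_deriv ?_
  have e : σ * (3 * σ * u ^ 2 * ovalK σ u - u * ovalL σ u) =
      3 * u ^ 2 * ovalK σ u - σ * u * ovalL σ u := by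
    linear_combination (3 * u ^ 2 * ovalK σ u) * hσ
  have e' : σ * ((3 * σ * u ^ 2 * ovalK σ u - u * ovalL σ u) / ((1 - u) * (3 + u))) =
      (3 * u ^ 2 * ovalK σ u - σ * u * ovalL σ u) / ((1 - u) * (3 + u)) := by rw [← e]; ring
  simp only [e']
  field_simp
  ring

theorem hasDerivAt_ovalK' {σ u : ℝ} (hσ : σ ^ 2 = 1) (hu : u ∈ ovalDom σ) :
    HasDerivAt (ovalK σ) (ovalFlux σ u / (u * (u + 2) * ((1 - u) * (3 + u)) / 12)) u := by
  have h1 : 0 < 1 - u := by linarith [hu.2.1]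
  have h2 : 0 < 3 + u := by linarith [hu.1]
  have h4 := hu.2.2.2.ne'
  have hu0 : u ≠ 0 := by rintro rfl; simp at h4
  have hu2 : u + 2 ≠ 0 := by intro h; simp [h] at h4
  refine (hasDerivAt_ovalK hσ hu).congr_deriv ?_
  unfold ovalFlux
  field_simp

theorem continuous_ovalL (σ : ℝ) : Continuous (ovalL σ) :=
  intervalIntegral.continuous_parametric_intervalIntegral_of_continuous'
    (f := fun u θ => √(ovalDist σ u θ)) (continuous_ovalDist σ).sqrt 0 (2 * Real.pi)

/-- The oval integral is continuous also at a parameter for which the oval has shrunk to a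
point. -/
theorem continuousAt_ovalK {σ e : ℝ} (h0 : ovalRad e = 0) (h1 : 1 < σ * (3 / 2 * (3 - e ^ 2))) :
    ContinuousAt (ovalK σ) e := by
  -- near `e` the integrand equals one that is continuous everywhere
  have hc : Continuous fun u => ∫ θ in (0 : ℝ)..2 * Real.pi, (√(max (ovalDist σ u θ) 1))⁻¹ := by
    refine intervalIntegral.continuous_parametric_intervalIntegral_of_continuous'
      (f := fun u θ => (√(max (ovalDist σ u θ) 1))⁻¹) ?_ 0 (2 * Real.pi)
    refine ((continuous_ovalDist σ).max continuous_const).sqrt.inv₀ fun p => ?_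
    exact (Real.sqrt_pos.2 (lt_max_of_lt_right one_pos)).ne'
  have hcont : Continuous fun u => σ * (3 / 2 * (3 - u ^ 2)) - |σ| * √(ovalRad u) := by
    unfold ovalRad; fun_prop
  have hev : ∀ᶠ u in 𝓝 e, 1 < σ * (3 / 2 * (3 - u ^ 2)) - |σ| * √(ovalRad u) :=
    hcont.continuousAt.eventually_const_lt (by simpa [h0] using h1)
  refine hc.continuousAt.congr ?_
  filter_upwards [hev] with u hu
  unfold ovalK
  congr 1
  funext θ
  rw [max_eq_left]
  have hc : |σ * √(ovalRad u) * Real.cos θ| ≤ |σ| * √(ovalRad u) := by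
    rw [abs_mul, abs_mul, abs_of_nonneg (Real.sqrt_nonneg _)]
    exact mul_le_of_le_one_right (by positivity) (Real.abs_cos_le_one θ)
  have := neg_abs_le (σ * √(ovalRad u) * Real.cos θ)
  unfold ovalDist
  linarith

theorem ovalK_of_ovalRad_eq_zero {σ e : ℝ} (h0 : ovalRad e = 0) :
    ovalK σ e = 2 * Real.pi * (√(σ * (3 / 2 * (3 - e ^ 2))))⁻¹ := by
  simp [ovalK, ovalDist, h0]

theorem ovalL_of_ovalRad_eq_zero {σ e : ℝ} (h0 : ovalRad e = 0) :
    ovalL σ e = 2 * Real.pi * √(σ * (3 / 2 * (3 - e ^ 2))) := by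
  simp [ovalL, ovalDist, h0]

theorem hasDerivAt_paramS (u : ℝ) :
    HasDerivAt (fun u : ℝ => u ^ 2 * (3 + u) / 4) (3 / 4 * (u * (u + 2))) u := by
  have := ((hasDerivAt_pow 2 u).mul ((hasDerivAt_id u).const_add 3)).div_const 4
  refine this.congr_deriv ?_
  simp
  ring

/-- As `u → 1`, that is `s → 1`, the oval shrinks to a point, the integral stays bounded and its
flux vanishes. This singles out the solution `hyp (1 - s)`. -/
theorem ovalK_one {u : ℝ} (h0 : 0 < u) (h1 : u < 1) :
    ovalK 1 u = 2 * Real.pi / √3 * hyp (1 - u ^ 2 * (3 + u) / 4) := by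
  have dom : ∀ x ∈ Set.Ioo (0 : ℝ) 1, x ∈ ovalDom 1 := fun x hx =>
    ⟨by linarith [hx.1], hx.2, by nlinarith [hx.1, hx.2], by have := hx.1; positivity⟩
  have hs : ∀ x ∈ Set.Ioo (0 : ℝ) 1, 0 < x ^ 2 * (3 + x) / 4 ∧ x ^ 2 * (3 + x) / 4 < 1 := by
    intro x ⟨hx0, hx1⟩
    refine ⟨by positivity, ?_⟩
    have : 0 < (1 - x) * (x + 2) ^ 2 := mul_pos (by linarith) (by positivity)
    nlinarith
  have hτ (x : ℝ) := (hasDerivAt_paramS x).const_sub 1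
  have e0 : ovalRad 1 = 0 := by simp [ovalRad]
  have e3 : (1 : ℝ) * (3 / 2 * (3 - 1 ^ 2)) = 3 := by norm_num
  have s3 : √(3 : ℝ) ^ 2 = 3 := Real.sq_sqrt (by norm_num)
  have s3' : √(3 : ℝ) ≠ 0 := by positivity
  have lK : Tendsto (ovalK 1) (𝓝[<] 1) (𝓝 (2 * Real.pi / √3)) := by
    have := (continuousAt_ovalK (σ := 1) e0 (by norm_num)).continuousWithinAt (s := Set.Iio 1)
    rwa [ContinuousWithinAt, ovalK_of_ovalRad_eq_zero e0, e3, ← div_eq_mul_inv] at this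
  have lL : Tendsto (ovalL 1) (𝓝[<] 1) (𝓝 (2 * Real.pi * √3)) := by
    have := (continuous_ovalL 1).continuousAt.continuousWithinAt (x := (1 : ℝ)) (s := Set.Iio 1)
    rwa [ContinuousWithinAt, ovalL_of_ovalRad_eq_zero e0, e3] at this
  have lτ : Tendsto (fun x : ℝ => 1 - x ^ 2 * (3 + x) / 4) (𝓝[<] 1) (𝓝 0) := by
    have : ContinuousAt (fun x : ℝ => 1 - x ^ 2 * (3 + x) / 4) 1 := by fun_prop
    have := this.continuousWithinAt (s := Set.Iio 1)
    rw [ContinuousWithinAt] at this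
    norm_num at this
    exact this
  have lp : Tendsto (fun x : ℝ => x ^ 2 * (x + 2)) (𝓝[<] 1) (𝓝 3) := by
    have : ContinuousAt (fun x : ℝ => x ^ 2 * (x + 2)) 1 := by fun_prop
    have := this.continuousWithinAt (s := Set.Iio 1)
    rw [ContinuousWithinAt] at this
    norm_num at this
    exact this
  refine eq_mul_of_flux_tendsto_zero (Φ := ovalFlux 1) (F := 𝓝[<] 1)
    (G := fun u => hyp (1 - u ^ 2 * (3 + u) / 4)) (H := fun u => -hypFlux (1 - u ^ 2 * (3 + u) / 4))
    (M := fun u => u * (u + 2) * ((1 - u) * (3 + u)) / 12) (ρ := fun u => u * (u + 2) / 6)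
    one_pos (Or.inr rfl) ?_ ?_ (fun x hx => hasDerivAt_ovalK' (by norm_num) (dom x hx))
    (fun x hx => hasDerivAt_ovalFlux (by norm_num) (dom x hx)) ?_ ?_ lK ?_ ?_ ?_ ⟨h0, h1⟩
  · intro x ⟨hx0, hx1⟩
    have : 0 < 1 - x := by linarith
    positivity
  · intro x hx
    have := one_le_hyp (s := 1 - x ^ 2 * (3 + x) / 4) (by linarith [(hs x hx).2])
      (by linarith [(hs x hx).1])
    exact (lt_of_lt_of_le one_pos this).ne'
  · intro x hx
    refine ((hasDerivAt_hyp (s := 1 - x ^ 2 * (3 + x) / 4) (by linarith [(hs x hx).2])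
      (by linarith [(hs x hx).1])).comp x (hτ x)).congr_deriv ?_
    obtain ⟨hx0, hx1⟩ := hx
    have h1 : 0 < 1 - x := by linarith
    have e1 : 1 - x ^ 2 * (3 + x) / 4 = (1 - x) * (x + 2) ^ 2 / 4 := by ring
    have e2 : 1 - (1 - x) * (x + 2) ^ 2 / 4 = x ^ 2 * (3 + x) / 4 := by ring
    rw [e1, e2]
    field_simp
    ring
  · intro x hx
    refine ((hasDerivAt_hypFlux (s := 1 - x ^ 2 * (3 + x) / 4)
      (by rw [abs_lt]; constructor <;> linarith [(hs x hx).1, (hs x hx).2])).comp x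
      (hτ x)).neg.congr_deriv ?_
    ring
  · have := ((lp.mul lK).sub (lL.const_mul 1)).div_const 12
    have e : (3 * (2 * Real.pi / √3) - 1 * (2 * Real.pi * √3)) / 12 = 0 := by
      field_simp; rw [s3]; ring
    rwa [e] at this
  · have := (continuousAt_hyp (s := 0) (by simp)).tendsto.comp lτ
    rwa [hyp_zero] at this
  · have := ((continuousAt_hypFlux (s := 0) (by simp)).tendsto.comp lτ).neg
    rwa [hypFlux_zero, neg_zero] at this

/-- The same argument as `u → -3`, that is `s → 0`, where it singles out the solution `hyp s`. -/
theorem ovalK_neg_one {u : ℝ} (h0 : -3 < u) (h1 : u < -2) :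
    ovalK (-1) u = 2 * Real.pi / 3 * hyp (u ^ 2 * (3 + u) / 4) := by
  have dom : ∀ x ∈ Set.Ioo (-3 : ℝ) (-2), x ∈ ovalDom (-1) := fun x hx =>
    ⟨hx.1, by linarith [hx.2], by nlinarith [hx.1, hx.2], by
      have h1 : 0 < -x := by linarith [hx.2]
      have h2 : 0 < -(x + 2) := by linarith [hx.2]
      have : 0 < (-x) ^ 3 * -(x + 2) := by positivity
      nlinarith⟩
  have hs : ∀ x ∈ Set.Ioo (-3 : ℝ) (-2), 0 < x ^ 2 * (3 + x) / 4 ∧ x ^ 2 * (3 + x) / 4 < 1 := by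
    intro x ⟨hx0, hx1⟩
    have h3 : 0 < 3 + x := by linarith
    have h2 : 0 < -x := by linarith
    refine ⟨by have : 0 < x ^ 2 := by nlinarith
               positivity, ?_⟩
    have : 0 < (1 - x) * (-(x + 2)) ^ 2 :=
      mul_pos (by linarith) (pow_pos (by linarith) 2)
    nlinarith
  have hτ := hasDerivAt_paramS
  have e0 : ovalRad (-3) = 0 := by simp [ovalRad]
  have e3 : (-1 : ℝ) * (3 / 2 * (3 - (-3) ^ 2)) = 3 ^ 2 := by norm_num
  have s9 : √((3 : ℝ) ^ 2) = 3 := Real.sqrt_sq (by norm_num)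
  have lK : Tendsto (ovalK (-1)) (𝓝[>] (-3)) (𝓝 (2 * Real.pi / 3)) := by
    have := (continuousAt_ovalK (σ := -1) e0 (by norm_num)).continuousWithinAt (s := Set.Ioi (-3))
    rwa [ContinuousWithinAt, ovalK_of_ovalRad_eq_zero e0, e3, s9, ← div_eq_mul_inv] at this
  have lL : Tendsto (ovalL (-1)) (𝓝[>] (-3)) (𝓝 (2 * Real.pi * 3)) := by
    have := (continuous_ovalL (-1)).continuousAt.continuousWithinAt (x := (-3 : ℝ))
      (s := Set.Ioi (-3))
    rwa [ContinuousWithinAt, ovalL_of_ovalRad_eq_zero e0, e3, s9] at this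
  have lτ : Tendsto (fun x : ℝ => x ^ 2 * (3 + x) / 4) (𝓝[>] (-3)) (𝓝 0) := by
    have : ContinuousAt (fun x : ℝ => x ^ 2 * (3 + x) / 4) (-3) := by fun_prop
    have := this.continuousWithinAt (s := Set.Ioi (-3))
    rw [ContinuousWithinAt] at this
    norm_num at this
    exact this
  have lp : Tendsto (fun x : ℝ => x ^ 2 * (x + 2)) (𝓝[>] (-3)) (𝓝 (-9)) := by
    have : ContinuousAt (fun x : ℝ => x ^ 2 * (x + 2)) (-3) := by fun_prop
    have := this.continuousWithinAt (s := Set.Ioi (-3))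
    rw [ContinuousWithinAt] at this
    norm_num at this
    exact this
  refine eq_mul_of_flux_tendsto_zero (Φ := ovalFlux (-1)) (F := 𝓝[>] (-3))
    (G := fun u => hyp (u ^ 2 * (3 + u) / 4)) (H := fun u => hypFlux (u ^ 2 * (3 + u) / 4))
    (M := fun u => u * (u + 2) * ((1 - u) * (3 + u)) / 12) (ρ := fun u => u * (u + 2) / 6)
    (by norm_num) (Or.inl rfl) ?_ ?_ (fun x hx => hasDerivAt_ovalK' (by norm_num) (dom x hx))
    (fun x hx => hasDerivAt_ovalFlux (by norm_num) (dom x hx)) ?_ ?_ lK ?_ ?_ ?_ ⟨h0, h1⟩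
  · intro x ⟨hx0, hx1⟩
    have h1 : 1 - x ≠ 0 := by linarith
    have h2 : x + 2 ≠ 0 := by linarith
    have h3 : 3 + x ≠ 0 := by linarith
    have h4 : x ≠ 0 := by linarith
    positivity
  · intro x hx
    have := one_le_hyp (s := x ^ 2 * (3 + x) / 4) (hs x hx).1.le (hs x hx).2
    exact (lt_of_lt_of_le one_pos this).ne'
  · intro x hx
    refine ((hasDerivAt_hyp (hs x hx).1 (hs x hx).2).comp x (hτ x)).congr_deriv ?_
    obtain ⟨hx0, hx1⟩ := hx
    have h1 : 1 - x ≠ 0 := by linarith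
    have h2 : x + 2 ≠ 0 := by linarith
    have h3 : 3 + x ≠ 0 := by linarith
    have h4 : x ≠ 0 := by linarith
    have e1 : 1 - x ^ 2 * (3 + x) / 4 = (1 - x) * (x + 2) ^ 2 / 4 := by ring
    rw [e1]
    field_simp
    ring
  · intro x hx
    refine ((hasDerivAt_hypFlux (s := x ^ 2 * (3 + x) / 4)
      (by rw [abs_lt]; constructor <;> linarith [(hs x hx).1, (hs x hx).2])).comp x
      (hτ x)).congr_deriv ?_
    ring
  · have := ((lp.mul lK).sub (lL.const_mul (-1))).div_const 12
    have e : (-9 * (2 * Real.pi / 3) - -1 * (2 * Real.pi * 3)) / 12 = 0 := by ring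
    rwa [e] at this
  · have := (continuousAt_hyp (s := 0) (by simp)).tendsto.comp lτ
    rwa [hyp_zero] at this
  · have := (continuousAt_hypFlux (s := 0) (by simp)).tendsto.comp lτ
    rwa [hypFlux_zero] at this

/-! ### The oval integrals as hypergeometric functions -/

open EllipticPeriods in
/-- The difference between the root `c = 3 - u²` and the point with parameter `θ` on the segment
between the other two roots `a` and `b`. -/
theorem sub_ovalX_eq {a b c s u : ℝ} (hab : a < b) (hsum : a + b + c = 0)
    (hpairs : 4 * (a * b + a * c + b * c) = -g₂ s) (hc : c = 3 - u ^ 2)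
    (hs : u ^ 2 * (3 + u) / 4 = s) (θ : ℝ) :
    c - ovalX a b θ = 3 / 2 * (3 - u ^ 2) + √(ovalRad u) * Real.cos θ := by
  have hrad : √(ovalRad u) = (b - a) / 2 := by
    have : ovalRad u = ((b - a) / 2) ^ 2 := by
      unfold g₂ at hpairs
      unfold ovalRad
      have hb : b = -a - (3 - u ^ 2) := by linarith
      subst hb hc hs
      linear_combination (1 / 4) * hpairs
    rw [this, Real.sqrt_sq (by linarith)]
  rw [hrad, ← hc]
  unfold ovalX
  linear_combination (-1 / 2) * hsum

open EllipticPeriods in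
/-- `x = 3 - u²` is the largest or the smallest root of the cubic if its derivative is positive
there. -/
theorem eq_root_or {s u : ℝ} (h0 : 0 < s) (h1 : s < 1) (hs : u ^ 2 * (3 + u) / 4 = s)
    (hu : 0 < u ^ 3 * (u + 2)) : 3 - u ^ 2 = root₁ s ∨ 3 - u ^ 2 = root₃ s := by
  have e1 := root_sum s
  have e2 := root_pairs h1.le
  have e3 := root_prod h0.le h1.le
  have l1 := root₁_lt_root₂ h0 h1
  have l2 := root₂_lt_root₃ h0 h1
  have hprod : (3 - u ^ 2 - root₁ s) * (3 - u ^ 2 - root₂ s) * (3 - u ^ 2 - root₃ s) = 0 := by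
    have : 4 * (3 - u ^ 2) ^ 3 - g₂ s * (3 - u ^ 2) - g₃ s = 0 := by
      unfold g₂ g₃; rw [← hs]; ring
    linear_combination this / 4 - (3 - u ^ 2) ^ 2 * e1 + (3 - u ^ 2) / 4 * e2 - e3 / 4
  have hder : 4 * ((3 - u ^ 2 - root₁ s) * (3 - u ^ 2 - root₂ s) +
      (3 - u ^ 2 - root₁ s) * (3 - u ^ 2 - root₃ s) +
      (3 - u ^ 2 - root₂ s) * (3 - u ^ 2 - root₃ s)) = 12 * (u ^ 3 * (u + 2)) := by
    have : 12 * (3 - u ^ 2) ^ 2 - g₂ s = 12 * (u ^ 3 * (u + 2)) := by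
      unfold g₂; rw [← hs]; ring
    linear_combination this - 8 * (3 - u ^ 2) * e1 + e2
  rcases mul_eq_zero.1 hprod with h | h
  · rcases mul_eq_zero.1 h with h | h
    · left; linarith
    · exfalso
      rw [h] at hder
      have : 3 - u ^ 2 = root₂ s := by linarith
      rw [this] at hder
      nlinarith [mul_pos (sub_pos.2 l1) (sub_pos.2 l2)]
  · right; linarith

open EllipticPeriods in
/-- The integral over the oval vanishing at `s = 1` is a hypergeometric function of `1 - s`. -/
theorem integral_oval_one {s : ℝ} (h0 : 0 < s) (h1 : s < 1) :
    ∫ θ in (0 : ℝ)..2 * Real.pi, (√|root₃ s - ovalX (root₁ s) (root₂ s) θ|)⁻¹ =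
      2 * Real.pi / √3 * hyp (1 - s) := by
  have hcont : ContinuousOn (fun u : ℝ => u ^ 2 * (3 + u) / 4) (Set.Icc 0 1) := by fun_prop
  obtain ⟨u, ⟨hu0, hu1⟩, hs⟩ := intermediate_value_Ioo zero_le_one hcont
    (show s ∈ Set.Ioo _ _ by norm_num; exact ⟨h0, h1⟩)
  have l1 := root₁_lt_root₂ h0 h1
  have l2 := root₂_lt_root₃ h0 h1
  have e1 := root_sum s
  have hr : root₃ s = 3 - u ^ 2 := by
    rcases eq_root_or h0 h1 hs (by positivity) with h | h
    · exfalso; nlinarith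
    · exact h.symm
  have hdom : u ∈ ovalDom 1 := ⟨by linarith, hu1, by nlinarith, by positivity⟩
  have hk := ovalK_one hu0 hu1
  rw [show u ^ 2 * (3 + u) / 4 = s from hs] at hk
  rw [← hk]
  unfold ovalK
  congr 1
  funext θ
  have e := sub_ovalX_eq (c := root₃ s) l1 e1
    (by rw [← root_pairs h1.le]) hr hs θ
  have e' : root₃ s - ovalX (root₁ s) (root₂ s) θ = ovalDist 1 u θ := by
    rw [e]; unfold ovalDist; ring
  rw [e', abs_of_pos (ovalDist_pos (by norm_num) hdom θ)]

open EllipticPeriods in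
/-- The integral over the oval vanishing at `s = 0` is a hypergeometric function of `s`. -/
theorem integral_oval_zero {s : ℝ} (h0 : 0 < s) (h1 : s < 1) :
    ∫ θ in (0 : ℝ)..2 * Real.pi, (√|root₁ s - ovalX (root₂ s) (root₃ s) θ|)⁻¹ =
      2 * Real.pi / 3 * hyp s := by
  have hcont : ContinuousOn (fun u : ℝ => u ^ 2 * (3 + u) / 4) (Set.Icc (-3) (-2)) := by fun_prop
  obtain ⟨u, ⟨hu0, hu1⟩, hs⟩ := intermediate_value_Ioo (by norm_num) hcont
    (show s ∈ Set.Ioo _ _ by norm_num; exact ⟨h0, h1⟩)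
  have l1 := root₁_lt_root₂ h0 h1
  have l2 := root₂_lt_root₃ h0 h1
  have e1 := root_sum s
  have hpos : 0 < u ^ 3 * (u + 2) := by
    have h1 : 0 < -u := by linarith
    have h2 : 0 < -(u + 2) := by linarith
    have : 0 < (-u) ^ 3 * -(u + 2) := by positivity
    nlinarith
  have hr : root₁ s = 3 - u ^ 2 := by
    rcases eq_root_or h0 h1 hs hpos with h | h
    · exact h.symm
    · exfalso; nlinarith
  have hdom : u ∈ ovalDom (-1) := ⟨hu0, by linarith, by nlinarith, hpos⟩
  have hk := ovalK_neg_one hu0 hu1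
  rw [show u ^ 2 * (3 + u) / 4 = s from hs] at hk
  rw [← hk]
  unfold ovalK
  congr 1
  funext θ
  have e := sub_ovalX_eq (c := root₁ s) l2 (by linarith)
    (by rw [← root_pairs h1.le]; ring) hr hs θ
  have e' : root₁ s - ovalX (root₂ s) (root₃ s) θ = -ovalDist (-1) u θ := by
    rw [e]; unfold ovalDist; ring
  rw [e', abs_neg, abs_of_pos (ovalDist_pos (by norm_num) hdom θ)]

/-! ### The periods of the thimbles -/

open EllipticPeriods in
/-- The pull-back of `t^(j-1) dt ∧ dx/y` to a thimble swept out by ovals. -/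
theorem pullback_thimble_oval {l j : ℕ} {P : ℝ} {x₀ : ℂ} {δ : VanishingCycle P x₀} {a b c : ℝ}
    {ε : ℂ} (hε : ε ≠ 0) {t θ : ℝ} (hab : a < b) (hc : b < c ∨ c < a)
    (hδ : ∀ θ, δ.toFun (t ^ l) θ = oval a b c ε θ) (hs : Real.sin θ ≠ 0) :
    pullback j (thimble l δ) (t, θ) =
      ε⁻¹ * ((√3 * (t ^ (j - 1) * (√|c - ovalX a b θ|)⁻¹) : ℝ) : ℂ) := by
  have hx : HasDerivAt (fun θ : ℝ => ((ovalX a b θ : ℝ) : ℂ))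
      (((b - a) / 2 * Real.sin θ : ℝ) : ℂ) θ := by
    refine HasDerivAt.ofReal_comp ?_
    unfold ovalX
    refine (((Real.hasDerivAt_cos θ).const_mul ((b - a) / 2)).const_sub _).congr_deriv ?_
    ring
  have ht : HasDerivAt (fun u : ℝ => (u : ℂ)) 1 t := by
    simpa using (hasDerivAt_id t).ofReal_comp
  have hne := abs_pos.2 (oval_ne hab hc θ)
  have hba : (b - a) / 2 ≠ 0 := by
    have : 0 < b - a := by linarith
    positivity
  simp only [pullback, thimble, hδ, ht.deriv, deriv_const, zero_mul, sub_zero, one_mul]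
  simp only [oval]
  rw [hx.deriv, Real.sqrt_div' _ (by norm_num : (0 : ℝ) ≤ 3)]
  have h3 : (√3 : ℝ) ≠ 0 := by positivity
  have hq : √|c - ovalX a b θ| ≠ 0 := (Real.sqrt_pos.2 hne).ne'
  have e1 : (((b - a) / 2 * Real.sin θ : ℝ) : ℂ) ≠ 0 := by
    exact_mod_cast mul_ne_zero hba hs
  have e2 : ((√|c - ovalX a b θ| : ℝ) : ℂ) ≠ 0 := by exact_mod_cast hq
  have e3 : ((√3 : ℝ) : ℂ) ≠ 0 := by exact_mod_cast h3
  rw [Complex.ofReal_mul ((b - a) / 2 * Real.sin θ)]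
  generalize (((b - a) / 2 * Real.sin θ : ℝ) : ℂ) = w at e1 ⊢
  push_cast
  field_simp

open MeasureTheory

open EllipticPeriods in
/-- By Fubini, the period of a thimble swept out by ovals is a simple integral of the oval
integrals. -/
theorem period_thimble_oval {l j : ℕ} (hl : l ≠ 0) {P : ℝ} {x₀ : ℂ} {δ : VanishingCycle P x₀}
    {a b c φ : ℝ → ℝ} {ε : ℂ} (hε : ε ≠ 0) (hab : ∀ s ∈ Set.Ioo (0 : ℝ) 1, a s < b s)
    (hc : ∀ s ∈ Set.Ioo (0 : ℝ) 1, b s < c s ∨ c s < a s)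
    (ca : ContinuousOn a (Set.Ioo 0 1)) (cb : ContinuousOn b (Set.Ioo 0 1))
    (cc : ContinuousOn c (Set.Ioo 0 1))
    (hδ : ∀ s ∈ Set.Ioo (0 : ℝ) 1, ∀ θ, δ.toFun s θ = oval (a s) (b s) (c s) ε θ)
    (hφ : ∀ s ∈ Set.Ioo (0 : ℝ) 1,
      ∫ θ in (0 : ℝ)..2 * Real.pi, (√|c s - ovalX (a s) (b s) θ|)⁻¹ = φ s)
    (hint : IntegrableOn (fun t => t ^ (j - 1) * φ (t ^ l)) (Set.Ioo 0 1)) :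
    PeriodConverges j (thimble l δ) ∧ period j (thimble l δ) =
      ε⁻¹ * ((√3 * ∫ t in Set.Ioo (0 : ℝ) 1, t ^ (j - 1) * φ (t ^ l) : ℝ) : ℂ) := by
  have hpi := Real.pi_pos
  have hpow : ∀ t ∈ Set.Ioo (0 : ℝ) 1, t ^ l ∈ Set.Ioo (0 : ℝ) 1 := fun t ht =>
    ⟨pow_pos ht.1 l, pow_lt_one₀ ht.1.le ht.2 hl⟩
  have hpowc : ContinuousOn (fun p : ℝ × ℝ => p.1 ^ l) (Set.Ioo (0 : ℝ) 1 ×ˢ Set.univ) := by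
    fun_prop
  have hmap : Set.MapsTo (fun p : ℝ × ℝ => p.1 ^ l) (Set.Ioo (0 : ℝ) 1 ×ˢ Set.univ)
      (Set.Ioo 0 1) := fun p hp => hpow _ hp.1
  have ca' := ca.comp hpowc hmap
  have cb' := cb.comp hpowc hmap
  have cc' := cc.comp hpowc hmap
  simp only [Function.comp_def] at ca' cb' cc'
  set κ : ℝ × ℝ → ℝ := fun p =>
    p.1 ^ (j - 1) * (√|c (p.1 ^ l) - ovalX (a (p.1 ^ l)) (b (p.1 ^ l)) p.2|)⁻¹ with hκ
  have hκc : ContinuousOn κ (Set.Ioo (0 : ℝ) 1 ×ˢ Set.univ) := by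
    refine ContinuousOn.mul (by fun_prop) (ContinuousOn.inv₀ ?_ fun p hp => ?_)
    · unfold ovalX; fun_prop
    · exact (Real.sqrt_pos.2 (abs_pos.2 (oval_ne (hab _ (hmap hp)) (hc _ (hmap hp)) _))).ne'
  set μ : Measure ℝ := volume.restrict (Set.Ioo (0 : ℝ) 1)
  set ν : Measure ℝ := volume.restrict (Set.Ioo (0 : ℝ) (2 * Real.pi))
  have hμν : (volume : Measure (ℝ × ℝ)).restrict rectangle = μ.prod ν := by
    rw [Measure.prod_restrict]; rfl
  have hκm : AEStronglyMeasurable κ (μ.prod ν) := by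
    rw [← hμν]
    exact (hκc.mono (Set.prod_mono_right (Set.subset_univ _))).aestronglyMeasurable
      (measurableSet_Ioo.prod measurableSet_Ioo)
  have slice : ∀ t ∈ Set.Ioo (0 : ℝ) 1, Continuous fun θ => κ (t, θ) := fun t ht =>
    hκc.comp_continuous (by fun_prop) fun θ => ⟨ht, trivial⟩
  have hnu (f : ℝ → ℝ) : ∫ θ, f θ ∂ν = ∫ θ in (0 : ℝ)..2 * Real.pi, f θ := by
    rw [intervalIntegral.integral_of_le (by positivity), integral_Ioc_eq_integral_Ioo]
  have inner : ∀ t ∈ Set.Ioo (0 : ℝ) 1, ∫ θ, κ (t, θ) ∂ν = t ^ (j - 1) * φ (t ^ l) := by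
    intro t ht
    rw [hnu, ← hφ _ (hpow t ht), ← intervalIntegral.integral_const_mul]
  have hκi : Integrable κ (μ.prod ν) := by
    rw [integrable_prod_iff hκm]
    constructor
    · filter_upwards [ae_restrict_mem measurableSet_Ioo] with t ht
      exact ((slice t ht).integrableOn_Icc (a := 0) (b := 2 * Real.pi)).mono_set
        Set.Ioo_subset_Icc_self
    · refine hint.congr ?_
      filter_upwards [ae_restrict_mem measurableSet_Ioo] with t ht
      rw [← inner t ht]
      refine integral_congr_ae (Eventually.of_forall fun θ => ?_)
      have h0 := ht.1
      have : 0 ≤ κ (t, θ) := by simp only [hκ]; positivity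
      exact (abs_of_nonneg this).symm
  have hκint : ∫ p, κ p ∂(μ.prod ν) = ∫ t in Set.Ioo (0 : ℝ) 1, t ^ (j - 1) * φ (t ^ l) := by
    rw [integral_prod _ hκi]
    exact setIntegral_congr_fun measurableSet_Ioo inner
  have hae : (fun p => ε⁻¹ * ((√3 * κ p : ℝ) : ℂ)) =ᵐ[μ.prod ν] pullback j (thimble l δ) := by
    -- at `θ = π` the oval crosses `y = 0`, where the formula for the pull-back does not apply
    have hnull : ∀ᵐ p ∂(μ.prod ν), p.2 ≠ Real.pi := by
      rw [← hμν]
      refine ae_restrict_of_ae ?_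
      have : {p : ℝ × ℝ | ¬ p.2 ≠ Real.pi} = Set.univ ×ˢ {Real.pi} := by ext; simp
      rw [ae_iff, this, Measure.volume_eq_prod, Measure.prod_prod]
      simp
    have hmem : ∀ᵐ p ∂(μ.prod ν), p ∈ rectangle := by
      rw [← hμν]
      exact ae_restrict_mem (measurableSet_Ioo.prod measurableSet_Ioo)
    filter_upwards [hnull, hmem] with p hp hr
    obtain ⟨t, θ⟩ := p
    have ht := hpow t hr.1
    refine (pullback_thimble_oval hε (hab _ ht) (hc _ ht) (hδ _ ht) fun hs => ?_).symm
    have h1 : 0 < θ := hr.2.1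
    have h2 : θ < 2 * Real.pi := hr.2.2
    rcases lt_trichotomy θ Real.pi with h | h | h
    · exact (Real.sin_pos_of_pos_of_lt_pi h1 h).ne' hs
    · exact hp h
    · have := Real.sin_pos_of_pos_of_lt_pi (sub_pos.2 h) (by linarith)
      rw [Real.sin_sub_pi] at this
      linarith
  constructor
  · unfold PeriodConverges IntegrableOn
    rw [hμν]
    exact ((hκi.const_mul √3).ofReal.const_mul ε⁻¹).congr hae
  · unfold period
    rw [hμν, ← integral_congr_ae hae, integral_const_mul, integral_complex_ofReal,
      integral_const_mul, hκint]

open EllipticPeriods in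
/-- The orientation of the cycle enters through the factor `i = (-i)⁻¹`. -/
theorem period_Δ {l j : ℕ} (hl : l ≠ 0)
    (hint : IntegrableOn (fun t : ℝ => t ^ (j - 1) * hyp (1 - t ^ l)) (Set.Ioo 0 1)) :
    PeriodConverges j (Δ l) ∧ period j (Δ l) = Complex.I *
      ((2 * Real.pi * ∫ t in Set.Ioo (0 : ℝ) 1, t ^ (j - 1) * hyp (1 - t ^ l) : ℝ) : ℂ) := by
  have h3 : √(3 : ℝ) ≠ 0 := by positivity
  have := period_thimble_oval (j := j) (δ := δ₁) (φ := fun s => 2 * Real.pi / √3 * hyp (1 - s))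
    hl (neg_ne_zero.2 Complex.I_ne_zero) (fun s hs => root₁_lt_root₂ hs.1 hs.2)
    (fun s hs => Or.inl (root₂_lt_root₃ hs.1 hs.2)) (continuousOn_root₁.mono fun s hs => hs.2.le)
    (continuousOn_root₂.mono fun s hs => hs.2.le) (continuousOn_root₃.mono fun s hs => hs.2.le)
    (fun s _ θ => rfl) (fun s hs => integral_oval_one hs.1 hs.2) (by
      refine (hint.const_mul (2 * Real.pi / √3)).congr (Eventually.of_forall fun t => ?_)
      ring)
  refine ⟨this.1, ?_⟩
  have e : √3 * ∫ t in Set.Ioo (0 : ℝ) 1, t ^ (j - 1) * (2 * Real.pi / √3 * hyp (1 - t ^ l)) =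
      2 * Real.pi * ∫ t in Set.Ioo (0 : ℝ) 1, t ^ (j - 1) * hyp (1 - t ^ l) := by
    rw [← integral_const_mul, ← integral_const_mul]
    congr 1; funext t; field_simp
  rw [Δ, this.2, e]
  congr 1
  rw [inv_neg, Complex.inv_I, neg_neg]

open EllipticPeriods in
/-- The orientation of the cycle enters through the sign. -/
theorem period_Γ {l j : ℕ} (hl : l ≠ 0)
    (hint : IntegrableOn (fun t : ℝ => t ^ (j - 1) * hyp (t ^ l)) (Set.Ioo 0 1)) :
    PeriodConverges j (Γ l) ∧ period j (Γ l) =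
      ((-(2 * Real.pi / √3) * ∫ t in Set.Ioo (0 : ℝ) 1, t ^ (j - 1) * hyp (t ^ l) : ℝ) : ℂ) := by
  have h3 : √(3 : ℝ) ≠ 0 := by positivity
  have s3 : √(3 : ℝ) ^ 2 = 3 := Real.sq_sqrt (by norm_num)
  have := period_thimble_oval (j := j) (δ := δ₀) (φ := fun s => 2 * Real.pi / 3 * hyp s)
    hl (neg_ne_zero.2 one_ne_zero) (fun s hs => root₂_lt_root₃ hs.1 hs.2)
    (fun s hs => Or.inr (root₁_lt_root₂ hs.1 hs.2)) (continuousOn_root₂.mono fun s hs => hs.2.le)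
    (continuousOn_root₃.mono fun s hs => hs.2.le) (continuousOn_root₁.mono fun s hs => hs.2.le)
    (fun s _ θ => rfl) (fun s hs => integral_oval_zero hs.1 hs.2) (by
      refine (hint.const_mul (2 * Real.pi / 3)).congr (Eventually.of_forall fun t => ?_)
      ring)
  refine ⟨this.1, ?_⟩
  have e : √3 * ∫ t in Set.Ioo (0 : ℝ) 1, t ^ (j - 1) * (2 * Real.pi / 3 * hyp (t ^ l)) =
      2 * Real.pi / √3 * ∫ t in Set.Ioo (0 : ℝ) 1, t ^ (j - 1) * hyp (t ^ l) := by
    rw [← integral_const_mul, ← integral_const_mul]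
    congr 1; funext t; field_simp; rw [s3]; ring
  rw [Γ, this.2, e]
  push_cast
  rw [show (-1 : ℂ)⁻¹ = -1 by norm_num]
  ring

/-! ### Rational powers of formal power series -/

open PowerSeries in
theorem choose_succ_mul (r : ℚ) (k : ℕ) :
    Ring.choose r (k + 1) * ((k : ℚ) + 1) = Ring.choose r k * (r - k) := by
  rw [Ring.choose_eq_smul, Ring.choose_eq_smul, descPochhammer_succ_right, Polynomial.smeval_mul,
    Polynomial.smeval_sub, Polynomial.smeval_X, Polynomial.smeval_natCast, Nat.factorial_succ]
  have : (k.factorial : ℚ) ≠ 0 := by exact_mod_cast k.factorial_ne_zero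
  have hk : (k : ℚ) + 1 ≠ 0 := by positivity
  push_cast
  simp only [smul_eq_mul, pow_one, pow_zero, nsmul_eq_mul, mul_one]
  field_simp

/-- For `|r| ≤ 1` the factors `(r - k) / (k + 1)` have absolute value at most `1`. -/
theorem abs_choose_le_one {r : ℚ} (hr : |r| ≤ 1) (k : ℕ) : |Ring.choose r k| ≤ 1 := by
  induction k with
  | zero => simp
  | succ k ih =>
    have h := choose_succ_mul r k
    have hk : (0 : ℚ) < (k : ℚ) + 1 := by positivity
    have h2 : |Ring.choose r (k + 1)| * ((k : ℚ) + 1) = |Ring.choose r k| * |r - k| := by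
      rw [← abs_mul, ← h, abs_mul, abs_of_pos hk]
    have h3 : |r - k| ≤ (k : ℚ) + 1 := by
      have := abs_sub r (k : ℚ)
      rw [abs_of_nonneg (Nat.cast_nonneg k : (0 : ℚ) ≤ k)] at this
      linarith
    have h4 : |Ring.choose r k| * |r - k| ≤ 1 * ((k : ℚ) + 1) :=
      mul_le_mul ih h3 (abs_nonneg _) zero_le_one
    rw [← h2] at h4
    exact le_of_mul_le_mul_right h4 hk

open PowerSeries in
/-- The differential equation `f (fʳ)' = r f' fʳ`. -/
theorem mul_derivative_ratPow {f : ℚ⟦X⟧} (hf : constantCoeff f = 1) (r : ℚ) :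
    f * d⁄dX ℚ (EllipticPeriods.ratPow f r) = C r * d⁄dX ℚ f * EllipticPeriods.ratPow f r := by
  have hs : HasSubst (f - 1) := HasSubst.of_constantCoeff_zero' (by simp [hf])
  have hB : (1 + X) * d⁄dX ℚ (PowerSeries.binomialSeries ℚ r) =
      C r * PowerSeries.binomialSeries ℚ r := by
    ext n
    rw [add_mul, one_mul, map_add, coeff_C_mul, coeff_derivative]
    cases n with
    | zero =>
      simp [binomialSeries_coeff]
    | succ n =>
      rw [coeff_succ_X_mul, coeff_derivative]
      simp only [binomialSeries_coeff, smul_eq_mul, mul_one]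
      have := choose_succ_mul r (n + 1)
      push_cast at this ⊢
      linear_combination this
  have hB' := congrArg (fun g : ℚ⟦X⟧ => PowerSeries.subst (f - 1) g) hB
  simp only [subst_mul hs, subst_add hs, subst_X hs, subst_C] at hB'
  have h1 : (1 : ℚ⟦X⟧).subst (f - 1) = (1 : ℚ⟦X⟧) := by
    rw [← coe_substAlgHom hs, map_one]
  have hC : (MvPowerSeries.C r : ℚ⟦X⟧) = C r := rfl
  rw [h1, hC, add_sub_cancel] at hB'
  unfold EllipticPeriods.ratPow
  rw [derivative_subst hs, map_sub, Derivation.map_one_eq_zero, sub_zero]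
  linear_combination (d⁄dX ℚ f) * hB'

open PowerSeries in
theorem constantCoeff_ratPow {f : ℚ⟦X⟧} (hf : constantCoeff f = 1) (r : ℚ) :
    constantCoeff (EllipticPeriods.ratPow f r) = 1 := by
  have hs : HasSubst (f - 1) := HasSubst.of_constantCoeff_zero' (by simp [hf])
  have hz : constantCoeff (f - 1) = 0 := by simp [hf]
  rw [← coeff_zero_eq_constantCoeff_apply]
  unfold EllipticPeriods.ratPow
  rw [coeff_subst' hs, finsum_eq_single _ 0]
  · simp
  · intro k hk
    simp [hz, hk]

open PowerSeries in
/-- The differential equation and the constant coefficient `1` determine the power. -/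
theorem eq_of_mul_derivative_eq {w G H : ℚ⟦X⟧} {r : ℚ} (hw : w ≠ 0)
    (hG : w * d⁄dX ℚ G = C r * d⁄dX ℚ w * G) (hH : w * d⁄dX ℚ H = C r * d⁄dX ℚ w * H)
    (hG0 : constantCoeff G = 1) (hH0 : constantCoeff H = 1) : G = H := by
  have hH1 : H * H⁻¹ = 1 := PowerSeries.mul_inv_cancel _ (by simp [hH0])
  have key : d⁄dX ℚ (G * H⁻¹) = d⁄dX ℚ (1 : ℚ⟦X⟧) := by
    have e : d⁄dX ℚ (G * H⁻¹) = G * (-H⁻¹ ^ 2 * d⁄dX ℚ H) + H⁻¹ * d⁄dX ℚ G := by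
      rw [Derivation.leibniz, derivative_inv', smul_eq_mul, smul_eq_mul]
    rw [e, Derivation.map_one_eq_zero]
    refine (mul_eq_zero.1 ?_).resolve_left hw
    linear_combination (H⁻¹) * hG - G * H⁻¹ ^ 2 * hH - (C r * d⁄dX ℚ w * G * H⁻¹) * hH1
  have := derivative.ext key (by simp [hG0, hH0])
  calc G = G * (H * H⁻¹) := by rw [hH1, mul_one]
    _ = (G * H⁻¹) * H := by ring
    _ = H := by rw [this, one_mul]

open PowerSeries in
/-- Both sides solve the differential equation of the power of `f * g`. -/
theorem ratPow_mul {f g : ℚ⟦X⟧} (hf : constantCoeff f = 1) (hg : constantCoeff g = 1) (r : ℚ) :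
    EllipticPeriods.ratPow (f * g) r =
      EllipticPeriods.ratPow f r * EllipticPeriods.ratPow g r := by
  have hfg : constantCoeff (f * g) = 1 := by simp [hf, hg]
  refine eq_of_mul_derivative_eq (w := f * g) (r := r) ?_ (mul_derivative_ratPow hfg r) ?_
    (constantCoeff_ratPow hfg r) (by simp [constantCoeff_ratPow, hf, hg])
  · rintro h; simp [h] at hfg
  · simp only [Derivation.leibniz, smul_eq_mul]
    linear_combination (EllipticPeriods.ratPow g r * g) * mul_derivative_ratPow hf r +
      (EllipticPeriods.ratPow f r * f) * mul_derivative_ratPow hg r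

open PowerSeries in
theorem ratPow_inv {f : ℚ⟦X⟧} (hf : constantCoeff f = 1) (r : ℚ) :
    EllipticPeriods.ratPow f⁻¹ r = EllipticPeriods.ratPow f (-r) := by
  have hf0 : f ≠ 0 := by rintro rfl; simp at hf
  have hi : constantCoeff f⁻¹ = 1 := by simp [hf]
  have hff : f * f⁻¹ = 1 := PowerSeries.mul_inv_cancel _ (by simp [hf])
  refine eq_of_mul_derivative_eq (w := f) (r := -r) hf0 ?_ (mul_derivative_ratPow hf (-r))
    (constantCoeff_ratPow hi r) (constantCoeff_ratPow hf (-r))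
  have h := mul_derivative_ratPow hi r
  rw [derivative_inv'] at h
  rw [map_neg]
  linear_combination (f ^ 2) * h - (f * d⁄dX ℚ (EllipticPeriods.ratPow f⁻¹ r)) * hff -
    (C r * d⁄dX ℚ f * EllipticPeriods.ratPow f⁻¹ r) * (f * f⁻¹ + 1) * hff

open PowerSeries in
/-- The power of a quotient as a product of powers. The binomial series converges for `f` and `g` on
a larger disc than for the quotient, as the weighted norm of `f / g - 1` can exceed `1` where those
of `f - 1` and `g - 1` do not. -/
theorem ratPow_div {f g : ℚ⟦X⟧} (hf : constantCoeff f = 1) (hg : constantCoeff g = 1) (r : ℚ) :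
    EllipticPeriods.ratPow (f * g⁻¹) r =
      EllipticPeriods.ratPow f r * EllipticPeriods.ratPow g (-r) := by
  rw [ratPow_mul hf (by simp [hg]), ratPow_inv hg]

open PowerSeries in
theorem coeff_mul_one (f g : ℚ⟦X⟧) :
    coeff 1 (f * g) = coeff 0 f * coeff 1 g + coeff 1 f * coeff 0 g := by
  rw [coeff_mul, Finset.Nat.sum_antidiagonal_eq_sum_range_succ_mk]
  simp [Finset.sum_range_succ]

open PowerSeries in
theorem coeff_mul_two (f g : ℚ⟦X⟧) : coeff 2 (f * g) =
    coeff 0 f * coeff 2 g + coeff 1 f * coeff 1 g + coeff 2 f * coeff 0 g := by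
  rw [coeff_mul, Finset.Nat.sum_antidiagonal_eq_sum_range_succ_mk]
  simp [Finset.sum_range_succ]

open PowerSeries in
theorem coeff_ratPow_one {f : ℚ⟦X⟧} (hf : constantCoeff f = 1) (r : ℚ) :
    coeff 1 (EllipticPeriods.ratPow f r) = r * coeff 1 f := by
  have h := congrArg (coeff 0) (mul_derivative_ratPow hf r)
  have hG := constantCoeff_ratPow hf r
  have hd (g : ℚ⟦X⟧) : constantCoeff (d⁄dX ℚ g) = coeff 1 g := by
    rw [← coeff_zero_eq_constantCoeff_apply, coeff_derivative]; simp
  simpa [hf, hG, hd] using h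

open PowerSeries in
theorem coeff_ratPow_two {f : ℚ⟦X⟧} (hf : constantCoeff f = 1) (r : ℚ) :
    coeff 2 (EllipticPeriods.ratPow f r) =
      r * coeff 2 f + r * (r - 1) / 2 * coeff 1 f ^ 2 := by
  have h := congrArg (coeff 1) (mul_derivative_ratPow hf r)
  have hG := constantCoeff_ratPow hf r
  rw [mul_assoc, coeff_C_mul, coeff_mul_one, coeff_mul_one, coeff_derivative, coeff_derivative,
    coeff_derivative, coeff_derivative, coeff_zero_eq_constantCoeff_apply,
    coeff_zero_eq_constantCoeff_apply, hf, hG] at h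
  norm_num [coeff_ratPow_one hf] at h
  linarith

/-! ### Evaluation of formal power series -/

section Evaluation

open PowerSeries

/-- Absolute convergence of a formal power series on the closed disc of radius `ρ`. -/
def AbsConv (ρ : ℝ) (f : ℚ⟦X⟧) : Prop := Summable fun n => |((coeff n f : ℚ) : ℝ)| * ρ ^ n

/-- The weighted `ℓ¹` norm of a formal power series. -/
noncomputable def wnorm (ρ : ℝ) (f : ℚ⟦X⟧) : ℝ := ∑' n, |((coeff n f : ℚ) : ℝ)| * ρ ^ n

/-- The value of a formal power series at a real number. -/
noncomputable def evalAt (f : ℚ⟦X⟧) (x : ℝ) : ℝ := ∑' n, ((coeff n f : ℚ) : ℝ) * x ^ n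

theorem wnorm_nonneg {ρ : ℝ} (hρ : 0 ≤ ρ) (f : ℚ⟦X⟧) : 0 ≤ wnorm ρ f :=
  tsum_nonneg fun n => by positivity

theorem AbsConv.summable_abs {ρ x : ℝ} {f : ℚ⟦X⟧} (hf : AbsConv ρ f) (hx : |x| ≤ ρ) :
    Summable fun n => ‖((coeff n f : ℚ) : ℝ) * x ^ n‖ := by
  refine Summable.of_nonneg_of_le (fun n => norm_nonneg _) (fun n => ?_) hf
  rw [Real.norm_eq_abs, abs_mul, abs_pow]
  gcongr

theorem AbsConv.hasSum {ρ x : ℝ} {f : ℚ⟦X⟧} (hf : AbsConv ρ f) (hx : |x| ≤ ρ) :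
    HasSum (fun n => ((coeff n f : ℚ) : ℝ) * x ^ n) (evalAt f x) :=
  (hf.summable_abs hx).of_norm.hasSum

theorem coeff_mul_cast (f g : ℚ⟦X⟧) (n : ℕ) (x : ℝ) :
    ((coeff n (f * g) : ℚ) : ℝ) * x ^ n = ∑ kl ∈ Finset.HasAntidiagonal.antidiagonal n,
      (((coeff kl.1 f : ℚ) : ℝ) * x ^ kl.1) * (((coeff kl.2 g : ℚ) : ℝ) * x ^ kl.2) := by
  rw [coeff_mul]
  push_cast
  rw [Finset.sum_mul]
  refine Finset.sum_congr rfl fun kl hkl => ?_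
  rw [← Finset.HasAntidiagonal.mem_antidiagonal.1 hkl, pow_add]
  ring

theorem abs_coeff_mul_le {ρ : ℝ} (hρ : 0 ≤ ρ) (f g : ℚ⟦X⟧) (n : ℕ) :
    |((coeff n (f * g) : ℚ) : ℝ)| * ρ ^ n ≤ ∑ kl ∈ Finset.HasAntidiagonal.antidiagonal n,
      (|((coeff kl.1 f : ℚ) : ℝ)| * ρ ^ kl.1) * (|((coeff kl.2 g : ℚ) : ℝ)| * ρ ^ kl.2) := by
  have e : |((coeff n (f * g) : ℚ) : ℝ)| * ρ ^ n = |((coeff n (f * g) : ℚ) : ℝ) * ρ ^ n| := by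
    rw [abs_mul, abs_of_nonneg (pow_nonneg hρ n)]
  rw [e, coeff_mul_cast]
  refine (Finset.abs_sum_le_sum_abs _ _).trans (le_of_eq ?_)
  refine Finset.sum_congr rfl fun kl _ => ?_
  rw [abs_mul, abs_mul, abs_mul, abs_of_nonneg (pow_nonneg hρ kl.1),
    abs_of_nonneg (pow_nonneg hρ kl.2)]

theorem AbsConv.norm {ρ : ℝ} (hρ : 0 ≤ ρ) {f : ℚ⟦X⟧} (hf : AbsConv ρ f) :
    Summable fun n => ‖|((coeff n f : ℚ) : ℝ)| * ρ ^ n‖ :=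
  hf.congr fun n => (Real.norm_of_nonneg (by positivity)).symm

theorem AbsConv.mul {ρ : ℝ} (hρ : 0 ≤ ρ) {f g : ℚ⟦X⟧} (hf : AbsConv ρ f) (hg : AbsConv ρ g) :
    AbsConv ρ (f * g) := by
  have h := (summable_norm_sum_mul_antidiagonal_of_summable_norm (hf.norm hρ) (hg.norm hρ)).of_norm
  exact Summable.of_nonneg_of_le (fun n => by positivity) (abs_coeff_mul_le hρ f g) h

theorem wnorm_mul_le {ρ : ℝ} (hρ : 0 ≤ ρ) {f g : ℚ⟦X⟧} (hf : AbsConv ρ f) (hg : AbsConv ρ g) :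
    wnorm ρ (f * g) ≤ wnorm ρ f * wnorm ρ g := by
  have h := (summable_norm_sum_mul_antidiagonal_of_summable_norm (hf.norm hρ) (hg.norm hρ)).of_norm
  unfold wnorm
  rw [tsum_mul_tsum_eq_tsum_sum_antidiagonal_of_summable_norm (hf.norm hρ) (hg.norm hρ)]
  exact (hf.mul hρ hg).tsum_le_tsum (abs_coeff_mul_le hρ f g) h

theorem evalAt_mul {ρ x : ℝ} {f g : ℚ⟦X⟧} (hf : AbsConv ρ f) (hg : AbsConv ρ g) (hx : |x| ≤ ρ) :
    evalAt (f * g) x = evalAt f x * evalAt g x := by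
  unfold evalAt
  rw [tsum_mul_tsum_eq_tsum_sum_antidiagonal_of_summable_norm (hf.summable_abs hx)
    (hg.summable_abs hx)]
  exact tsum_congr fun n => coeff_mul_cast f g n x

theorem hasSum_coeff_one (x : ℝ) : HasSum (fun n => ((coeff n (1 : ℚ⟦X⟧) : ℚ) : ℝ) * x ^ n) 1 := by
  refine hasSum_of_eq (hasSum_ite_eq (0 : ℕ) (1 : ℝ)) (fun n => ?_) rfl
  rw [coeff_one]
  split_ifs with h
  · simp [h]
  · simp

theorem hasSum_abs_coeff_one (ρ : ℝ) :
    HasSum (fun n => |((coeff n (1 : ℚ⟦X⟧) : ℚ) : ℝ)| * ρ ^ n) 1 := by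
  refine hasSum_of_eq (hasSum_coeff_one ρ) (fun n => ?_) rfl
  rw [coeff_one]
  split_ifs <;> simp

theorem AbsConv.pow {ρ : ℝ} (hρ : 0 ≤ ρ) {f : ℚ⟦X⟧} (hf : AbsConv ρ f) (k : ℕ) :
    AbsConv ρ (f ^ k) := by
  induction k with
  | zero => rw [pow_zero]; exact (hasSum_abs_coeff_one ρ).summable
  | succ k ih => rw [pow_succ]; exact ih.mul hρ hf

theorem wnorm_pow_le {ρ : ℝ} (hρ : 0 ≤ ρ) {f : ℚ⟦X⟧} (hf : AbsConv ρ f) (k : ℕ) :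
    wnorm ρ (f ^ k) ≤ wnorm ρ f ^ k := by
  induction k with
  | zero => rw [pow_zero, pow_zero]; exact (hasSum_abs_coeff_one ρ).tsum_eq.le
  | succ k ih =>
    rw [pow_succ, pow_succ]
    exact (wnorm_mul_le hρ (hf.pow hρ k) hf).trans
      (mul_le_mul_of_nonneg_right ih (wnorm_nonneg hρ f))

theorem evalAt_pow {ρ x : ℝ} (hρ : 0 ≤ ρ) {f : ℚ⟦X⟧} (hf : AbsConv ρ f) (hx : |x| ≤ ρ) (k : ℕ) :
    evalAt (f ^ k) x = evalAt f x ^ k := by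
  induction k with
  | zero => rw [pow_zero, pow_zero]; exact (hasSum_coeff_one x).tsum_eq
  | succ k ih => rw [pow_succ, pow_succ, evalAt_mul (hf.pow hρ k) hf hx, ih]

theorem coeff_pow_eq_zero {h : ℚ⟦X⟧} (h0 : constantCoeff h = 0) {n k : ℕ} (hnk : n < k) :
    coeff n (h ^ k) = 0 :=
  X_pow_dvd_iff.1 (pow_dvd_pow_of_dvd (X_dvd_iff.2 h0) k) n hnk

theorem hasSum_coeff_subst (β : ℚ⟦X⟧) {h : ℚ⟦X⟧} (h0 : constantCoeff h = 0) (n : ℕ) :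
    HasSum (fun k => ((coeff k β : ℚ) : ℝ) * ((coeff n (h ^ k) : ℚ) : ℝ))
      ((coeff n (β.subst h) : ℚ) : ℝ) := by
  have hz : ∀ k ∉ Finset.range (n + 1), coeff n (h ^ k) = 0 := fun k hk =>
    coeff_pow_eq_zero h0 (by simpa using hk)
  have e : coeff n (β.subst h) = ∑ k ∈ Finset.range (n + 1), coeff k β * coeff n (h ^ k) := by
    rw [coeff_subst' (HasSubst.of_constantCoeff_zero' h0),
      finsum_eq_sum_of_support_subset (s := Finset.range (n + 1))]
    · rfl
    · intro k hk
      by_contra hk'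
      exact hk (by simp [hz k hk'])
  rw [e]
  push_cast
  exact hasSum_sum_of_ne_finset_zero fun k hk => by rw [hz k hk]; simp

/-- Substitution of a series of weighted norm less than `1` without constant term in a series
with bounded coefficients. -/
theorem absConv_subst {ρ : ℝ} (hρ : 0 ≤ ρ) {β h : ℚ⟦X⟧} (hβ : ∀ k, |coeff k β| ≤ 1)
    (h0 : constantCoeff h = 0) (hh : AbsConv ρ h) (h1 : wnorm ρ h < 1) :
    AbsConv ρ (β.subst h) ∧ ∀ x, |x| ≤ ρ →
      HasSum (fun k => ((coeff k β : ℚ) : ℝ) * evalAt h x ^ k) (evalAt (β.subst h) x) := by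
  have hβ' (k : ℕ) : |((coeff k β : ℚ) : ℝ)| ≤ 1 := by exact_mod_cast hβ k
  have hdouble : Summable fun p : ℕ × ℕ => |((coeff p.2 (h ^ p.1) : ℚ) : ℝ)| * ρ ^ p.2 := by
    rw [summable_prod_of_nonneg fun p => by positivity]
    refine ⟨fun k => hh.pow hρ k, ?_⟩
    refine Summable.of_nonneg_of_le (fun k => wnorm_nonneg hρ (h ^ k))
      (fun k => wnorm_pow_le hρ hh k)
      (summable_geometric_of_lt_one (wnorm_nonneg hρ h) h1)
  have hd (x : ℝ) (hx : |x| ≤ ρ) : Summable fun p : ℕ × ℕ =>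
      ‖((coeff p.1 β : ℚ) : ℝ) * (((coeff p.2 (h ^ p.1) : ℚ) : ℝ) * x ^ p.2)‖ := by
    refine Summable.of_nonneg_of_le (fun p => norm_nonneg _) (fun p => ?_) hdouble
    rw [Real.norm_eq_abs, abs_mul, abs_mul, abs_pow]
    refine (mul_le_of_le_one_left (by positivity) (hβ' _)).trans ?_
    gcongr
  have hA : AbsConv ρ (β.subst h) := by
    have h1 := (hd ρ (abs_of_nonneg hρ).le).prod_symm.prod
    refine Summable.of_nonneg_of_le (fun n => by positivity) (fun n => ?_) h1
    have h2 := (hasSum_coeff_subst β h0 n).mul_right (ρ ^ n)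
    have h3 : Summable fun k => ‖((coeff k β : ℚ) : ℝ) * (((coeff n (h ^ k) : ℚ) : ℝ) * ρ ^ n)‖ :=
      (hd ρ (abs_of_nonneg hρ).le).prod_symm.prod_factor n
    have e : |((coeff n (β.subst h) : ℚ) : ℝ)| * ρ ^ n =
        ‖∑' k, ((coeff k β : ℚ) : ℝ) * (((coeff n (h ^ k) : ℚ) : ℝ) * ρ ^ n)‖ := by
      rw [← abs_of_nonneg (pow_nonneg hρ n), ← abs_mul, ← h2.tsum_eq, Real.norm_eq_abs,
        abs_of_nonneg (pow_nonneg hρ n)]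
      congr 1
      exact tsum_congr fun k => by ring
    rw [e]
    exact norm_tsum_le_tsum_norm h3
  refine ⟨hA, fun x hx => ?_⟩
  have hs := (hd x hx).of_norm
  have h1 : HasSum (fun k => ((coeff k β : ℚ) : ℝ) * evalAt h x ^ k)
      (∑' p : ℕ × ℕ, ((coeff p.1 β : ℚ) : ℝ) * (((coeff p.2 (h ^ p.1) : ℚ) : ℝ) * x ^ p.2)) := by
    refine hs.hasSum.prod_fiberwise fun k => ?_
    rw [← evalAt_pow hρ hh hx]
    exact ((hh.pow hρ k).hasSum hx).mul_left _
  have h2 : HasSum (fun n => ((coeff n (β.subst h) : ℚ) : ℝ) * x ^ n)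
      (∑' p : ℕ × ℕ, ((coeff p.1 β : ℚ) : ℝ) * (((coeff p.2 (h ^ p.1) : ℚ) : ℝ) * x ^ p.2)) := by
    have hs' := (Equiv.prodComm ℕ ℕ).hasSum_iff.2 hs.hasSum
    refine HasSum.prod_fiberwise hs' fun n => ?_
    refine hasSum_of_eq ((hasSum_coeff_subst β h0 n).mul_right (x ^ n)) (fun k => ?_) rfl
    simp [mul_assoc]
  rw [(hA.hasSum hx).unique h2]
  exact h1

/-- The binomial series. -/
theorem hasSum_choose_mul_pow (r : ℚ) {x : ℝ} (hx : |x| < 1) :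
    HasSum (fun k => ((Ring.choose r k : ℚ) : ℝ) * x ^ k) ((1 + x) ^ (r : ℝ)) := by
  have h := (Complex.one_add_cpow_hasFPowerSeriesOnBall_zero (a := ((r : ℝ) : ℂ))).hasSum
    (y := (x : ℂ)) (by
      rw [Metric.mem_eball, edist_zero_right]
      rw [← ofReal_norm, Complex.norm_real, Real.norm_eq_abs]
      exact ENNReal.ofReal_lt_one.2 hx)
  have h1 : 0 ≤ 1 + x := by linarith [neg_abs_le x]
  have e1 : ((1 + x : ℝ) : ℂ) ^ ((r : ℝ) : ℂ) = (((1 + x) ^ (r : ℝ) : ℝ) : ℂ) :=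
    (Complex.ofReal_cpow h1 _).symm
  have e2 (k : ℕ) : Ring.choose ((r : ℝ) : ℂ) k = ((Ring.choose r k : ℚ) : ℂ) := by
    have := Ring.map_choose (algebraMap ℚ ℂ) r k
    simpa using this.symm
  have e3 : (fun k => ((((Ring.choose r k : ℚ) : ℝ) * x ^ k : ℝ) : ℂ)) =
      fun k => _root_.binomialSeries ℂ ((r : ℝ) : ℂ) k fun _ => (x : ℂ) := by
    funext k
    rw [binomialSeries_apply, List.ofFn_const, List.prod_replicate, smul_eq_mul, e2]
    push_cast
    rfl
  rw [← Complex.hasSum_ofReal, ← e1, e3]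
  push_cast
  rwa [zero_add] at h

/-- Where the weighted norm of `f - 1` is less than `1`, the rational power of formal power series
is the real power of the values. -/
theorem absConv_ratPow {ρ : ℝ} (hρ : 0 ≤ ρ) {f : ℚ⟦X⟧} (hf : constantCoeff f = 1) {r : ℚ}
    (hr : |r| ≤ 1) (hh : AbsConv ρ (f - 1)) (h1 : wnorm ρ (f - 1) < 1) :
    AbsConv ρ (EllipticPeriods.ratPow f r) ∧ ∀ x, |x| ≤ ρ →
      evalAt (EllipticPeriods.ratPow f r) x = evalAt f x ^ (r : ℝ) := by
  obtain ⟨hA, hB⟩ := absConv_subst hρ (β := PowerSeries.binomialSeries ℚ r)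
    (fun k => by simpa using abs_choose_le_one hr k) (by simp [hf]) hh h1
  refine ⟨hA, fun x hx => ?_⟩
  have hev := hh.hasSum hx
  have hlt : |evalAt (f - 1) x| < 1 := by
    refine lt_of_le_of_lt ?_ h1
    have h2 := norm_tsum_le_tsum_norm (hh.summable_abs hx)
    refine h2.trans ((hh.summable_abs hx).tsum_le_tsum (fun n => ?_) hh)
    rw [Real.norm_eq_abs, abs_mul, abs_pow]
    gcongr
  have hf1 : evalAt f x = 1 + evalAt (f - 1) x := by
    refine HasSum.tsum_eq (hasSum_of_eq ((hasSum_coeff_one x).add hev) (fun n => ?_) rfl)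
    rw [map_sub]; push_cast; ring
  rw [hf1]
  refine HasSum.unique ?_ (hasSum_choose_mul_pow r hlt)
  refine hasSum_of_eq (hB x hx) (fun k => ?_) rfl
  simp

/-- A geometric bound on the coefficients gives a bound on the weighted norm. -/
theorem wnorm_sub_one_lt {ρ B M : ℝ} (hρ : 0 < ρ) (hB : 0 ≤ B) (hBρ : (B + M) * ρ < 1)
    (hM : 0 ≤ M) {f : ℚ⟦X⟧} (hf : constantCoeff f = 1)
    (hb : ∀ n, |((coeff (n + 1) f : ℚ) : ℝ)| ≤ M * B ^ n) :
    AbsConv ρ (f - 1) ∧ wnorm ρ (f - 1) < 1 := by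
  have hBρ' : B * ρ < 1 := by nlinarith
  have hgeo := (hasSum_geometric_of_lt_one (by positivity) hBρ').mul_left (M * ρ)
  have hle (n : ℕ) : |((coeff (n + 1) (f - 1) : ℚ) : ℝ)| * ρ ^ (n + 1) ≤
      M * ρ * (B * ρ) ^ n := by
    rw [map_sub, coeff_one, if_neg (Nat.succ_ne_zero n), sub_zero, mul_pow, pow_succ]
    have := mul_le_mul_of_nonneg_right (hb n) (by positivity : 0 ≤ ρ ^ n * ρ)
    linarith
  have hs : Summable fun n => |((coeff (n + 1) (f - 1) : ℚ) : ℝ)| * ρ ^ (n + 1) :=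
    Summable.of_nonneg_of_le (fun n => by positivity) hle hgeo.summable
  have hA : AbsConv ρ (f - 1) := (summable_nat_add_iff 1).1 hs
  refine ⟨hA, ?_⟩
  unfold wnorm
  rw [hA.tsum_eq_zero_add]
  have h0 : ((coeff 0 (f - 1) : ℚ) : ℝ) = 0 := by simp [hf]
  rw [h0, abs_zero, zero_mul, zero_add]
  refine (hs.tsum_le_tsum hle hgeo.summable).trans_lt ?_
  rw [hgeo.tsum_eq, ← div_eq_mul_inv, div_lt_one (by linarith)]
  linarith

end Evaluation

/-! ### The power series of the periods -/

section Series

open PowerSeries EllipticPeriods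

theorem abs_sum_divisors_le {w : ℕ → ℝ} (n : ℕ) (hw : ∀ k, |w k| ≤ 1) :
    |∑ k ∈ n.divisors, w k * (k : ℝ) ^ 2| ≤ (n : ℝ) ^ 3 := by
  refine (Finset.abs_sum_le_sum_abs _ _).trans ?_
  have h : ∀ k ∈ n.divisors, |w k * (k : ℝ) ^ 2| ≤ (n : ℝ) ^ 2 := fun k hk => by
    have hk' : (k : ℝ) ≤ n := by exact_mod_cast Nat.divisor_le hk
    rw [abs_mul, abs_of_nonneg (sq_nonneg (k : ℝ))]
    refine (mul_le_of_le_one_left (sq_nonneg _) (hw k)).trans ?_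
    gcongr
  refine (Finset.sum_le_card_nsmul _ _ _ h).trans ?_
  rw [nsmul_eq_mul]
  have : (n.divisors.card : ℝ) ≤ n := by exact_mod_cast Nat.card_divisors_le_self n
  have h2 : (0 : ℝ) ≤ (n : ℝ) ^ 2 := by positivity
  nlinarith

theorem coeff_E3a_succ (n : ℕ) : coeff (n + 1) E3a =
    -9 * ∑ k ∈ (n + 1).divisors, (legendreSym 3 (k : ℤ) : ℚ) * (k : ℚ) ^ 2 := by
  unfold E3a
  have e9 : (9 : PowerSeries ℚ) = PowerSeries.C 9 := rfl
  rw [map_sub, coeff_one, if_neg (Nat.succ_ne_zero n), e9, coeff_C_mul, coeff_mk]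
  ring

theorem abs_coeff_E3a_succ (n : ℕ) :
    |((coeff (n + 1) E3a : ℚ) : ℝ)| ≤ 9 * ((n : ℝ) + 1) ^ 3 := by
  rw [coeff_E3a_succ]
  push_cast
  have h := abs_sum_divisors_le (n + 1) (w := fun k => chi k) fun k => abs_chi_le k
  rw [abs_mul]
  push_cast at h
  norm_num
  exact h

theorem abs_coeff_E3b (n : ℕ) : |((coeff n E3b : ℚ) : ℝ)| ≤ (n : ℝ) ^ 3 := by
  unfold E3b
  rw [coeff_mk]
  push_cast
  exact abs_sum_divisors_le n (w := fun k => chi (n / k : ℕ)) fun k => abs_chi_le _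

theorem legendreSym_values : legendreSym 3 1 = 1 ∧ legendreSym 3 2 = -1 ∧ legendreSym 3 3 = 0 := by
  decide

theorem coeff_E3a_zero : coeff 0 E3a = 1 := by simp [E3a]

theorem coeff_E3a_one : coeff 1 E3a = -9 := by
  obtain ⟨h1, h2, h3⟩ := legendreSym_values
  rw [coeff_E3a_succ 0]
  simp [h1]

theorem coeff_E3a_two : coeff 2 E3a = 27 := by
  obtain ⟨h1, h2, h3⟩ := legendreSym_values
  rw [coeff_E3a_succ 1, show (1 + 1 : ℕ).divisors = {1, 2} by decide]
  norm_num [h1, h2]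

theorem coeff_E3b_zero : coeff 0 E3b = 0 := by simp [E3b]

theorem coeff_E3b_one : coeff 1 E3b = 1 := by
  obtain ⟨h1, h2, h3⟩ := legendreSym_values
  simp [E3b, h1]

theorem coeff_E3b_two : coeff 2 E3b = 3 := by
  obtain ⟨h1, h2, h3⟩ := legendreSym_values
  rw [E3b, coeff_mk, show (2 : ℕ).divisors = {1, 2} by decide]
  norm_num [h1, h2]

theorem coeff_E3b_three : coeff 3 E3b = 9 := by
  obtain ⟨h1, h2, h3⟩ := legendreSym_values
  rw [E3b, coeff_mk, show (3 : ℕ).divisors = {1, 3} by decide]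
  norm_num [h1, h3]

theorem constantCoeff_E3a : constantCoeff E3a = 1 := by
  rw [← coeff_zero_eq_constantCoeff_apply, coeff_E3a_zero]

theorem constantCoeff_E3bDivQ : constantCoeff E3bDivQ = 1 := by
  rw [← coeff_zero_eq_constantCoeff_apply, E3bDivQ, coeff_mk, coeff_E3b_one]

theorem coeff_weightThree (n : ℕ) :
    coeff n (E3a + 27 * E3b) = coeff n E3a + 27 * coeff n E3b := by
  have e : (27 : PowerSeries ℚ) = PowerSeries.C 27 := rfl
  rw [map_add, e, coeff_C_mul]

theorem constantCoeff_weightThree : constantCoeff (E3a + 27 * E3b) = 1 := by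
  rw [← coeff_zero_eq_constantCoeff_apply, coeff_weightThree, coeff_E3a_zero, coeff_E3b_zero]
  norm_num

theorem a_eq (l j n : ℕ) : EllipticPeriods.a l j n = coeff n (E3b * (ratPow E3a ((j : ℚ) / l) *
    ratPow (E3a + 27 * E3b) (-((j : ℚ) / l)))) := by
  rw [EllipticPeriods.a, ratPow_div constantCoeff_E3a constantCoeff_weightThree]

theorem b_eq (l j n : ℕ) : EllipticPeriods.b l j n = coeff n (E3a * (ratPow E3bDivQ ((j : ℚ) / l) *
    ratPow (E3a + 27 * E3b) (-((j : ℚ) / l)))) := by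
  rw [EllipticPeriods.b, ratPow_div constantCoeff_E3bDivQ constantCoeff_weightThree]

theorem a_first (l j : ℕ) : EllipticPeriods.a l j 0 = 0 ∧ EllipticPeriods.a l j 1 = 1 ∧
    EllipticPeriods.a l j 2 = 3 - 27 * ((j : ℚ) / l) ∧
    EllipticPeriods.a l j 3 = 9 - 81 / 2 * ((j : ℚ) / l) + 729 / 2 * ((j : ℚ) / l) ^ 2 := by
  have hX : E3b = X * E3bDivQ := by
    ext n
    cases n with
    | zero => simp [coeff_E3b_zero]
    | succ n => rw [coeff_succ_X_mul, E3bDivQ, coeff_mk]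
  have d0 : coeff 0 E3bDivQ = 1 := by rw [E3bDivQ, coeff_mk, coeff_E3b_one]
  have d1 : coeff 1 E3bDivQ = 3 := by rw [E3bDivQ, coeff_mk, coeff_E3b_two]
  have d2 : coeff 2 E3bDivQ = 9 := by rw [E3bDivQ, coeff_mk, coeff_E3b_three]
  have p0 {f : ℚ⟦X⟧} (hf : constantCoeff f = 1) (r : ℚ) : coeff 0 (ratPow f r) = 1 := by
    rw [coeff_zero_eq_constantCoeff_apply, constantCoeff_ratPow hf]
  have cA := constantCoeff_E3a
  have cv := constantCoeff_weightThree
  simp only [a_eq]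
  refine ⟨?_, ?_, ?_, ?_⟩
  · rw [hX, mul_assoc]; simp
  · rw [show E3b = X * E3bDivQ from hX, mul_assoc, coeff_succ_X_mul, ← hX]
    simp [constantCoeff_E3bDivQ, constantCoeff_ratPow, cA, cv]
  · rw [show E3b = X * E3bDivQ from hX, mul_assoc, coeff_succ_X_mul, ← hX, coeff_mul_one,
      coeff_mul_one, coeff_mul, p0 cA, p0 cv]
    simp [p0 cA, p0 cv, d0, d1, coeff_ratPow_one cA, coeff_ratPow_one cv, coeff_weightThree,
      coeff_E3a_one, coeff_E3b_one]
    norm_num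
    ring
  · rw [show E3b = X * E3bDivQ from hX, mul_assoc, coeff_succ_X_mul, ← hX]
    simp only [coeff_mul_two, coeff_mul_one, p0 cA, p0 cv, d0, d1, d2, coeff_ratPow_one cA,
      coeff_ratPow_one cv, coeff_ratPow_two cA, coeff_ratPow_two cv, coeff_weightThree,
      coeff_E3a_one, coeff_E3b_one, coeff_E3a_two, coeff_E3b_two]
    rw [coeff_zero_eq_constantCoeff_apply, map_mul, constantCoeff_ratPow cA,
      constantCoeff_ratPow cv]
    ring

theorem b_first (l j : ℕ) : EllipticPeriods.b l j 0 = 1 ∧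
    EllipticPeriods.b l j 1 = -9 - 15 * ((j : ℚ) / l) ∧
    EllipticPeriods.b l j 2 = 27 + 387 / 2 * ((j : ℚ) / l) + 225 / 2 * ((j : ℚ) / l) ^ 2 := by
  have d1 : coeff 1 E3bDivQ = 3 := by rw [E3bDivQ, coeff_mk, coeff_E3b_two]
  have d2 : coeff 2 E3bDivQ = 9 := by rw [E3bDivQ, coeff_mk, coeff_E3b_three]
  have p0 {f : ℚ⟦X⟧} (hf : constantCoeff f = 1) (r : ℚ) : coeff 0 (ratPow f r) = 1 := by
    rw [coeff_zero_eq_constantCoeff_apply, constantCoeff_ratPow hf]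
  have cB := constantCoeff_E3bDivQ
  have cv := constantCoeff_weightThree
  have z0 (r : ℚ) : coeff 0 (ratPow E3bDivQ r * ratPow (E3a + 27 * E3b) (-r)) = 1 := by
    rw [coeff_zero_eq_constantCoeff_apply, map_mul, constantCoeff_ratPow cB,
      constantCoeff_ratPow cv, one_mul]
  simp only [b_eq]
  refine ⟨?_, ?_, ?_⟩
  · rw [coeff_zero_eq_constantCoeff_apply, map_mul, constantCoeff_E3a,
      ← coeff_zero_eq_constantCoeff_apply, z0, one_mul]
  · simp only [coeff_mul_one, z0, p0 cB, p0 cv, d1, coeff_ratPow_one cB,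
      coeff_ratPow_one cv, coeff_weightThree, coeff_E3a_zero,
      coeff_E3a_one, coeff_E3b_one]
    ring
  · simp only [coeff_mul_two, coeff_mul_one, z0, p0 cB, p0 cv, d1, d2, coeff_ratPow_one cB,
      coeff_ratPow_one cv, coeff_ratPow_two cB, coeff_ratPow_two cv, coeff_weightThree,
      coeff_E3a_zero, coeff_E3a_one, coeff_E3b_one, coeff_E3a_two, coeff_E3b_two]
    ring

/-- The radius `1/36` exceeds `c`, and is small enough for all series in use to converge. -/
theorem c_lt : c < 1 / 36 := by
  have hpi := Real.pi_gt_d2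
  have h3 : √(3 : ℝ) < 1.733 := (Real.sqrt_lt' (by norm_num)).2 (by norm_num)
  have h3' : 0 < √(3 : ℝ) := by positivity
  have h1 : (18 : ℝ) / 5 ≤ 2 * Real.pi / √3 := by
    rw [le_div_iff₀ h3']; nlinarith
  have h2 : (36 : ℝ) ^ 5 < Real.exp (18 / 5) ^ 5 := by
    rw [← Real.exp_nat_mul, show ((5 : ℕ) : ℝ) * (18 / 5) = ((18 : ℕ) : ℝ) * 1 by norm_num,
      Real.exp_nat_mul]
    calc (36 : ℝ) ^ 5 < 2.7182818283 ^ 18 := by norm_num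
      _ < Real.exp 1 ^ 18 := pow_lt_pow_left₀ Real.exp_one_gt_d9 (by norm_num) (by norm_num)
  have h3 : (36 : ℝ) < Real.exp (18 / 5) := lt_of_pow_lt_pow_left₀ 5 (Real.exp_pos _).le h2
  unfold c
  rw [show -2 * Real.pi / √3 = -(2 * Real.pi / √3) by ring, Real.exp_neg, one_div]
  exact inv_strictAnti₀ (by norm_num) (h3.trans_le (Real.exp_le_exp.2 h1))

theorem c_pos : 0 < c := Real.exp_pos _

theorem log_c : Real.log c = -(2 * Real.pi / √3) := by
  unfold c; rw [Real.log_exp]; ring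

theorem add_one_le_two_pow (n : ℕ) : (n : ℝ) + 1 ≤ 2 ^ n := by
  exact_mod_cast Nat.lt_two_pow_self (n := n)

/-- The coefficient of `q ^ (n + 1)` is at most `9 (n + 1)³ ≤ 9 * 8 ^ n`, and `9 + 8 < 36`. The two
analogous bounds below use `8 * 4 ^ n` and `18 * 16 ^ n`. -/
theorem absConv_E3a_sub_one : AbsConv (1 / 36) (E3a - 1) ∧ wnorm (1 / 36) (E3a - 1) < 1 := by
  refine wnorm_sub_one_lt (B := 8) (M := 9) (by norm_num) (by norm_num) (by norm_num) (by norm_num)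
    constantCoeff_E3a fun n => (abs_coeff_E3a_succ n).trans ?_
  have : ((n : ℝ) + 1) ^ 3 ≤ (2 ^ n) ^ 3 := by gcongr; exact add_one_le_two_pow n
  rw [← pow_mul, mul_comm n 3, pow_mul] at this
  norm_num at this ⊢
  exact this

theorem absConv_E3bDivQ_sub_one :
    AbsConv (1 / 36) (E3bDivQ - 1) ∧ wnorm (1 / 36) (E3bDivQ - 1) < 1 := by
  refine wnorm_sub_one_lt (B := 4) (M := 8) (by norm_num) (by norm_num) (by norm_num) (by norm_num)
    constantCoeff_E3bDivQ fun n => ?_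
  rw [E3bDivQ, coeff_mk]
  refine (abs_coeff_E3b _).trans ?_
  induction n with
  | zero => norm_num
  | succ n ih =>
    push_cast at ih ⊢
    have : ((n : ℝ) + 1 + 1 + 1) ^ 3 ≤ 4 * ((n : ℝ) + 1 + 1) ^ 3 := by
      have hn : (0 : ℝ) ≤ n := Nat.cast_nonneg n
      nlinarith [mul_nonneg hn hn, mul_nonneg hn (mul_nonneg hn hn)]
    rw [pow_succ (4 : ℝ)]
    linarith

theorem absConv_weightThree_sub_one :
    AbsConv (1 / 36) (E3a + 27 * E3b - 1) ∧ wnorm (1 / 36) (E3a + 27 * E3b - 1) < 1 := by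
  refine wnorm_sub_one_lt (B := 16) (M := 18) (by norm_num) (by norm_num) (by norm_num)
    (by norm_num) constantCoeff_weightThree fun n => ?_
  rcases Nat.eq_zero_or_pos n with rfl | hn
  · rw [coeff_weightThree, coeff_E3a_one, coeff_E3b_one]; norm_num
  · have h1 : |((coeff (n + 1) (E3a + 27 * E3b) : ℚ) : ℝ)| ≤ 36 * ((n : ℝ) + 1) ^ 3 := by
      rw [coeff_weightThree]
      push_cast
      have ha := abs_coeff_E3a_succ n
      have hb := abs_coeff_E3b (n + 1)
      push_cast at hb
      refine (abs_add_le _ _).trans ?_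
      rw [abs_mul, abs_of_pos (by norm_num : (0 : ℝ) < 27)]
      linarith
    refine h1.trans ?_
    have h2 : ((n : ℝ) + 1) ^ 3 ≤ (2 ^ n) ^ 3 := by gcongr; exact add_one_le_two_pow n
    have h3 : (2 : ℝ) * (2 ^ n) ^ 3 ≤ 16 ^ n := by
      have : (2 : ℝ) ≤ 2 ^ n := by
        calc (2 : ℝ) = 2 ^ 1 := by norm_num
          _ ≤ 2 ^ n := pow_le_pow_right₀ (by norm_num) hn
      have e : (16 : ℝ) ^ n = 2 ^ n * (2 ^ n) ^ 3 := by
        rw [show (16 : ℝ) = 2 ^ 4 by norm_num, ← pow_mul, mul_comm 4 n, pow_mul]; ring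
      rw [e]
      gcongr
    linarith

theorem absConv_of_bound {f : ℚ⟦X⟧} {C ρ : ℝ} {p : ℕ} (h0 : 0 ≤ ρ) (h1 : ρ < 1)
    (hf : ∀ n, |((coeff n f : ℚ) : ℝ)| ≤ C * ((n : ℝ) + 1) ^ p) : AbsConv ρ f :=
  summable_pow_of_bound (f := fun n => |((coeff n f : ℚ) : ℝ)|) (C := C) (p := p)
    (fun n => by rw [abs_abs]; exact hf n) (by rwa [abs_of_nonneg h0])

theorem absConv_E3a : AbsConv (1 / 36) E3a := by
  refine absConv_of_bound (C := 9) (p := 3) (by norm_num) (by norm_num) fun n => ?_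
  cases n with
  | zero => rw [coeff_E3a_zero]; norm_num
  | succ n =>
    refine (abs_coeff_E3a_succ n).trans ?_
    push_cast
    gcongr
    linarith

theorem absConv_E3b : AbsConv (1 / 36) E3b := by
  refine absConv_of_bound (C := 1) (p := 3) (by norm_num) (by norm_num) fun n => ?_
  refine (abs_coeff_E3b n).trans ?_
  rw [one_mul]
  gcongr
  linarith

theorem evalAt_E3a {q : ℝ} (hq : q ∈ Set.Ioo (0 : ℝ) 1) :
    evalAt E3a q = eisOne q ^ 3 * (1 - hauptmodul q) := by
  rw [eisOne_cube_mul hq]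
  exact (hasSum_E3a (abs_lt_one_of_mem hq)).tsum_eq

theorem evalAt_E3b {q : ℝ} (hq : q ∈ Set.Ioo (0 : ℝ) 1) :
    evalAt E3b q = eisOne q ^ 3 * hauptmodul q / 27 := by
  have h : evalAt E3b q = seriesB q := (hasSum_E3b (abs_lt_one_of_mem hq)).tsum_eq
  have hA := eisOne_pos hq.1 hq.2
  rw [h, seriesB_eq hq.1 hq.2]
  unfold hauptmodul
  field_simp

theorem evalAt_E3bDivQ {q : ℝ} (hq : q ∈ Set.Ioo (0 : ℝ) 1) :
    evalAt E3bDivQ q = eisOne q ^ 3 * hauptmodul q / 27 / q := by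
  have hs := hasSum_E3b (abs_lt_one_of_mem hq)
  have h : evalAt E3b q = seriesB q := hs.tsum_eq
  rw [← evalAt_E3b hq, h]
  have hq0 := hq.1.ne'
  have h1 := (hasSum_nat_add_iff' 1).2 hs
  simp only [Finset.range_one, Finset.sum_singleton, coeff_E3b_zero] at h1
  refine HasSum.tsum_eq (hasSum_of_eq (h1.div_const q) (fun n => ?_) (by simp))
  rw [E3bDivQ, coeff_mk, pow_succ]
  field_simp

theorem evalAt_weightThree {q : ℝ} (hq : q ∈ Set.Ioo (0 : ℝ) 1) :
    evalAt (E3a + 27 * E3b) q = eisOne q ^ 3 := by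
  have h := (hasSum_E3a (abs_lt_one_of_mem hq)).add
    ((hasSum_E3b (abs_lt_one_of_mem hq)).mul_left 27)
  have ha : evalAt E3a q = 1 - 9 * seriesA q := (hasSum_E3a (abs_lt_one_of_mem hq)).tsum_eq
  have hb : evalAt E3b q = seriesB q := (hasSum_E3b (abs_lt_one_of_mem hq)).tsum_eq
  rw [evalAt_E3a hq] at ha
  rw [evalAt_E3b hq] at hb
  refine HasSum.tsum_eq (hasSum_of_eq h (fun n => ?_) ?_)
  · rw [coeff_weightThree]; push_cast; ring
  · rw [← ha, ← hb]; ring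

theorem abs_ratio_le_one {l j : ℕ} (hl : j ≤ l) : |(j : ℚ) / l| ≤ 1 := by
  rw [abs_of_nonneg (by positivity)]
  exact div_le_one_of_le₀ (by exact_mod_cast hl) (by positivity)

theorem summable_abs_a {l j : ℕ} (hl : j ≤ l) :
    Summable fun n => |(EllipticPeriods.a l j n : ℝ)| * (1 / 36) ^ n := by
  have hα := abs_ratio_le_one hl
  simp only [a_eq]
  exact absConv_E3b.mul (by norm_num)
    ((absConv_ratPow (by norm_num) constantCoeff_E3a hα absConv_E3a_sub_one.1
      absConv_E3a_sub_one.2).1.mul (by norm_num)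
    (absConv_ratPow (by norm_num) constantCoeff_weightThree (by rwa [abs_neg])
      absConv_weightThree_sub_one.1 absConv_weightThree_sub_one.2).1)

theorem summable_abs_b {l j : ℕ} (hl : j ≤ l) :
    Summable fun n => |(EllipticPeriods.b l j n : ℝ)| * (1 / 36) ^ n := by
  have hα := abs_ratio_le_one hl
  simp only [b_eq]
  exact absConv_E3a.mul (by norm_num)
    ((absConv_ratPow (by norm_num) constantCoeff_E3bDivQ hα absConv_E3bDivQ_sub_one.1
      absConv_E3bDivQ_sub_one.2).1.mul (by norm_num)
    (absConv_ratPow (by norm_num) constantCoeff_weightThree (by rwa [abs_neg])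
      absConv_weightThree_sub_one.1 absConv_weightThree_sub_one.2).1)

/-- The generating function of `a_n(j)` on the disc `|q| ≤ 1/36`. -/
theorem hasSum_a {l j : ℕ} (hl : j ≤ l) {q : ℝ} (h0 : 0 < q) (h1 : q ≤ 1 / 36) :
    HasSum (fun n => (EllipticPeriods.a l j n : ℝ) * q ^ n)
      (eisOne q ^ 3 * hauptmodul q / 27 * (1 - hauptmodul q) ^ ((j : ℝ) / l)) := by
  have hα := abs_ratio_le_one hl
  have hq : q ∈ Set.Ioo (0 : ℝ) 1 := ⟨h0, by linarith⟩
  have hx : |q| ≤ 1 / 36 := by rwa [abs_of_pos h0]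
  obtain ⟨cA, eA⟩ := absConv_ratPow (by norm_num) constantCoeff_E3a hα absConv_E3a_sub_one.1
      absConv_E3a_sub_one.2
  obtain ⟨cv, ev⟩ := absConv_ratPow (by norm_num) constantCoeff_weightThree
    (r := -((j : ℚ) / l)) (by rwa [abs_neg])
      absConv_weightThree_sub_one.1 absConv_weightThree_sub_one.2
  have hs := (absConv_E3b.mul (by norm_num) (cA.mul (by norm_num) cv)).hasSum hx
  refine hasSum_of_eq hs (fun n => by rw [a_eq]) ?_
  rw [evalAt_mul absConv_E3b (cA.mul (by norm_num) cv) hx, evalAt_mul cA cv hx, eA q hx, ev q hx,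
    evalAt_E3a hq, evalAt_E3b hq, evalAt_weightThree hq]
  have hA := eisOne_pos hq.1 hq.2
  have hS := hauptmodul_mem hq
  have hS1 : 0 ≤ 1 - hauptmodul q := by linarith [hS.2]
  have e : ((-((j : ℚ) / l) : ℚ) : ℝ) = -((j : ℝ) / l) := by push_cast; ring
  have e' : (((j : ℚ) / l : ℚ) : ℝ) = (j : ℝ) / l := by push_cast; ring
  rw [e, e', Real.mul_rpow (by positivity) hS1, Real.rpow_neg (by positivity)]
  have : ((eisOne q ^ 3) ^ ((j : ℝ) / l)) ≠ 0 := by positivity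
  field_simp

/-- The generating function of `b_n(j)` on the disc `|q| ≤ 1/36`. -/
theorem hasSum_b {l j : ℕ} (hl : j ≤ l) {q : ℝ} (h0 : 0 < q) (h1 : q ≤ 1 / 36) :
    HasSum (fun n => (EllipticPeriods.b l j n : ℝ) * q ^ n)
      (eisOne q ^ 3 * (1 - hauptmodul q) * (hauptmodul q / (27 * q)) ^ ((j : ℝ) / l)) := by
  have hα := abs_ratio_le_one hl
  have hq : q ∈ Set.Ioo (0 : ℝ) 1 := ⟨h0, by linarith⟩
  have hx : |q| ≤ 1 / 36 := by rwa [abs_of_pos h0]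
  obtain ⟨cA, eA⟩ := absConv_ratPow (by norm_num) constantCoeff_E3bDivQ hα
    absConv_E3bDivQ_sub_one.1 absConv_E3bDivQ_sub_one.2
  obtain ⟨cv, ev⟩ := absConv_ratPow (by norm_num) constantCoeff_weightThree
    (r := -((j : ℚ) / l)) (by rwa [abs_neg])
      absConv_weightThree_sub_one.1 absConv_weightThree_sub_one.2
  have hs := (absConv_E3a.mul (by norm_num) (cA.mul (by norm_num) cv)).hasSum hx
  refine hasSum_of_eq hs (fun n => by rw [b_eq]) ?_
  rw [evalAt_mul absConv_E3a (cA.mul (by norm_num) cv) hx, evalAt_mul cA cv hx, eA q hx, ev q hx,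
    evalAt_E3a hq, evalAt_E3bDivQ hq, evalAt_weightThree hq]
  have hA := eisOne_pos hq.1 hq.2
  have hS := hauptmodul_mem hq
  have hS1 : 0 ≤ hauptmodul q / (27 * q) := div_nonneg hS.1.le (by positivity)
  have e : ((-((j : ℚ) / l) : ℚ) : ℝ) = -((j : ℝ) / l) := by push_cast; ring
  have e' : (((j : ℚ) / l : ℚ) : ℝ) = (j : ℝ) / l := by push_cast; ring
  rw [e, e', show eisOne q ^ 3 * hauptmodul q / 27 / q =
    eisOne q ^ 3 * (hauptmodul q / (27 * q)) by field_simp,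
    Real.mul_rpow (by positivity) hS1, Real.rpow_neg (by positivity)]
  have : ((eisOne q ^ 3) ^ ((j : ℝ) / l)) ≠ 0 := by positivity
  field_simp

end Series

/-! ### Integration in the nome -/

/-- Termwise integration of a power series against an integrable weight. -/
theorem hasSum_integral_mul_pow {u : ℕ → ℝ} {U κ : ℝ → ℝ} {c ρ : ℝ}
    (hκ : IntegrableOn κ (Set.Ioo 0 c)) (hcρ : c ≤ ρ) (hu : Summable fun n => |u n| * ρ ^ n)
    (hU : ∀ q ∈ Set.Ioo 0 c, HasSum (fun n => u n * q ^ n) (U q)) :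
    IntegrableOn (fun q => κ q * U q) (Set.Ioo 0 c) ∧
      HasSum (fun n => u n * ∫ q in Set.Ioo 0 c, κ q * q ^ n) (∫ q in Set.Ioo 0 c, κ q * U q) := by
  have hb (n : ℕ) (q : ℝ) (hq : q ∈ Set.Ioo 0 c) : ‖q ^ n‖ ≤ ρ ^ n := by
    rw [norm_pow, Real.norm_of_nonneg hq.1.le]
    exact pow_le_pow_left₀ hq.1.le (hq.2.le.trans hcρ) n
  have hmem := ae_restrict_mem (μ := volume) (measurableSet_Ioo (a := (0 : ℝ)) (b := c))
  have hint (n : ℕ) : Integrable (fun q => κ q * q ^ n) (volume.restrict (Set.Ioo 0 c)) :=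
    hκ.mul_bdd (c := ρ ^ n) (by fun_prop) (by filter_upwards [hmem] with q hq using hb n q hq)
  have hsum : ∀ q ∈ Set.Ioo 0 c, HasSum (fun n => u n * (κ q * q ^ n)) (κ q * U q) := by
    intro q hq
    exact hasSum_of_eq ((hU q hq).mul_left (κ q)) (fun n => by ring) rfl
  constructor
  · refine (hκ.norm.mul_const (∑' n, |u n| * ρ ^ n)).mono' ?_ ?_
    · refine aestronglyMeasurable_of_tendsto_ae atTop
        (f := fun N q => ∑ n ∈ Finset.range N, u n * (κ q * q ^ n)) (fun N => ?_) ?_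
      · exact (integrable_finsetSum _ fun n _ => (hint n).const_mul (u n)).aestronglyMeasurable
      · filter_upwards [hmem] with q hq using (hsum q hq).tendsto_sum_nat
    · filter_upwards [hmem] with q hq
      rw [norm_mul]
      refine mul_le_mul_of_nonneg_left ?_ (norm_nonneg _)
      rw [← (hU q hq).tsum_eq]
      have hle (n : ℕ) : ‖u n * q ^ n‖ ≤ |u n| * ρ ^ n := by
        rw [norm_mul]
        exact mul_le_mul_of_nonneg_left (hb n q hq) (norm_nonneg _)
      exact tsum_of_norm_bounded hu.hasSum hle
  · have h := hasSum_integral_of_summable_integral_norm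
      (μ := volume.restrict (Set.Ioo 0 c)) (F := fun n q => u n * (κ q * q ^ n))
      (fun n => (hint n).const_mul (u n)) (by
        refine Summable.of_nonneg_of_le (fun n => integral_nonneg fun q => norm_nonneg _)
          (fun n => ?_) (hu.mul_right (∫ q in Set.Ioo 0 c, ‖κ q‖))
        rw [← integral_const_mul]
        refine integral_mono_ae ((hint n).const_mul (u n)).norm (hκ.norm.const_mul _) ?_
        filter_upwards [hmem] with q hq
        rw [norm_mul, norm_mul, Real.norm_eq_abs (u n)]
        have := mul_le_mul_of_nonneg_left (hb n q hq)
          (mul_nonneg (abs_nonneg (u n)) (norm_nonneg (κ q)))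
        linarith)
    refine hasSum_of_eq h (fun n => (integral_const_mul _ _).symm) ?_
    exact setIntegral_congr_fun measurableSet_Ioo fun q hq => (hsum q hq).tsum_eq.symm

/-- The integral of a nonnegative derivative. -/
theorem integral_Ioo_of_hasDerivAt {G g : ℝ → ℝ} {c : ℝ} (hc : 0 < c)
    (hG : ContinuousOn G (Set.Icc 0 c)) (hd : ∀ q ∈ Set.Ioo 0 c, HasDerivAt G (g q) q)
    (hpos : ∀ q ∈ Set.Ioo 0 c, 0 ≤ g q) (h0 : G 0 = 0) :
    IntegrableOn g (Set.Ioo 0 c) ∧ ∫ q in Set.Ioo 0 c, g q = G c := by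
  have hi := intervalIntegral.integrableOn_deriv_of_nonneg hG hd hpos
  refine ⟨hi.mono_set Set.Ioo_subset_Ioc_self, ?_⟩
  have h := intervalIntegral.integral_eq_sub_of_hasDerivAt_of_le hc.le hG hd
    ((intervalIntegrable_iff_integrableOn_Ioc_of_le hc.le).2 hi)
  rw [intervalIntegral.integral_of_le hc.le, integral_Ioc_eq_integral_Ioo, h0, sub_zero] at h
  exact h

theorem integral_rpow_Ioo {β c : ℝ} (hβ : 0 < β) (hc : 0 < c) :
    IntegrableOn (fun q : ℝ => q ^ (β - 1)) (Set.Ioo 0 c) ∧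
      ∫ q in Set.Ioo 0 c, q ^ (β - 1) = c ^ β / β := by
  refine integral_Ioo_of_hasDerivAt (G := fun q => q ^ β / β) hc ?_ (fun q hq => ?_)
    (fun q hq => Real.rpow_nonneg hq.1.le _) (by simp [hβ.ne'])
  · exact ((Real.continuous_rpow_const hβ.le).div_const β).continuousOn
  · refine ((Real.hasDerivAt_rpow_const (Or.inl hq.1.ne')).div_const β).congr_deriv ?_
    field_simp

/-- The primitive used is continuous at `0` with value `0`, in spite of the logarithm, because of
its factor `q ^ β`. -/
theorem integral_rpow_mul_log_Ioo {β c : ℝ} (hβ : 0 < β) (hc : 0 < c) (hc1 : c ≤ 1) :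
    IntegrableOn (fun q : ℝ => q ^ (β - 1) * -Real.log q) (Set.Ioo 0 c) ∧
      ∫ q in Set.Ioo 0 c, q ^ (β - 1) * -Real.log q =
        c ^ β * (-Real.log c / β + 1 / β ^ 2) := by
  refine integral_Ioo_of_hasDerivAt
    (G := fun q => q ^ β * (-Real.log q / β + 1 / β ^ 2)) hc ?_ (fun q hq => ?_)
    (fun q hq => mul_nonneg (Real.rpow_nonneg hq.1.le _)
      (neg_nonneg.2 (Real.log_nonpos hq.1.le (hq.2.le.trans hc1)))) (by simp [hβ.ne'])
  · intro q hq
    rcases hq.1.eq_or_lt with rfl | h0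
    · have h1 : Tendsto (fun q : ℝ => q ^ β * (-Real.log q / β + 1 / β ^ 2)) (𝓝[>] 0) (𝓝 0) := by
        have l1 := tendsto_log_mul_rpow_nhdsGT_zero hβ
        have l2 : Tendsto (fun q : ℝ => q ^ β) (𝓝[>] 0) (𝓝 0) := by
          have := (Real.continuous_rpow_const hβ.le).continuousAt (x := 0)
          have := this.continuousWithinAt (s := Set.Ioi 0)
          rwa [ContinuousWithinAt, Real.zero_rpow hβ.ne'] at this
        have l3 := (l1.mul_const (-1 / β)).add (l2.mul_const (1 / β ^ 2))
        rw [zero_mul, zero_mul, add_zero] at l3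
        exact l3.congr fun q => by ring
      have h2 : ContinuousWithinAt (fun q : ℝ => q ^ β * (-Real.log q / β + 1 / β ^ 2))
          (Set.Ioi 0) 0 := by
        rw [ContinuousWithinAt]
        simpa [Real.zero_rpow hβ.ne'] using h1
      exact (continuousWithinAt_Ioi_iff_Ici.1 h2).mono fun x hx => hx.1
    · have := Real.continuousAt_log h0.ne'
      exact ((Real.continuousAt_rpow_const q β (Or.inl h0.ne')).mul
        ((this.neg.div_const β).add continuousAt_const)).continuousWithinAt
  · have h0 := hq.1
    refine ((Real.hasDerivAt_rpow_const (Or.inl h0.ne')).mul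
      (((Real.hasDerivAt_log h0.ne').neg.div_const β).add_const (1 / β ^ 2))).congr_deriv ?_
    rw [Real.rpow_sub_one h0.ne']
    simp only [Pi.neg_apply]
    field_simp
    ring

/-- Termwise integration of a power series against the two kernels that occur. -/
theorem hasSum_integral_kernels {u : ℕ → ℝ} {U : ℝ → ℝ} {β : ℝ} (hβ : 0 < β)
    (hu : Summable fun n => |u n| * (1 / 36) ^ n)
    (hU : ∀ q ∈ Set.Ioo 0 EllipticPeriods.c, HasSum (fun n => u n * q ^ n) (U q)) :
    (IntegrableOn (fun q => q ^ (β - 1) * U q) (Set.Ioo 0 EllipticPeriods.c) ∧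
      HasSum (fun n : ℕ => u n * (EllipticPeriods.c ^ ((n : ℝ) + β) / ((n : ℝ) + β)))
        (∫ q in Set.Ioo 0 EllipticPeriods.c, q ^ (β - 1) * U q)) ∧
    (IntegrableOn (fun q => q ^ (β - 1) * -Real.log q * U q) (Set.Ioo 0 EllipticPeriods.c) ∧
      HasSum (fun n : ℕ => u n * (EllipticPeriods.c ^ ((n : ℝ) + β) *
          (2 * Real.pi / √3 / ((n : ℝ) + β) + 1 / ((n : ℝ) + β) ^ 2)))
        (∫ q in Set.Ioo 0 EllipticPeriods.c, q ^ (β - 1) * -Real.log q * U q)) := by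
  have hc0 := c_pos
  have hc1 := c_lt
  have e (n : ℕ) (q : ℝ) (hq : q ∈ Set.Ioo 0 EllipticPeriods.c) :
      q ^ (β - 1) * q ^ n = q ^ ((n : ℝ) + β - 1) := by
    rw [← Real.rpow_natCast, ← Real.rpow_add hq.1]
    ring_nf
  have hβn (n : ℕ) : 0 < (n : ℝ) + β := by positivity
  obtain ⟨i1, s1⟩ := hasSum_integral_mul_pow (integral_rpow_Ioo hβ hc0).1 hc1.le hu hU
  obtain ⟨i2, s2⟩ := hasSum_integral_mul_pow
    (integral_rpow_mul_log_Ioo hβ hc0 (by linarith)).1 hc1.le hu hU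
  refine ⟨⟨i1, hasSum_of_eq s1 (fun n => ?_) rfl⟩, ⟨i2, hasSum_of_eq s2 (fun n => ?_) rfl⟩⟩
  · rw [← (integral_rpow_Ioo (hβn n) hc0).2]
    congr 1
    exact setIntegral_congr_fun measurableSet_Ioo fun q hq => (e n q hq).symm
  · have := (integral_rpow_mul_log_Ioo (hβn n) hc0 (by linarith)).2
    rw [log_c, neg_neg] at this
    rw [← this]
    congr 1
    refine setIntegral_congr_fun measurableSet_Ioo fun q hq => ?_
    simp only [← e n q hq]
    ring

/-- The hauptmodul takes the value `1/2` at the fixed point `c` of the Fricke involution. -/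
theorem hauptmodul_c : hauptmodul EllipticPeriods.c = 1 / 2 := by
  have hc : EllipticPeriods.c ∈ Set.Ioo (0 : ℝ) 1 := ⟨c_pos, by linarith [c_lt]⟩
  have s3 : √(3 : ℝ) ^ 2 = 3 := Real.sq_sqrt (by norm_num)
  have h := hauptmodul_fricke hc hc (by
    rw [log_c, neg_mul_neg, div_mul_div_comm, ← sq √3, s3]; ring)
  linarith

/-- On `(0, c)` the hauptmodul covers half of `(0, 1)`; the Fricke involution takes care of the
other half. -/
theorem image_hauptmodul : hauptmodul '' Set.Ioo 0 EllipticPeriods.c = Set.Ioo 0 (1 / 2) := by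
  have hc1 := c_lt
  have sub : ∀ q ∈ Set.Ioo 0 EllipticPeriods.c, q ∈ Set.Ioo (0 : ℝ) 1 := fun q hq =>
    ⟨hq.1, by linarith [hq.2]⟩
  have hc : EllipticPeriods.c ∈ Set.Ioo (0 : ℝ) 1 := ⟨c_pos, by linarith⟩
  ext s
  constructor
  · rintro ⟨q, hq, rfl⟩
    refine ⟨(hauptmodul_mem (sub q hq)).1, ?_⟩
    rw [← hauptmodul_c]
    exact hauptmodul_strictMonoOn (sub q hq) hc hq.2
  · intro hs
    have hev := (tendsto_hauptmodul_zero.eventually_lt_const hs.1).and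
      (Ioo_mem_nhdsGT c_pos)
    obtain ⟨q, hqs, hq⟩ := hev.exists
    have hcont : ContinuousOn hauptmodul (Set.Icc q EllipticPeriods.c) := fun x hx =>
      (hasDerivAt_hauptmodul (hq.1.trans_le hx.1)
        (by linarith [hx.2])).continuousAt.continuousWithinAt
    obtain ⟨x, hx, rfl⟩ := intermediate_value_Ioo hq.2.le hcont
      (show s ∈ Set.Ioo _ _ from ⟨hqs, by rw [hauptmodul_c]; exact hs.2⟩)
    exact ⟨x, ⟨hq.1.trans hx.1, hx.2⟩, rfl⟩

/-- The substitutions `t^l = S(q)` for `t^l < 1/2` and `t^l = 1 - S(q)` for `t^l > 1/2`, where `S`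
is the hauptmodul. -/
theorem integral_hauptmodul {l j : ℕ} (hj : 1 ≤ j) (hl : l ≠ 0) {g F₁ F₂ : ℝ → ℝ}
    (h1 : ∀ q ∈ Set.Ioo 0 EllipticPeriods.c, hauptmodul q ^ ((j : ℝ) / l) *
      ((1 - hauptmodul q) * eisOne q ^ 2 / q) * g (hauptmodul q) = F₁ q)
    (h2 : ∀ q ∈ Set.Ioo 0 EllipticPeriods.c, (1 - hauptmodul q) ^ ((j : ℝ) / l) *
      (hauptmodul q * eisOne q ^ 2 / q) * g (1 - hauptmodul q) = F₂ q)
    (i1 : IntegrableOn F₁ (Set.Ioo 0 EllipticPeriods.c))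
    (i2 : IntegrableOn F₂ (Set.Ioo 0 EllipticPeriods.c)) :
    IntegrableOn (fun t => t ^ (j - 1) * g (t ^ l)) (Set.Ioo 0 1) ∧
      ∫ t in Set.Ioo (0 : ℝ) 1, t ^ (j - 1) * g (t ^ l) =
        1 / l * ((∫ q in Set.Ioo 0 EllipticPeriods.c, F₁ q) +
          ∫ q in Set.Ioo 0 EllipticPeriods.c, F₂ q) := by
  have hl0 : (l : ℝ) ≠ 0 := by exact_mod_cast hl
  have hlpos : (0 : ℝ) < l := by positivity
  have hc1 := c_lt
  have sub : ∀ q ∈ Set.Ioo 0 EllipticPeriods.c, q ∈ Set.Ioo (0 : ℝ) 1 := fun q hq =>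
    ⟨hq.1, by linarith [hq.2]⟩
  set T : ℝ := (1 / 2) ^ (1 / (l : ℝ)) with hT
  have hTl : T ^ l = 1 / 2 := by
    rw [hT, one_div (l : ℝ), Real.rpow_inv_natCast_pow (by norm_num) hl]
  have hT0 : 0 < T := by positivity
  have hT1 : T < 1 := Real.rpow_lt_one (by norm_num) (by norm_num) (by positivity)
  have rootpow {s : ℝ} (hs : 0 ≤ s) : (s ^ (1 / (l : ℝ))) ^ l = s := by
    rw [one_div, Real.rpow_inv_natCast_pow hs hl]
  have powroot {t : ℝ} (ht : 0 ≤ t) : (t ^ l) ^ (1 / (l : ℝ)) = t := by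
    rw [one_div, Real.pow_rpow_inv_natCast ht hl]
  have hinj : Set.InjOn hauptmodul (Set.Ioo 0 EllipticPeriods.c) :=
    hauptmodul_strictMonoOn.injOn.mono sub
  have jac {s : ℝ} (hs : 0 < s) : (s ^ (1 / (l : ℝ))) ^ (j - 1) * (1 / l * s ^ (1 / (l : ℝ) - 1)) =
      1 / l * (s ^ ((j : ℝ) / l) / s) := by
    rw [← Real.rpow_mul_natCast hs.le, Nat.cast_sub hj, mul_left_comm, ← Real.rpow_add hs,
      ← Real.rpow_sub_one hs.ne']
    congr 2
    push_cast
    field_simp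
    ring
  -- the part `t ^ l < 1 / 2`
  have img1 : (fun q => hauptmodul q ^ (1 / (l : ℝ))) '' Set.Ioo 0 EllipticPeriods.c =
      Set.Ioo 0 T := by
    have : (fun q => hauptmodul q ^ (1 / (l : ℝ))) =
      (fun s => s ^ (1 / (l : ℝ))) ∘ hauptmodul := rfl
    rw [this, Set.image_comp, image_hauptmodul]
    ext t
    constructor
    · rintro ⟨s, hs, rfl⟩
      exact ⟨Real.rpow_pos_of_pos hs.1 _, Real.rpow_lt_rpow hs.1.le hs.2 (by positivity)⟩
    · intro ht
      exact ⟨t ^ l, ⟨pow_pos ht.1 l, by rw [← hTl]; exact pow_lt_pow_left₀ ht.2 ht.1.le hl⟩,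
        powroot ht.1.le⟩
  have d1 : ∀ q ∈ Set.Ioo 0 EllipticPeriods.c,
      HasDerivWithinAt (fun q => hauptmodul q ^ (1 / (l : ℝ)))
        (1 / l * hauptmodul q ^ (1 / (l : ℝ) - 1) *
          (hauptmodul q * (1 - hauptmodul q) * eisOne q ^ 2 / q))
        (Set.Ioo 0 EllipticPeriods.c) q := by
    intro q hq
    have hS := hauptmodul_mem (sub q hq)
    refine (((hasDerivAt_hauptmodul hq.1 (sub q hq).2).rpow_const
      (p := 1 / (l : ℝ)) (Or.inl hS.1.ne')).congr_deriv ?_).hasDerivWithinAt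
    ring
  have inj1 : Set.InjOn (fun q => hauptmodul q ^ (1 / (l : ℝ))) (Set.Ioo 0 EllipticPeriods.c) := by
    intro x hx y hy hxy
    refine hinj hx hy ?_
    have := congrArg (fun t => t ^ l) hxy
    simpa only [rootpow (hauptmodul_mem (sub x hx)).1.le,
      rootpow (hauptmodul_mem (sub y hy)).1.le] using this
  have e1 : ∀ q ∈ Set.Ioo 0 EllipticPeriods.c, |1 / l * hauptmodul q ^ (1 / (l : ℝ) - 1) *
      (hauptmodul q * (1 - hauptmodul q) * eisOne q ^ 2 / q)| •
      ((hauptmodul q ^ (1 / (l : ℝ))) ^ (j - 1) * g ((hauptmodul q ^ (1 / (l : ℝ))) ^ l)) =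
      1 / l * F₁ q := by
    intro q hq
    have hS := hauptmodul_mem (sub q hq)
    have h1S : 0 < 1 - hauptmodul q := by linarith [hS.2]
    have hS0 := hS.1
    have hq0 := hq.1
    rw [abs_of_nonneg (by positivity), smul_eq_mul, rootpow hS.1.le, ← h1 q hq]
    have := jac hS0
    linear_combination (hauptmodul q * (1 - hauptmodul q) * eisOne q ^ 2 / q *
      g (hauptmodul q)) * this + (1 / l * hauptmodul q ^ ((j : ℝ) / l) * ((1 - hauptmodul q) *
      eisOne q ^ 2 / q) * g (hauptmodul q)) * (div_self hS0.ne')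
  -- the part `t ^ l > 1 / 2`
  have img2 : (fun q => (1 - hauptmodul q) ^ (1 / (l : ℝ))) '' Set.Ioo 0 EllipticPeriods.c =
      Set.Ioo T 1 := by
    have : (fun q => (1 - hauptmodul q) ^ (1 / (l : ℝ))) =
      (fun s => (1 - s) ^ (1 / (l : ℝ))) ∘ hauptmodul := rfl
    rw [this, Set.image_comp, image_hauptmodul]
    ext t
    constructor
    · rintro ⟨s, hs, rfl⟩
      have h1 : 1 / 2 < 1 - s := by linarith [hs.2]
      exact ⟨Real.rpow_lt_rpow (by norm_num) h1 (by positivity),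
        Real.rpow_lt_one (by linarith) (by linarith [hs.1]) (by positivity)⟩
    · intro ht
      have ht0 : 0 ≤ t := hT0.le.trans ht.1.le
      have a1 : 1 / 2 < t ^ l := by rw [← hTl]; exact pow_lt_pow_left₀ ht.1 hT0.le hl
      have a2 : t ^ l < 1 := pow_lt_one₀ ht0 ht.2 hl
      refine ⟨1 - t ^ l, ⟨by linarith, by linarith⟩, ?_⟩
      simp only [sub_sub_cancel]
      exact powroot ht0
  have d2 : ∀ q ∈ Set.Ioo 0 EllipticPeriods.c,
      HasDerivWithinAt (fun q => (1 - hauptmodul q) ^ (1 / (l : ℝ)))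
        (-(1 / l * (1 - hauptmodul q) ^ (1 / (l : ℝ) - 1) *
          (hauptmodul q * (1 - hauptmodul q) * eisOne q ^ 2 / q)))
        (Set.Ioo 0 EllipticPeriods.c) q := by
    intro q hq
    have hS := hauptmodul_mem (sub q hq)
    refine ((((hasDerivAt_hauptmodul hq.1 (sub q hq).2).const_sub 1).rpow_const
      (p := 1 / (l : ℝ)) (Or.inl (by linarith [hS.2]))).congr_deriv ?_).hasDerivWithinAt
    ring
  have inj2 : Set.InjOn (fun q => (1 - hauptmodul q) ^ (1 / (l : ℝ)))
      (Set.Ioo 0 EllipticPeriods.c) := by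
    intro x hx y hy hxy
    refine hinj hx hy ?_
    have := congrArg (fun t => t ^ l) hxy
    simp only [rootpow (sub_nonneg.2 (hauptmodul_mem (sub x hx)).2.le),
      rootpow (sub_nonneg.2 (hauptmodul_mem (sub y hy)).2.le)] at this
    linarith
  have e2 : ∀ q ∈ Set.Ioo 0 EllipticPeriods.c, |-(1 / l * (1 - hauptmodul q) ^ (1 / (l : ℝ) - 1) *
      (hauptmodul q * (1 - hauptmodul q) * eisOne q ^ 2 / q))| •
      (((1 - hauptmodul q) ^ (1 / (l : ℝ))) ^ (j - 1) *
        g (((1 - hauptmodul q) ^ (1 / (l : ℝ))) ^ l)) = 1 / l * F₂ q := by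
    intro q hq
    have hS := hauptmodul_mem (sub q hq)
    have h1S : 0 < 1 - hauptmodul q := by linarith [hS.2]
    have hS0 := hS.1
    have hq0 := hq.1
    rw [abs_neg, abs_of_nonneg (by positivity), smul_eq_mul, rootpow h1S.le, ← h2 q hq]
    have := jac h1S
    linear_combination (hauptmodul q * (1 - hauptmodul q) * eisOne q ^ 2 / q *
      g (1 - hauptmodul q)) * this + (1 / l * (1 - hauptmodul q) ^ ((j : ℝ) / l) * (hauptmodul q *
      eisOne q ^ 2 / q) * g (1 - hauptmodul q)) * (div_self h1S.ne')
  have int1 : IntegrableOn (fun t => t ^ (j - 1) * g (t ^ l)) (Set.Ioo 0 T) := by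
    rw [← img1, integrableOn_image_iff_integrableOn_abs_deriv_smul measurableSet_Ioo d1 inj1,
      integrableOn_congr_fun e1 measurableSet_Ioo]
    exact i1.const_mul _
  have int2 : IntegrableOn (fun t => t ^ (j - 1) * g (t ^ l)) (Set.Ioo T 1) := by
    rw [← img2, integrableOn_image_iff_integrableOn_abs_deriv_smul measurableSet_Ioo d2 inj2,
      integrableOn_congr_fun e2 measurableSet_Ioo]
    exact i2.const_mul _
  have val1 : ∫ t in Set.Ioo 0 T, t ^ (j - 1) * g (t ^ l) =
      1 / l * ∫ q in Set.Ioo 0 EllipticPeriods.c, F₁ q := by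
    rw [← img1, integral_image_eq_integral_abs_deriv_smul measurableSet_Ioo d1 inj1,
      setIntegral_congr_fun measurableSet_Ioo e1, integral_const_mul]
  have val2 : ∫ t in Set.Ioo T 1, t ^ (j - 1) * g (t ^ l) =
      1 / l * ∫ q in Set.Ioo 0 EllipticPeriods.c, F₂ q := by
    rw [← img2, integral_image_eq_integral_abs_deriv_smul measurableSet_Ioo d2 inj2,
      setIntegral_congr_fun measurableSet_Ioo e2, integral_const_mul]
  have int1' : IntegrableOn (fun t => t ^ (j - 1) * g (t ^ l)) (Set.Ioc 0 T) := by
    rwa [integrableOn_Ioc_iff_integrableOn_Ioo]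
  have hdisj : Disjoint (Set.Ioc 0 T) (Set.Ioo T 1) :=
    Set.disjoint_left.2 fun x hx hy => not_lt.2 hx.2 hy.1
  rw [← Set.Ioc_union_Ioo_eq_Ioo hT0.le hT1]
  refine ⟨int1'.union int2, ?_⟩
  rw [setIntegral_union hdisj measurableSet_Ioo int1' int2, integral_Ioc_eq_integral_Ioo, val1,
    val2]
  ring

/-! ### The generating functions in the nome -/

/-- In the nome, the periods of `t^(j-1) dt ∧ dx/y` are integrals of the two generating functions
against `q^(α-1)` and `1`, and `log q` times these. -/
theorem hauptmodul_weights {l j : ℕ} (hl : j ≤ l) {q : ℝ}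
    (hq : q ∈ Set.Ioo 0 EllipticPeriods.c) {A B : ℝ}
    (hA : HasSum (fun n => (EllipticPeriods.a l j n : ℝ) * q ^ n) A)
    (hB : HasSum (fun n => (EllipticPeriods.b l j n : ℝ) * q ^ n) B) :
    hauptmodul q ^ ((j : ℝ) / l) * ((1 - hauptmodul q) * eisOne q ^ 2 / q) * eisOne q =
        27 ^ ((j : ℝ) / l) * (q ^ ((j : ℝ) / l - 1) * B) ∧
      (1 - hauptmodul q) ^ ((j : ℝ) / l) * (hauptmodul q * eisOne q ^ 2 / q) * eisOne q =
        27 * (A / q) := by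
  have hc1 := c_lt
  have hq0 := hq.1
  have hq' : q ∈ Set.Ioo (0 : ℝ) 1 := ⟨hq.1, by linarith [hq.2]⟩
  have hS := (hauptmodul_mem hq').1
  rw [hA.unique (hasSum_a hl hq.1 (by linarith [hq.2])),
    hB.unique (hasSum_b hl hq.1 (by linarith [hq.2]))]
  constructor
  · rw [Real.div_rpow hS.le (by positivity), Real.mul_rpow (by norm_num) hq0.le,
      Real.rpow_sub_one hq0.ne']
    have h1 : (27 : ℝ) ^ ((j : ℝ) / l) ≠ 0 := by positivity
    have h2 : q ^ ((j : ℝ) / l) ≠ 0 := by positivity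
    field_simp
  · field_simp

theorem hasSum_a_succ {l j : ℕ} {q A : ℝ} (hq : q ≠ 0)
    (hA : HasSum (fun n => (EllipticPeriods.a l j n : ℝ) * q ^ n) A) :
    HasSum (fun n => (EllipticPeriods.a l j (n + 1) : ℝ) * q ^ n) (A / q) := by
  have h := (hasSum_nat_add_iff' 1).2 hA
  simp only [Finset.range_one, Finset.sum_singleton, (a_first l j).1] at h
  refine hasSum_of_eq (h.div_const q) (fun n => ?_) (by simp)
  rw [pow_succ]
  field_simp

end CubicPeriods

open CubicPeriods MeasureTheory in
theorem theorem5p9 (l j : ℕ) (hj : 1 ≤ j) (hjl : j ≤ l - 1) :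
    -- the first coefficients `a_n(j)` and `b_n(j)`
    (EllipticPeriods.a l j 0 = 0 ∧
      EllipticPeriods.a l j 1 = 1 ∧
      EllipticPeriods.a l j 2 = 3 - 27 * ((j : ℚ) / l) ∧
      EllipticPeriods.a l j 3 = 9 - 81 / 2 * ((j : ℚ) / l) + 729 / 2 * ((j : ℚ) / l) ^ 2) ∧
    (EllipticPeriods.b l j 0 = 1 ∧
      EllipticPeriods.b l j 1 = -9 - 15 * ((j : ℚ) / l) ∧
      EllipticPeriods.b l j 2 = 27 + 387 / 2 * ((j : ℚ) / l) + 225 / 2 * ((j : ℚ) / l) ^ 2) ∧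
    -- the four series in the definitions of `I(j)` and `J(j)` converge
    (Summable (fun n : ℕ => EllipticPeriods.I₁ l j (n + 1)) ∧
      Summable (fun n : ℕ => EllipticPeriods.I₂ l j n) ∧
      Summable (fun n : ℕ => EllipticPeriods.J₁ l j (n + 1)) ∧
      Summable (fun n : ℕ => EllipticPeriods.J₂ l j n)) ∧
    -- the two period integrals converge absolutely
    EllipticPeriods.PeriodConverges j (EllipticPeriods.Δ l) ∧
    EllipticPeriods.PeriodConverges j (EllipticPeriods.Γ l) ∧
    -- and have the stated values
    EllipticPeriods.period j (EllipticPeriods.Δ l) =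
      54 * Real.pi * Complex.I / l * EllipticPeriods.I l j ∧
    EllipticPeriods.period j (EllipticPeriods.Γ l) =
      -27 / l * EllipticPeriods.J l j := by
  have hl : l ≠ 0 := by omega
  have hjl' : j ≤ l := by omega
  have hα : 0 < (j : ℝ) / l := by
    have : 0 < j := hj
    positivity
  have hl0 : (l : ℝ) ≠ 0 := by exact_mod_cast hl
  have hc1 := c_lt
  have hpi := Real.pi_pos
  have h3 : √(3 : ℝ) ≠ 0 := by positivity
  have s3 : √(3 : ℝ) ^ 2 = 3 := Real.sq_sqrt (by norm_num)
  have mem : ∀ q ∈ Set.Ioo 0 EllipticPeriods.c, q ∈ Set.Ioo (0 : ℝ) 1 := fun q hq =>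
    ⟨hq.1, by linarith [hq.2]⟩
  -- the generating functions, and their integrals term by term
  set A : ℝ → ℝ := fun q => ∑' n, (EllipticPeriods.a l j n : ℝ) * q ^ n
  set B : ℝ → ℝ := fun q => ∑' n, (EllipticPeriods.b l j n : ℝ) * q ^ n
  have hA : ∀ q ∈ Set.Ioo 0 EllipticPeriods.c,
      HasSum (fun n => (EllipticPeriods.a l j n : ℝ) * q ^ n) (A q) := fun q hq =>
    (hasSum_a hjl' hq.1 (by linarith [hq.2])).summable.hasSum
  have hB : ∀ q ∈ Set.Ioo 0 EllipticPeriods.c,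
      HasSum (fun n => (EllipticPeriods.b l j n : ℝ) * q ^ n) (B q) := fun q hq =>
    (hasSum_b hjl' hq.1 (by linarith [hq.2])).summable.hasSum
  have hsa : Summable fun n => |(EllipticPeriods.a l j (n + 1) : ℝ)| * (1 / 36) ^ n := by
    refine (((summable_nat_add_iff 1).2 (summable_abs_a hjl')).mul_left 36).congr fun n => ?_
    rw [pow_succ]; ring
  obtain ⟨⟨iB, sB⟩, iBl, sBl⟩ := hasSum_integral_kernels hα (summable_abs_b hjl') hB
  obtain ⟨⟨iA, sA⟩, iAl, sAl⟩ := hasSum_integral_kernels one_pos hsa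
    fun q hq => hasSum_a_succ hq.1.ne' (hA q hq)
  have weights q (hq : q ∈ Set.Ioo 0 EllipticPeriods.c) :=
    hauptmodul_weights hjl' hq (hA q hq) (hB q hq)
  -- the period integrals in the nome
  obtain ⟨intΔ, valΔ⟩ := integral_hauptmodul (g := fun s => hyp (1 - s)) hj hl
    (F₁ := fun q => wronskianConst * 27 ^ ((j : ℝ) / l) *
      (q ^ ((j : ℝ) / l - 1) * -Real.log q * B q))
    (F₂ := fun q => 27 * (q ^ ((1 : ℝ) - 1) * (A q / q)))
    (fun q hq => by
      rw [hyp_one_sub_hauptmodul (mem q hq)]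
      linear_combination (-wronskianConst * Real.log q) * (weights q hq).1)
    (fun q hq => by
      rw [sub_sub_cancel, hyp_hauptmodul (mem q hq), (weights q hq).2, sub_self, Real.rpow_zero,
        one_mul])
    (iBl.const_mul _) (iA.const_mul _)
  obtain ⟨intΓ, valΓ⟩ := integral_hauptmodul (g := hyp) hj hl
    (F₁ := fun q => 27 ^ ((j : ℝ) / l) * (q ^ ((j : ℝ) / l - 1) * B q))
    (F₂ := fun q => wronskianConst * 27 * (q ^ ((1 : ℝ) - 1) * -Real.log q * (A q / q)))
    (fun q hq => by rw [hyp_hauptmodul (mem q hq), (weights q hq).1])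
    (fun q hq => by
      rw [hyp_one_sub_hauptmodul (mem q hq), sub_self, Real.rpow_zero]
      linear_combination (-wronskianConst * Real.log q) * (weights q hq).2)
    (iB.const_mul _) (iAl.const_mul _)
  obtain ⟨convΔ, perΔ⟩ := period_Δ hl intΔ
  obtain ⟨convΓ, perΓ⟩ := period_Γ hl intΓ
  rw [integral_const_mul, integral_const_mul] at valΔ valΓ
  -- the four series
  have hI₁ : HasSum (fun n : ℕ => EllipticPeriods.I₁ l j (n + 1))
      (∫ q in Set.Ioo 0 EllipticPeriods.c, q ^ ((1 : ℝ) - 1) * (A q / q)) := by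
    refine hasSum_of_eq sA (fun n => ?_) rfl
    unfold EllipticPeriods.I₁
    rw [← Nat.cast_add_one, Real.rpow_natCast]
    ring
  have hI₂ : HasSum (fun n : ℕ => EllipticPeriods.I₂ l j n) (wronskianConst *
      ∫ q in Set.Ioo 0 EllipticPeriods.c, q ^ ((j : ℝ) / l - 1) * -Real.log q * B q) := by
    refine hasSum_of_eq (sBl.mul_left wronskianConst) (fun n => ?_) rfl
    have hn : (n : ℝ) + j / l ≠ 0 := by positivity
    unfold EllipticPeriods.I₂ wronskianConst
    field_simp
  have hJ₁ : HasSum (fun n : ℕ => EllipticPeriods.J₁ l j (n + 1))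
      (∫ q in Set.Ioo 0 EllipticPeriods.c, q ^ ((1 : ℝ) - 1) * -Real.log q * (A q / q)) := by
    refine hasSum_of_eq sAl (fun n => ?_) rfl
    unfold EllipticPeriods.J₁
    rw [← Nat.cast_add_one, Real.rpow_natCast, div_div]
    ring
  have hJ₂ : HasSum (fun n : ℕ => EllipticPeriods.J₂ l j n)
      (∫ q in Set.Ioo 0 EllipticPeriods.c, q ^ ((j : ℝ) / l - 1) * B q) := by
    refine hasSum_of_eq sB (fun n => ?_) rfl
    unfold EllipticPeriods.J₂
    ring
  have p27 : (27 : ℝ) ^ ((j : ℝ) / l) = 3 ^ (3 * (j : ℝ) / l) := by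
    rw [show (27 : ℝ) = 3 ^ (3 : ℝ) by norm_num, ← Real.rpow_mul (by norm_num)]
    congr 1; ring
  have pI : (3 : ℝ) ^ (3 * (j : ℝ) / l - 3) = 27 ^ ((j : ℝ) / l) / 27 := by
    rw [Real.rpow_sub (by norm_num), p27]; norm_num
  have pJ : (3 : ℝ) ^ (3 * (j : ℝ) / l - 7 / 2) = 27 ^ ((j : ℝ) / l) / (27 * √3) := by
    rw [Real.rpow_sub (by norm_num), p27, Real.sqrt_eq_rpow,
      show (7 / 2 : ℝ) = 3 + 1 / 2 by norm_num, Real.rpow_add (by norm_num)]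
    norm_num
  refine ⟨a_first l j, b_first l j, ⟨hI₁.summable, hI₂.summable, hJ₁.summable, hJ₂.summable⟩,
    convΔ, convΓ, ?_, ?_⟩
  · have e : 2 * Real.pi * ∫ t in Set.Ioo (0 : ℝ) 1, t ^ (j - 1) * hyp (1 - t ^ l) =
        54 * Real.pi / l * EllipticPeriods.I l j := by
      rw [valΔ, EllipticPeriods.I, hI₁.tsum_eq, hI₂.tsum_eq, pI]
      field_simp
      ring
    rw [perΔ, e]
    push_cast
    ring
  · have e : -(2 * Real.pi / √3) * ∫ t in Set.Ioo (0 : ℝ) 1, t ^ (j - 1) * hyp (t ^ l) =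
        -27 / l * EllipticPeriods.J l j := by
      rw [valΓ, EllipticPeriods.J, hJ₁.tsum_eq, hJ₂.tsum_eq, pJ]
      unfold wronskianConst
      field_simp
      ring
    rw [perΓ, e]
    push_cast
    ring
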